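/- **Setting.** Let $n\ge 2$, let $so(n)$ be the Lie algebra of skew-symmetric real $n\times n$ matrices with the scalar product $\langle X,Y\rangle=-\tfrac12\mathrm{tr}(XY)$, by which it is identified with $so(n)^*$, and put $x\wedge y=xy^T-yx^T$ for $x,y\in\mathbb R^n$. A balanced $n$-dimensional ball of mass $\mathsf m>0$ and radius $\rho>0$ rolls over a fixed sphere of radius $\sigma>0$, without slipping and twisting, in one of three ways: (i) over the outer surface; (ii) over the inner surface ($\rho<\sigma$); (iii) as a shell that contains the fixed sphere ($\sigma<\rho$). Put $D=\mathsf m\rho^2$ and $\epsilon=\sigma/(\sigma\pm\rho)$, with $+$ in case (i) and $-$ in cases (ii), (iii). Let $\mathbb I:so(n)\to so(n)$ be the inertia operator, symmetric and positive definite, and let $\mathbf I=\mathbb I+D\,\mathrm{Id}$. For a unit vector $\gamma$ let $\mathfrak v_\gamma=\mathbb R^n\wedge\gamma$, let $\mathfrak h_\gamma$ be its orthogonal complement in $so(n)$, and let $\mathrm{pr}_{\mathfrak h_\gamma}$ be the orthogonal projection. Identify $T^*SO(n)$ with $\{(m,g)\}=so(n)\times SO(n)$ by left translations, let $\varOmega$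 be its canonical symplectic form, $d=\dim SO(n)$, and write $\omega=\mathbf I^{-1}m$. The phase space and the reduced phase space are $$\mathcal G=\{(m,g,\gamma)\in T^*SO(n)\times S^{n-1}\mid \mathrm{pr}_{\mathfrak h_\gamma}\omega=0\},\qquad \mathcal G_0=\mathcal G/SO(n)=\{(m,\gamma)\in so(n)\times S^{n-1}\mid \mathrm{pr}_{\mathfrak h_\gamma}\omega=0\}.$$ The equations of motion on $\mathcal G$ are $$\dot m=[m,\omega]+\lambda_0,\qquad \dot g=g\omega,\qquad \dot\gamma=-\epsilon\,\omega\gamma,\tag{1}$$ where $\lambda_0\in\mathfrak h_\gamma$ is determined by $\mathrm{pr}_{\mathfrak h_\gamma}\mathbf I^{-1}([m,\omega]+\lambda_0)=0$. The reduced system on $\mathcal G_0$ is $$\dot m=[m,\omega]+\lambda_0,\qquad \dot\gamma=-\epsilon\,\omega\gamma.\tag{2}$$ **Restriction of a volume.** For a local orthonormal frame $\mathbf e_1,\dots,\mathbf e_{n-1},\gamma$ of $\mathbb R^n$, depending on $\gamma$, the spaces $\mathcal G$, $\mathcal G_0$ are the zero levels of the constraint functions $\phi_{ij}=\langle\omega,\mathbf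 e_i\wedge\mathbf e_j\rangle$, $1\le i<j\le n-1$. The restriction $\alpha|_{\mathcal G}$ (or $\alpha|_{\mathcal G_0}$) of a volume form $\alpha$ is the volume on that level induced by any form $\beta$ with $\alpha=\beta\wedge\bigwedge_{i<j}d\phi_{ij}$; up to sign it does not depend on the choices. **Theorem.** The flows of (1) on $\mathcal G$ and of (2) on $\mathcal G_0$ exist for all times, every initial condition determines exactly one solution, and for every $t$ the time-$t$ maps preserve the measures $$\mu_\epsilon(\gamma)\,\varOmega^d\wedge d\gamma|_{\mathcal G}\qquad\text{and}\qquad \mu_\epsilon(\gamma)\,dm\wedge d\gamma|_{\mathcal G_0},$$ respectively, where $dm$ and $d\gamma$ are the standard volumes of $so(n)$ and $S^{n-1}$ and $$\mu_\epsilon(\gamma)=\bigl(\det \mathbf I^{-1}|_{\mathfrak h_\gamma}\bigr)^{\frac1{2\epsilon}}.$$ Here $\mathbf I^{-1}|_{\mathfrak h_\gamma}$ is the operator $\mathrm{pr}_{\mathfrak h_\gamma}\circ\mathbf I^{-1}$ on $\mathfrak h_\gamma$, that is, $\mu_\epsilon$ is the power $1/(2\epsilon)$ of the determinant of the matrix $\langle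 \mathbf e_i\wedge\mathbf e_j,\mathbf I^{-1}(\mathbf e_k\wedge\mathbf e_l)\rangle$, $1\le i<j\le n-1$, $1\le k<l\le n-1$. -/

import Mathlib

open MeasureTheory
open scoped Matrix

noncomputable section

namespace RubberRolling

/-! ### The Lie algebra `so(n)` with the invariant scalar product `-½ tr(XY)` -/

/-- The Lie algebra `so(n)` of skew-symmetric real `n × n` matrices. (A type synonym of Mathlib's
`LieAlgebra.Orthogonal.so`, so that it can carry its own norm.) It is identified with its dual
by the scalar product `⟨X, Y⟩ = -½ tr(XY)`. -/
def So (n : ℕ) : Type := ↥(LieAlgebra.Orthogonal.so (Fin n) ℝ)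

variable {n : ℕ}

section LieStructure

attribute [local instance] LieRing.ofAssociativeRing

instance : LieRing (So n) := inferInstanceAs (LieRing ↥(LieAlgebra.Orthogonal.so (Fin n) ℝ))

instance : LieAlgebra ℝ (So n) :=
  inferInstanceAs (LieAlgebra ℝ ↥(LieAlgebra.Orthogonal.so (Fin n) ℝ))

instance : FiniteDimensional ℝ (So n) :=
  inferInstanceAs (FiniteDimensional ℝ ↥(LieAlgebra.Orthogonal.so (Fin n) ℝ))

/-- The underlying matrix. -/
def So.mat : So n →ₗ[ℝ] Matrix (Fin n) (Fin n) ℝ :=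
  (LieAlgebra.Orthogonal.so (Fin n) ℝ).toSubmodule.subtype

theorem So.mat_transpose (X : So n) : X.matᵀ = -X.mat :=
  (LieAlgebra.Orthogonal.mem_so (n := Fin n) (R := ℝ) X.mat).1 X.2

theorem So.mat_injective : Function.Injective (So.mat (n := n)) := Subtype.val_injective

theorem So.mat_bracket (X Y : So n) : (⁅X, Y⁆ : So n).mat = X.mat * Y.mat - Y.mat * X.mat := rfl

end LieStructure

theorem So.neg_half_trace_self (X : So n) :
    -(1 / 2 : ℝ) * (X.mat * X.mat).trace = (1 / 2 : ℝ) * ∑ i, ∑ j, X.mat i j ^ 2 := by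
  have h : ∀ i j, X.mat j i = -X.mat i j := fun i j => by
    have := congrFun (congrFun X.mat_transpose i) j
    simpa using this
  simp only [Matrix.trace, Matrix.diag, Matrix.mul_apply]
  rw [neg_mul, ← mul_neg, ← Finset.sum_neg_distrib]
  congr 1
  refine Finset.sum_congr rfl fun i _ => ?_
  rw [← Finset.sum_neg_distrib]
  refine Finset.sum_congr rfl fun j _ => ?_
  rw [h i j]
  ring

/-- The scalar product `⟨X, Y⟩ = -½ tr(XY)` on `so(n)`. -/
@[reducible]
def So.core : InnerProductSpace.Core ℝ (So n) where
  inner X Y := -(1 / 2 : ℝ) * (X.mat * Y.mat).trace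
  conj_inner_symm X Y := by
    simp [Matrix.trace_mul_comm X.mat Y.mat]
  re_inner_nonneg X := by
    change 0 ≤ -(1 / 2 : ℝ) * (X.mat * X.mat).trace
    rw [X.neg_half_trace_self]
    positivity
  add_left X Y Z := by
    simp only [map_add, Matrix.add_mul, Matrix.trace_add]
    ring
  smul_left X Y r := by
    simp only [map_smul, Matrix.smul_mul, Matrix.trace_smul, smul_eq_mul, conj_trivial]
    ring
  definite X h := by
    change -(1 / 2 : ℝ) * (X.mat * X.mat).trace = 0 at h
    rw [X.neg_half_trace_self] at h
    have h2 : ∑ i, ∑ j, X.mat i j ^ 2 = 0 := by linarith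
    apply So.mat_injective
    ext i j
    rw [Finset.sum_eq_zero_iff_of_nonneg (fun i _ => by positivity)] at h2
    have h3 := h2 i (Finset.mem_univ i)
    rw [Finset.sum_eq_zero_iff_of_nonneg (fun i _ => by positivity)] at h3
    simpa using h3 j (Finset.mem_univ j)

instance : NormedAddCommGroup (So n) := So.core.toNormedAddCommGroup

instance : InnerProductSpace ℝ (So n) := InnerProductSpace.ofCore So.core.toCore

instance : MeasurableSpace (So n) := borel _

instance : BorelSpace (So n) := ⟨rfl⟩

theorem So.inner_def (X Y : So n) : inner ℝ X Y = -(1 / 2 : ℝ) * (X.mat * Y.mat).trace := rfl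

/-- `ℝⁿ` with its Euclidean structure. -/
abbrev E (n : ℕ) : Type := EuclideanSpace ℝ (Fin n)

/-- The unit sphere `S^{n-1}` in `ℝⁿ`. -/
abbrev Sph (n : ℕ) : Type := ↥(Metric.sphere (0 : E n) 1)

/-- The rotation group `SO(n)`. -/
abbrev SO (n : ℕ) : Type := ↥(Matrix.specialOrthogonalGroup (Fin n) ℝ)

instance : MeasurableSpace (SO n) := borel _

instance : BorelSpace (SO n) := ⟨rfl⟩

/-- The product `ω γ` of a skew-symmetric matrix with a column. -/
def So.act (ω : So n) (x : E n) : E n := WithLp.toLp 2 (ω.mat *ᵥ x.ofLp)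

/-- `x ∧ y = x yᵀ - y xᵀ`. -/
def wedge (x y : E n) : So n :=
  ⟨Matrix.vecMulVec x.ofLp y.ofLp - Matrix.vecMulVec y.ofLp x.ofLp, by
    rw [LieAlgebra.Orthogonal.mem_so]
    ext i j
    simp [Matrix.vecMulVec_apply, mul_comm]⟩

/-- `𝔳_γ = ℝⁿ ∧ γ`. -/
def vSpace (γ : E n) : Submodule ℝ (So n) := Submodule.span ℝ (Set.range fun x => wedge x γ)

/-- `𝔥_γ`, the orthogonal complement of `𝔳_γ` in `so(n)`. For orthonormal `e₁, …, e_{n-1}, γ`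
it has the orthonormal basis `eᵢ ∧ eⱼ`, `1 ≤ i < j ≤ n-1`. -/
def hSpace (γ : E n) : Submodule ℝ (So n) := (vSpace γ)ᗮ

/-! ### Restriction of a volume to the zero level of a family of linear constraints -/

section Restriction

variable {V : Type*} [NormedAddCommGroup V] [InnerProductSpace ℝ V] [FiniteDimensional ℝ V]
  [MeasurableSpace V] [BorelSpace V]

/-- Let `φ : V → H` be a surjective linear map of Euclidean spaces, with components
`φ₁, …, φ_k` in an orthonormal basis of `H`. The volume form `dm` of `V` can be written as
`dm = σ ∧ dφ₁ ∧ ⋯ ∧ dφ_k`, and `σ` restricts to a volume form on the level `φ = 0` that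
does not depend on the choice of `σ` or (up to sign) of the orthonormal basis. `fibreMeasure φ` is
the measure on `V`, carried by `ker φ`, of this (Leray, or Gelfand-Leray) restriction of `dm`:
the Euclidean volume of `ker φ`, divided by the `k`-volume factor
`‖∇φ₁ ∧ ⋯ ∧ ∇φ_k‖ = √det(φ φ*)`. -/
def fibreMeasure {H : Type*} [NormedAddCommGroup H] [InnerProductSpace ℝ H]
    [FiniteDimensional ℝ H] (φ : V →ₗ[ℝ] H) : Measure V :=
  ENNReal.ofReal (1 / Real.sqrt (LinearMap.det (φ ∘ₗ LinearMap.adjoint φ))) •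
    (volume : Measure (LinearMap.ker φ)).map Subtype.val

/-- The restriction of the volume `dm ⊗ dβ` on `V × B` to the common zero level
`{(m, b) | φ_b(m) = 0}` of the constraints `φ_b : V → H_b`, linear in `m`: fibrewise the measure
`fibreMeasure (φ b)`. It is carried by that level. When a flow preserves a
volume on `V × B` and the components of `φ` are first integrals, the measure induced on
the zero level is this one. -/
def restrictToZeroLevel {B : Type*} [MeasurableSpace B] (β : Measure B)
    (H : B → Submodule ℝ V) (φ : ∀ b, V →ₗ[ℝ] H b) : Measure (V × B) :=
  β.bind fun b => (fibreMeasure (φ b)).map fun m => (m, b)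

end Restriction

/-! ### The canonical symplectic structure of `T*SO(n)` -/

/-- The canonical symplectic form `Ω = -dθ` of `T*SO(n)` at `(g, m)`, where `T*SO(n)` is
identified with `SO(n) × so(n)` by left translations and the scalar product, so that
`θ(gξ, η) = ⟨m, ξ⟩`. The tangent vector `(gξ, η)` is represented by `(ξ, η)`. -/
def canonicalSymplectic (m : So n) (a b : So n × So n) : ℝ :=
  inner ℝ a.1 b.2 - inner ℝ a.2 b.1 + inner ℝ m ⁅a.1, b.1⁆

/-- The frame `(gb₁, 0), …, (gb_d, 0), (0, b₁), …, (0, b_d)` of `T*SO(n)`, with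
`b₁, …, b_d` an orthonormal basis of `so(n)`, in the left trivialization. -/
def frame (n : ℕ) :
    Fin (Module.finrank ℝ (So n)) ⊕ Fin (Module.finrank ℝ (So n)) → So n × So n :=
  Sum.elim (fun i => (stdOrthonormalBasis ℝ (So n) i, 0))
    (fun i => (0, stdOrthonormalBasis ℝ (So n) i))

/-- The absolute value of `Ω^d`, `d = dim SO(n)`, on the frame `frame n` at `(g, m)`. For a
two-form `Ω` with Gram matrix `A` in a frame of `2d` vectors, `Ω^d` takes on that frame the value
`d! Pf(A)`, and `Pf(A)² = det A`. -/
def liouvilleDensity (m : So n) : ℝ :=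
  (Module.finrank ℝ (So n)).factorial *
    Real.sqrt |(Matrix.of fun i j => canonicalSymplectic m (frame n i) (frame n j)).det|

/-! ### Invariant measures of a system of differential equations -/

/-- `μ` is an invariant measure of the system on `X` whose solutions `ℝ → X` are singled out
by `Sol`: through each point there is exactly one solution, defined for all times, and
each time-`t` map of the flow preserves `μ`. -/
structure IsInvariantMeasure {X : Type*} [MeasurableSpace X] (Sol : (ℝ → X) → Prop)
    (μ : Measure X) : Prop where
  existsUnique_solution : ∀ x, ∃! c : ℝ → X, Sol c ∧ c 0 = x
  measurePreserving : ∀ Φ : ℝ → X → X, (∀ x, Sol (fun t => Φ t x) ∧ Φ 0 x = x) →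
    ∀ t, MeasurePreserving (Φ t) μ μ

/-! ### The rubber Chaplygin ball over a sphere -/

/-- The three variants of the problem. -/
inductive RollingKind where
  /-- over the outer surface of the fixed sphere -/
  | outer
  /-- over the inner surface of the fixed sphere -/
  | inner
  /-- the ball is a shell that contains the fixed sphere, and rolls over its outer surface -/
  | shell

/-- The data of an `n`-dimensional balanced ball that rolls over a fixed sphere in `ℝⁿ`. -/
structure RubberBall (n : ℕ) where
  /-- variant of the problem -/
  kind : RollingKind
  /-- mass of the rolling ball -/
  mass : ℝ
  /-- radius of the rolling ball -/
  ρ : ℝ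
  /-- radius of the fixed sphere -/
  σ : ℝ
  mass_pos : 0 < mass
  ρ_pos : 0 < ρ
  σ_pos : 0 < σ
  inner_lt : kind = RollingKind.inner → ρ < σ
  shell_lt : kind = RollingKind.shell → σ < ρ
  /-- the inertia operator `𝕀`, which defines a left-invariant metric on `SO(n)` -/
  inertia : So n →ₗ[ℝ] So n
  inertia_symm : inertia.IsSymmetric
  inertia_pos : ∀ X : So n, X ≠ 0 → 0 < inner ℝ (inertia X) X

namespace RubberBall

variable (S : RubberBall n)

/-- `ε = σ / (σ ± ρ)`, with the sign `+` when the ball rolls over the outer surface and does not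
contain the fixed sphere, and `-` otherwise. -/
def ε : ℝ :=
  match S.kind with
  | RollingKind.outer => S.σ / (S.σ + S.ρ)
  | RollingKind.inner => S.σ / (S.σ - S.ρ)
  | RollingKind.shell => S.σ / (S.σ - S.ρ)

/-- `D = mρ²`. -/
def D : ℝ := S.mass * S.ρ ^ 2

/-- The modified inertia operator `𝐈 = 𝕀 + D · Id`. -/
def modifiedInertia : So n →ₗ[ℝ] So n := S.inertia + S.D • LinearMap.id

theorem modifiedInertia_injective : Function.Injective S.modifiedInertia := by
  rw [← LinearMap.ker_eq_bot, LinearMap.ker_eq_bot']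
  intro X hX
  by_contra h
  have h1 := S.inertia_pos X h
  have h2 : 0 ≤ inner ℝ X X := real_inner_self_nonneg
  have h3 : 0 < S.D := mul_pos S.mass_pos (pow_pos S.ρ_pos 2)
  have h4 : inner ℝ (S.modifiedInertia X) X = 0 := by rw [hX, inner_zero_left]
  simp only [modifiedInertia, LinearMap.add_apply, LinearMap.smul_apply, LinearMap.id_apply,
    inner_add_left, real_inner_smul_left] at h4
  nlinarith [mul_nonneg h3.le h2]

/-- `𝐈` as a linear isomorphism. -/
def modifiedInertiaEquiv : So n ≃ₗ[ℝ] So n :=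
  LinearEquiv.ofInjectiveEndo S.modifiedInertia S.modifiedInertia_injective

/-- The angular velocity `ω = 𝐈⁻¹ m` in the body frame. -/
def angularVelocity : So n →ₗ[ℝ] So n := S.modifiedInertiaEquiv.symm.toLinearMap

/-- `m ↦ pr_{𝔥_γ} 𝐈⁻¹ m`. Its components in the orthonormal basis `eᵢ ∧ eⱼ` of `𝔥_γ` are the
no-twist constraint functions `φᵢⱼ = ⟨ω, eᵢ ∧ eⱼ⟩`. -/
def twist (γ : E n) : So n →ₗ[ℝ] hSpace γ :=
  (hSpace γ).orthogonalProjectionOnto.toLinearMap ∘ₗ S.angularVelocity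

/-- The density `μ_ε(γ) = (det 𝐈⁻¹|_{𝔥_γ})^{1/(2ε)}`; here `𝐈⁻¹|_{𝔥_γ}` is the operator of the
quadratic form of `𝐈⁻¹` on `𝔥_γ`, with matrix `⟨eᵢ ∧ eⱼ, 𝐈⁻¹(e_k ∧ e_l)⟩`. -/
def density (γ : E n) : ℝ :=
  (LinearMap.det (S.twist γ ∘ₗ (hSpace γ).subtype)) ^ (1 / (2 * S.ε))

/-- The points of `T*SO(n) × S^{n-1}` in the left trivialization, as `(m, g, γ)`. -/
abbrev Ambient (n : ℕ) : Type := So n × SO n × Sph n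

/-- The phase space `𝒢 = {(m, g, γ) | pr_{𝔥_γ} ω = 0}`. -/
def phaseSpace : Set (Ambient n) := {x | S.twist (x.2.2 : E n) x.1 = 0}

/-- The reduced phase space `𝒢₀ = 𝒢 / SO(n) = {(m, γ) | pr_{𝔥_γ} ω = 0}`. -/
def reducedPhaseSpace : Set (So n × Sph n) := {x | S.twist (x.2 : E n) x.1 = 0}

/-- `v = [m, ω] + λ₀`, where `λ₀ ∈ 𝔥_γ` is the Lagrange multiplier, determined by
`pr_{𝔥_γ} 𝐈⁻¹([m, ω] + λ₀) = 0`. -/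
def IsMomentumVelocity (m : So n) (γ : E n) (v : So n) : Prop :=
  ∃ l ∈ hSpace γ, v = ⁅m, S.angularVelocity m⁆ + l ∧ S.twist γ v = 0

/-- The curve `(m(t), g(t), γ(t))` in `𝒢` solves the equations of the rubber rolling,
`ṁ = [m, ω] + λ₀`, `ġ = gω`, `γ̇ = -ε ω γ`. -/
def IsSolution (c : ℝ → S.phaseSpace) : Prop :=
  ∀ t,
    (∃ v, S.IsMomentumVelocity (c t).1.1 (c t).1.2.2 v ∧ HasDerivAt (fun s => (c s).1.1) v t) ∧
    (∀ i j, HasDerivAt (fun s => ((c s).1.2.1 : Matrix (Fin n) (Fin n) ℝ) i j)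
      ((((c t).1.2.1 : Matrix (Fin n) (Fin n) ℝ) * (S.angularVelocity (c t).1.1).mat) i j) t) ∧
    HasDerivAt (fun s => ((c s).1.2.2 : E n))
      (-S.ε • (S.angularVelocity (c t).1.1).act (c t).1.2.2) t

/-- The curve `(m(t), γ(t))` in `𝒢₀` solves the reduced equations
`ṁ = [m, ω] + λ₀`, `γ̇ = -ε ω γ`. -/
def IsReducedSolution (c : ℝ → S.reducedPhaseSpace) : Prop :=
  ∀ t,
    (∃ v, S.IsMomentumVelocity (c t).1.1 (c t).1.2 v ∧ HasDerivAt (fun s => (c s).1.1) v t) ∧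
    HasDerivAt (fun s => ((c s).1.2 : E n))
      (-S.ε • (S.angularVelocity (c t).1.1).act (c t).1.2) t

/-- The standard volume `dγ` of `S^{n-1}`. -/
def sphereVolume (n : ℕ) : Measure (Sph n) := (volume : Measure (E n)).toSphere

/-- The measure `μ_ε(γ) Ω^d ∧ dγ |_𝒢`, as a measure on `T*SO(n) × S^{n-1}` carried by `𝒢`.
The Haar measure `ν` of `SO(n)` stands for the invariant volume `dg`, and on `T*SO(n)` one has
`|Ω^d| = liouvilleDensity m · dm ⊗ dg`. -/
def phaseVolume (ν : Measure (SO n)) : Measure (Ambient n) :=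
  (restrictToZeroLevel (ν.prod (sphereVolume n)) (fun b => hSpace (b.2 : E n))
    (fun b => S.twist (b.2 : E n))).withDensity
      fun x => ENNReal.ofReal (S.density (x.2.2 : E n) * liouvilleDensity x.1)

/-- The measure `μ_ε(γ) dm ∧ dγ |_𝒢₀`, as a measure on `so(n) × S^{n-1}` carried by `𝒢₀`. -/
def reducedVolume : Measure (So n × Sph n) :=
  (restrictToZeroLevel (sphereVolume n) (fun γ => hSpace (γ : E n))
    (fun γ => S.twist (γ : E n))).withDensity
      fun x => ENNReal.ofReal (S.density (x.2 : E n))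

end RubberBall

end RubberRolling

end

/-! Write `ω = 𝐈⁻¹m`. The constraint says that `ω` lies in `𝔳_γ`, that is, `ω = x ∧ γ` with `x =
ωγ`. The multiplier `λ₀ ∈ 𝔥_γ` annihilates `γ`, so evaluating `𝐈ω̇ = [m, ω] + λ₀` at `γ` eliminates
it. What remains is `B_γ a = [𝐈ω, ω]γ` for `a = ω̇γ`, where `B_γ h = 𝐈(h ∧ γ)γ + ⟨γ, h⟩γ` is
symmetric and positive definite on `ℝⁿ` for every `γ ≠ 0`. The reduced system thus extends to the
vector field `ẋ = a - εωx`, `γ̇ = -εωγ` on an open subset of the linear space `ℝⁿ × ℝⁿ`, where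
Lebesgue measure and the ordinary divergence are available (`field`). It has the first integrals
`|γ|²`, `⟨x, γ⟩` and the energy, whose bounds cut out compact invariant sets. This gives global
existence.

The heart is a pair of trace computations. Put `u = ωγ` and `τ = tr(B_γ⁻¹ ∘ (h ↦ 𝐈(h ∧ γ)u))`. The
divergence of the field is `τ` (`trace_fderiv_field`, `trace_accelDeriv`), all other contributions
being traces of skew operators, of products of a skew and a symmetric operator, or of operators of
rank one that vanish because `⟨γ, B_γ⁻¹u⟩ = 0`. Along the flow `log det B_γ` has the derivative
`-2ετ` (`trace_bopInv_bopDeriv`), the `2` coming from two mutually adjoint terms. Hence `(det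
B_γ)^{1/(2ε)}`, times any function of the first integrals, is an invariant density
(`trace_fderiv_weight_smul_field`). Jacobi's identity for complementary minors gives `det B_γ = det
𝐈 · det(𝐈⁻¹|𝔥_γ)` for a unit `γ` (`det_bop_eq`), so this density is `μ_ε` up to a constant.

To return to the phase space, the weighted Lebesgue measure is pushed forward by `(x, γ) ↦ (𝐈(x ∧
γ), γ/|γ|)`, which carries solutions to solutions. The same identity for `𝐈²` shows that the
Jacobian on each fibre is the factor of the restricted volume up to a constant (`map_fibreEquiv`),
so that the image is a constant multiple of the reduced measure, cut off in the energy
(`lintegral_weight`). Exhausting by energy sublevels removes the cutoff.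

For the full system, `Ω^d` has the constant density `d!`, and by left invariance the flow is a skew
product over the reduced flow that acts on `SO(n)` by right translations. These preserve the Haar
measure, as `SO(n)` is compact (`measurePreserving_flow`). -/

noncomputable section

open Filter Topology NNReal

/-! ### Global flows of bounded Lipschitz vector fields -/

section Flow

variable {F : Type*} [NormedAddCommGroup F] [NormedSpace ℝ F]

/-- `Φ` is a global flow of the vector field `Y`. -/
structure IsGlobalFlow (Y : F → F) (Φ : ℝ → F → F) : Prop where
  zero : ∀ z, Φ 0 z = z
  hasDerivAt : ∀ z t, HasDerivAt (fun s => Φ s z) (Y (Φ t z)) t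

theorem eq_of_hasDerivAt_of_lipschitzWith {Y : F → F} {K : ℝ≥0} (hY : LipschitzWith K Y)
    {f g : ℝ → F} (hf : ∀ t, HasDerivAt f (Y (f t)) t) (hg : ∀ t, HasDerivAt g (Y (g t)) t)
    (h0 : f 0 = g 0) : f = g :=
  ODE_solution_unique_univ (v := fun _ => Y) (s := fun _ => Set.univ) (t₀ := 0)
    (fun _ => hY.lipschitzOnWith) (fun t => ⟨hf t, trivial⟩) (fun t => ⟨hg t, trivial⟩) h0

/-- Boundedness confines a solution up to time `N + 1` to a ball of radius `L (N + 1)`, so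
Picard–Lindelöf applies on the whole interval. The solutions on growing intervals agree by
uniqueness and are glued. -/
theorem exists_hasDerivAt_of_lipschitzWith_of_bounded [CompleteSpace F] {Y : F → F} {K L : ℝ≥0}
    (hY : LipschitzWith K Y) (hL : ∀ z, ‖Y z‖ ≤ L) (z : F) :
    ∃ f : ℝ → F, f 0 = z ∧ ∀ t, HasDerivAt f (Y (f t)) t := by
  have key : ∀ N : ℕ, ∃ f : ℝ → F, f 0 = z ∧
      ∀ t ∈ Set.Ioo (-(N + 1 : ℝ)) (N + 1), HasDerivAt f (Y (f t)) t := by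
    intro N
    have hmem : (0 : ℝ) ∈ Set.Icc (-(N + 1 : ℝ)) (N + 1) := by
      constructor <;> linarith [N.cast_nonneg (α := ℝ)]
    have hP : IsPicardLindelof (fun _ => Y) (⟨0, hmem⟩ : Set.Icc (-(N + 1 : ℝ)) (N + 1)) z
        (L * (N + 1)) 0 L K := by
      refine IsPicardLindelof.of_time_independent (fun x _ => hL x) hY.lipschitzOnWith ?_
      push_cast
      simp
    obtain ⟨f, hf0, hf⟩ := hP.exists_eq_forall_mem_Icc_hasDerivWithinAt₀
    refine ⟨f, hf0, fun t ht => (hf t (Set.Ioo_subset_Icc_self ht)).hasDerivAt ?_⟩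
    exact Icc_mem_nhds ht.1 ht.2
  choose f hf0 hf using key
  have huniq : ∀ N M : ℕ, N ≤ M → ∀ s : ℝ, |s| < N + 1 → f N s = f M s := by
    intro N M hNM s hs
    have hNM' : (N : ℝ) ≤ M := by exact_mod_cast hNM
    refine ODE_solution_unique_of_mem_Ioo (v := fun _ => Y) (s := fun _ => Set.univ)
      (a := -(N + 1 : ℝ)) (b := N + 1) (t₀ := 0) (fun _ _ => hY.lipschitzOnWith) ?_
      (fun t ht => ⟨hf N t ht, trivial⟩) (fun t ht => ⟨hf M t ⟨?_, ?_⟩, trivial⟩)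
      ((hf0 N).trans (hf0 M).symm) (abs_lt.1 hs)
    · constructor <;> linarith [N.cast_nonneg (α := ℝ)]
    · linarith [ht.1]
    · linarith [ht.2]
  have hall : ∀ M : ℕ, ∀ s : ℝ, |s| < M + 1 → f ⌈|s|⌉₊ s = f M s := by
    intro M s hs
    have h1 : |s| < (⌈|s|⌉₊ : ℝ) + 1 := lt_of_le_of_lt (Nat.le_ceil _) (by linarith)
    rcases le_total ⌈|s|⌉₊ M with h | h
    · exact huniq _ _ h s h1
    · exact (huniq _ _ h s hs).symm
  -- The index `⌈|s|⌉` is admissible because `|s| < ⌈|s|⌉ + 1`. Near a given `t` it may be replaced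
  -- by one fixed `M > |t|`, which gives the derivative.
  refine ⟨fun s => f ⌈|s|⌉₊ s, hf0 _, fun t => ?_⟩
  obtain ⟨M, hM⟩ := exists_nat_gt |t|
  have hM1 : |t| < M + 1 := by linarith
  have hev : (fun s : ℝ => f ⌈|s|⌉₊ s) =ᶠ[𝓝 t] fun s : ℝ => f M s := by
    have : ∀ᶠ s : ℝ in 𝓝 t, |s| < (M : ℝ) + 1 := continuous_abs.continuousAt.eventually_lt_const hM1
    filter_upwards [this] with s hs using hall M s hs
  simp only [hall M t hM1]
  exact (hf M t (abs_lt.1 hM1)).congr_of_eventuallyEq hev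

theorem exists_isGlobalFlow [CompleteSpace F] {Y : F → F} {K L : ℝ≥0}
    (hY : LipschitzWith K Y) (hL : ∀ z, ‖Y z‖ ≤ L) : ∃ Φ, IsGlobalFlow Y Φ := by
  choose f hf0 hf using exists_hasDerivAt_of_lipschitzWith_of_bounded hY hL
  exact ⟨fun t z => f z t, hf0, hf⟩

namespace IsGlobalFlow

variable {Y : F → F} {Φ : ℝ → F → F} {K : ℝ≥0}

theorem map_add (h : IsGlobalFlow Y Φ) (hY : LipschitzWith K Y) (t s : ℝ) (z : F) :
    Φ (t + s) z = Φ t (Φ s z) := by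
  have := eq_of_hasDerivAt_of_lipschitzWith hY (f := fun t => Φ (t + s) z)
    (g := fun t => Φ t (Φ s z))
    (fun t => by simpa using (h.hasDerivAt z (t + s)).comp_add_const t s)
    (fun t => h.hasDerivAt _ t) (by simp [h.zero])
  exact congrFun this t

theorem neg (h : IsGlobalFlow Y Φ) : IsGlobalFlow (-Y) (fun t => Φ (-t)) where
  zero z := by simp [h.zero]
  hasDerivAt z t := by
    have := (h.hasDerivAt z (-t)).scomp t (hasDerivAt_neg t)
    simpa [Function.comp_def] using this

theorem exists_lipschitzWith_of_nonneg (h : IsGlobalFlow Y Φ) (hY : LipschitzWith K Y) {t : ℝ}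
    (ht : 0 ≤ t) : ∃ C, LipschitzWith C (Φ t) := by
  refine ⟨⟨Real.exp (K * t), (Real.exp_pos _).le⟩, LipschitzWith.of_dist_le_mul fun x y => ?_⟩
  have hc : ∀ z, ContinuousOn (fun s => Φ s z) (Set.Icc 0 t) := fun z s _ =>
    (h.hasDerivAt z s).continuousAt.continuousWithinAt
  have := dist_le_of_trajectories_ODE (v := fun _ => Y) (δ := dist x y) (fun _ => hY) (hc x)
    (fun s _ => (h.hasDerivAt x s).hasDerivWithinAt) (hc y)
    (fun s _ => (h.hasDerivAt y s).hasDerivWithinAt) (by simp [h.zero]) t ⟨ht, le_rfl⟩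
  rw [mul_comm]
  rwa [sub_zero] at this

theorem exists_lipschitzWith (h : IsGlobalFlow Y Φ) (hY : LipschitzWith K Y) (t : ℝ) :
    ∃ C, LipschitzWith C (Φ t) := by
  rcases le_total 0 t with ht | ht
  · exact h.exists_lipschitzWith_of_nonneg hY ht
  · have hY' : LipschitzWith K (-Y) := hY.neg
    simpa using h.neg.exists_lipschitzWith_of_nonneg hY' (neg_nonneg.2 ht)

theorem dist_le (h : IsGlobalFlow Y Φ) {L : ℝ≥0} (hL : ∀ z, ‖Y z‖ ≤ L) (z : F) (s t : ℝ) :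
    dist (Φ s z) (Φ t z) ≤ L * dist s t :=
  (lipschitzWith_of_nnnorm_deriv_le (f := fun s => Φ s z) (C := L)
    (fun s => (h.hasDerivAt z s).differentiableAt)
    (fun s => by rw [(h.hasDerivAt z s).deriv]; exact hL _)).dist_le_mul s t

end IsGlobalFlow

end Flow

/-! ### Liouville's theorem with Lipschitz test functions -/

section Liouville

variable {F : Type*} [NormedAddCommGroup F] [NormedSpace ℝ F] [FiniteDimensional ℝ F]
  [MeasurableSpace F] [BorelSpace F]

/-- Integration by parts in each coordinate moves the derivative from `g` to `W`, and the sum over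
the coordinates is the divergence of `W`. By Rademacher's theorem Lipschitz regularity of `g` is
enough; this class is stable under composition with the flow. -/
theorem integral_fderiv_apply_eq_zero_of_trace_eq_zero (μ : Measure F) [μ.IsAddHaarMeasure]
    {W : F → F} (hW : ContDiff ℝ 1 W) (hWc : HasCompactSupport W)
    (htr : ∀ z, LinearMap.trace ℝ F (fderiv ℝ W z) = 0) {g : F → ℝ} {C : ℝ≥0}
    (hg : LipschitzWith C g) : ∫ z, fderiv ℝ g z (W z) ∂μ = 0 := by
  classical
  let b := Module.finBasis ℝ F
  let p : ∀ i, F →L[ℝ] ℝ := fun i => (b.coord i).toContinuousLinearMap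
  have hpc : ∀ i, ContDiff ℝ 1 (fun z => p i (W z)) := fun i => (p i).contDiff.comp hW
  have hps : ∀ i, HasCompactSupport (fun z => p i (W z)) := fun i =>
    hWc.comp_left (g := p i) (map_zero _)
  have hpd : ∀ i z v, lineDeriv ℝ (fun z => p i (W z)) z v = p i (fderiv ℝ W z v) := by
    intro i z v
    have h1 : HasFDerivAt (fun z => p i (W z)) ((p i).comp (fderiv ℝ W z)) z :=
      (p i).hasFDerivAt.comp z (hW.differentiable one_ne_zero z).hasFDerivAt
    rw [h1.differentiableAt.lineDeriv_eq_fderiv, h1.fderiv]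
    rfl
  have hsum : ∀ᵐ z ∂μ, fderiv ℝ g z (W z) = ∑ i, lineDeriv ℝ g z (b i) * p i (W z) := by
    filter_upwards [hg.ae_differentiableAt (μ := μ)] with z hz
    conv_lhs => rw [← b.sum_repr (W z), map_sum]
    refine Finset.sum_congr rfl fun i _ => ?_
    rw [map_smul, hz.lineDeriv_eq_fderiv, smul_eq_mul, mul_comm]
    rfl
  have hint : ∀ i, Integrable (fun z => lineDeriv ℝ g z (b i) * p i (W z)) μ := by
    intro i
    have h1 := hg.memLp_lineDeriv (μ := μ) (b i)
    have h2 : Integrable (fun z => p i (W z)) μ :=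
      (hpc i).continuous.integrable_of_hasCompactSupport (hps i)
    exact h2.bdd_mul (c := C * ‖b i‖) h1.1
      (Eventually.of_forall fun z => norm_lineDeriv_le_of_lipschitz ℝ hg)
  have hint' : ∀ i, Integrable (fun z => lineDeriv ℝ (fun z => p i (W z)) z (-b i) * g z) μ := by
    intro i
    simp_rw [hpd]
    refine Continuous.integrable_of_hasCompactSupport ?_ ?_
    · exact ((p i).continuous.comp ((hW.continuous_fderiv one_ne_zero).clm_apply
        continuous_const)).mul hg.continuous
    · refine HasCompactSupport.mul_right ?_
      exact (hWc.fderiv ℝ).comp_left (g := fun T : F →L[ℝ] F => p i (T (-b i))) (by simp)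
  rw [integral_congr_ae hsum, integral_finsetSum _ fun i _ => hint i]
  have hparts : ∀ i, ∫ z, lineDeriv ℝ g z (b i) * p i (W z) ∂μ =
      ∫ z, lineDeriv ℝ (fun z => p i (W z)) z (-b i) * g z ∂μ := by
    intro i
    obtain ⟨D, hD⟩ := (hpc i).lipschitzWith_of_hasCompactSupport (hps i) one_ne_zero
    exact hg.integral_lineDeriv_mul_eq hD (hps i) (b i)
  simp_rw [hparts]
  rw [← integral_finsetSum _ fun i _ => hint' i]
  have : ∀ z, ∑ i, lineDeriv ℝ (fun z => p i (W z)) z (-b i) * g z = 0 := by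
    intro z
    have h1 : ∑ i, p i (fderiv ℝ W z (b i)) = 0 := by
      rw [← htr z, LinearMap.trace_eq_matrix_trace ℝ b]
      simp only [Matrix.trace, Matrix.diag, LinearMap.toMatrix_apply]
      rfl
    simp_rw [hpd, map_neg]
    rw [← Finset.sum_mul, Finset.sum_neg_distrib, h1]
    simp
  simp [this]

/-- The time derivative of the left side is the integral of `d(f ∘ Φ t)` along `J Y`, which vanishes
by the previous lemma. Only the Lipschitz dependence of the flow on the initial point enters, not
its differentiability. -/
theorem IsGlobalFlow.integral_comp_mul_eq (μ : Measure F) [μ.IsAddHaarMeasure] {Y : F → F}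
    {Φ : ℝ → F → F} {K L : ℝ≥0} (hΦ : IsGlobalFlow Y Φ) (hY : LipschitzWith K Y)
    (hL : ∀ z, ‖Y z‖ ≤ L) {J : F → ℝ} (hJ : Continuous J) (hJc : HasCompactSupport J)
    (hW : ContDiff ℝ 1 fun z => J z • Y z)
    (htr : ∀ z, LinearMap.trace ℝ F (fderiv ℝ (fun z => J z • Y z) z) = 0)
    {f : F → ℝ} {C : ℝ≥0} (hf : LipschitzWith C f) (t : ℝ) :
    ∫ z, f (Φ t z) * J z ∂μ = ∫ z, f z * J z ∂μ := by
  have hder : ∀ t, HasDerivAt (fun s => ∫ z, f (Φ s z) * J z ∂μ) 0 t := by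
    intro t
    obtain ⟨Ct, hCt⟩ := hΦ.exists_lipschitzWith hY t
    have hg : LipschitzWith (C * Ct) (fun z => f (Φ t z)) := hf.comp hCt
    set g := fun z => f (Φ t z) with hgdef
    have hz := integral_fderiv_apply_eq_zero_of_trace_eq_zero μ hW
      (hJc.smul_right (f' := Y)) htr hg
    have hcont : ∀ s, Continuous (fun z => g (Φ s z) * J z) := fun s => by
      obtain ⟨D, hD⟩ := hΦ.exists_lipschitzWith hY s
      exact (hg.continuous.comp hD.continuous).mul hJ
    -- It suffices to differentiate at time `0` for `g = f ∘ Φ t`: there the derivative of `g` is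
    -- needed at `z` itself, where it exists almost everywhere. The group law then shifts the result
    -- to time `t`.
    have hmain : HasDerivAt (fun s => ∫ z, g (Φ s z) * J z ∂μ)
        (∫ z, fderiv ℝ g z (J z • Y z) ∂μ) 0 := by
      refine (hasDerivAt_integral_of_dominated_loc_of_lip
        (bound := fun z => (C * Ct * L : ℝ) * |J z|) univ_mem
        (Eventually.of_forall fun s => (hcont s).aestronglyMeasurable)
        ((hcont 0).integrable_of_hasCompactSupport hJc.mul_left) ?_ ?_ ?_ ?_).2
      · have : Measurable fun z => fderiv ℝ g z := measurable_fderiv ℝ g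
        exact (isBoundedBilinearMap_apply.continuous.measurable.comp
          (this.prodMk hW.continuous.measurable)).aestronglyMeasurable
      · refine Eventually.of_forall fun z => LipschitzOnWith.of_dist_le_mul fun s _ s' _ => ?_
        rw [Real.dist_eq, ← sub_mul, abs_mul, ← Real.dist_eq]
        have h1 := hg.dist_le_mul (Φ s z) (Φ s' z)
        have h2 := hΦ.dist_le hL z s s'
        have h3 : dist (g (Φ s z)) (g (Φ s' z)) ≤ (C * Ct) * (L * dist s s') :=
          h1.trans (by push_cast; gcongr)
        have h4 : ((Real.nnabs ((C * Ct * L : ℝ) * |J z|) : ℝ≥0) : ℝ) = (C * Ct * L : ℝ) * |J z| := by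
          rw [Real.coe_nnabs, abs_of_nonneg (by positivity)]
        rw [h4]
        calc _ ≤ ((C * Ct) * (L * dist s s')) * |J z| := by gcongr
          _ = _ := by ring
      · exact ((hJ.abs).integrable_of_hasCompactSupport hJc.norm).const_mul _
      · filter_upwards [hg.ae_differentiableAt (μ := μ)] with z hz
        have h1 : HasDerivAt (fun s => g (Φ s z)) (fderiv ℝ g z (Y z)) 0 := by
          have hz' : HasFDerivAt g (fderiv ℝ g z) (Φ 0 z) := by
            rw [hΦ.zero]; exact hz.hasFDerivAt
          have := hz'.comp_hasDerivAt (0 : ℝ) (hΦ.hasDerivAt z 0)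
          rwa [hΦ.zero] at this
        have := h1.mul_const (J z)
        rw [map_smul, smul_eq_mul, mul_comm]
        exact this
    rw [hz] at hmain
    have heq : (fun s => ∫ z, f (Φ s z) * J z ∂μ) =
        fun s => (fun s => ∫ z, g (Φ s z) * J z ∂μ) (s - t) := by
      funext s
      simp only [hgdef, ← hΦ.map_add hY, add_sub_cancel]
    rw [heq]
    have := HasDerivAt.comp_sub_const (f := fun s => ∫ z, g (Φ s z) * J z ∂μ) t t
      (by simpa using hmain)
    simpa using this
  have := is_const_of_deriv_eq_zero (fun t => (hder t).differentiableAt)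
    (fun t => (hder t).deriv) t 0
  simpa [hΦ.zero] using this

/-- Liouville's theorem: the flow of `Y` preserves the density `J` if `J Y` is divergence free. -/
theorem IsGlobalFlow.measurePreserving_withDensity (μ : Measure F) [μ.IsAddHaarMeasure]
    {Y : F → F} {Φ : ℝ → F → F} {K L : ℝ≥0} (hΦ : IsGlobalFlow Y Φ) (hY : LipschitzWith K Y)
    (hL : ∀ z, ‖Y z‖ ≤ L) {J : F → ℝ} (hJ0 : ∀ z, 0 ≤ J z) (hJ : Continuous J)
    (hJc : HasCompactSupport J) (hW : ContDiff ℝ 1 fun z => J z • Y z)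
    (htr : ∀ z, LinearMap.trace ℝ F (fderiv ℝ (fun z => J z • Y z) z) = 0) (t : ℝ) :
    MeasurePreserving (Φ t) (μ.withDensity fun z => ENNReal.ofReal (J z))
      (μ.withDensity fun z => ENNReal.ofReal (J z)) := by
  have hΦc : ∀ t, Continuous (Φ t) := fun t =>
    (hΦ.exists_lipschitzWith hY t).choose_spec.continuous
  set κ := μ.withDensity fun z => ENNReal.ofReal (J z) with hκ
  have hJi : Integrable J μ := hJ.integrable_of_hasCompactSupport hJc
  have : IsFiniteMeasure κ := isFiniteMeasure_withDensity_ofReal hJi.2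
  have hJm : Measurable fun z => (J z).toNNReal := hJ.measurable.real_toNNReal
  have hint : ∀ f : F → ℝ, ∫ z, f z ∂κ = ∫ z, f z * J z ∂μ := by
    intro f
    rw [hκ]
    change ∫ z, f z ∂(μ.withDensity fun z => ((J z).toNNReal : ENNReal)) = _
    rw [integral_withDensity_eq_integral_smul hJm]
    refine integral_congr_ae (Eventually.of_forall fun z => ?_)
    simp [NNReal.smul_def, Real.coe_toNNReal _ (hJ0 z), mul_comm]
  have : IsFiniteMeasure (κ.map (Φ t)) := Measure.isFiniteMeasure_map κ (Φ t)
  refine ⟨(hΦc t).measurable, ?_⟩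
  -- Indicators of closed sets are limits of thickened indicators, which are Lipschitz. Closed sets
  -- form a π-system that generates the Borel sets, and both measures are finite.
  have hclosed : ∀ s : Set F, IsClosed s → κ.map (Φ t) s = κ s := by
    intro s hs
    have hpos : ∀ n : ℕ, (0 : ℝ) < 1 / (n + 1) := fun n => by positivity
    have h1 := tendsto_integral_thickenedIndicator_of_isClosed (κ.map (Φ t)) hs hpos
      tendsto_one_div_add_atTop_nhds_zero_nat
    have h2 := tendsto_integral_thickenedIndicator_of_isClosed κ hs hpos
      tendsto_one_div_add_atTop_nhds_zero_nat
    have h3 : ∀ n : ℕ, ∫ z, (thickenedIndicator (hpos n) s z : ℝ) ∂(κ.map (Φ t)) =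
        ∫ z, (thickenedIndicator (hpos n) s z : ℝ) ∂κ := by
      intro n
      have hLip : LipschitzWith _ (fun z => (thickenedIndicator (hpos n) s z : ℝ)) :=
        LipschitzWith.comp (f := ((↑) : ℝ≥0 → ℝ)) (Kf := 1)
          (LipschitzWith.of_dist_le_mul fun x y => by simp [NNReal.dist_eq, Real.dist_eq])
          (lipschitzWith_thickenedIndicator (hpos n) s)
      rw [integral_map (hΦc t).aemeasurable hLip.continuous.aestronglyMeasurable, hint, hint]
      exact hΦ.integral_comp_mul_eq μ hY hL hJ hJc hW htr hLip t
    simp_rw [h3] at h1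
    have := tendsto_nhds_unique h1 h2
    rwa [measureReal_eq_measureReal_iff] at this
  refine ext_of_generate_finite _ (BorelSpace.measurable_eq (α := F) |>.trans
    borel_eq_generateFrom_isClosed) isPiSystem_isClosed (fun s hs => hclosed s hs)
    (hclosed _ isClosed_univ)

end Liouville

/-! ### Cutting off a vector field outside a compact set -/

section Cutoff

variable {F : Type*} [NormedAddCommGroup F] [NormedSpace ℝ F] [FiniteDimensional ℝ F]

/-- A smooth bump supported in `U`, with compact support, makes the field `C¹` with compact support
on the whole space, hence Lipschitz and bounded, without changing it on `C`. -/
theorem exists_cutoff_isGlobalFlow {U C : Set F} (hU : IsOpen U) (hC : IsCompact C) (hCU : C ⊆ U)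
    {X : F → F} (hX : ContDiffOn ℝ 1 X U) :
    ∃ (χ : F → ℝ) (Φ : ℝ → F → F) (K L : ℝ≥0), (∀ z ∈ C, χ z = 1) ∧ (∀ z ∉ U, χ z = 0) ∧
      LipschitzWith K (fun z => χ z • X z) ∧ (∀ z, ‖χ z • X z‖ ≤ L) ∧
      IsGlobalFlow (fun z => χ z • X z) Φ := by
  obtain ⟨V, hVo, hCV, hVU, hVc⟩ := exists_open_between_and_isCompact_closure hC hU hCU
  obtain ⟨χ, hχ1, hχ0, -⟩ := exists_contMDiffMap_one_nhds_of_subset_interior (n := 1)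
    (modelWithCornersSelf ℝ F) hC.isClosed (hCV.trans (hVo.interior_eq.symm.subset))
  have hχd : ContDiff ℝ 1 χ := χ.contMDiff.contDiff
  have hts : tsupport χ ⊆ closure V :=
    closure_mono fun z hz => by
      by_contra h
      exact hz (hχ0 z h)
  have hYs : HasCompactSupport fun z => χ z • X z :=
    HasCompactSupport.smul_right (hVc.of_isClosed_subset (isClosed_tsupport _) hts)
  have hY : ContDiff ℝ 1 fun z => χ z • X z := by
    rw [contDiff_iff_contDiffAt]
    intro z
    by_cases hz : z ∈ U
    · exact hχd.contDiffAt.smul (hX.contDiffAt (hU.mem_nhds hz))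
    · have hz' : z ∉ tsupport χ := fun h => hz (hVU (hts h))
      have : (fun z => χ z • X z) =ᶠ[𝓝 z] fun _ => 0 := by
        filter_upwards [(isClosed_tsupport χ).isOpen_compl.mem_nhds hz'] with w hw
        rw [image_eq_zero_of_notMem_tsupport hw, zero_smul]
      exact contDiffAt_const.congr_of_eventuallyEq this
  obtain ⟨K, hK⟩ := hY.lipschitzWith_of_hasCompactSupport hYs one_ne_zero
  obtain ⟨L, hL⟩ := hYs.exists_bound_of_continuous hY.continuous
  have hL' : ∀ z, ‖χ z • X z‖ ≤ (L.toNNReal : ℝ≥0) := fun z => (hL z).trans (Real.le_coe_toNNReal L)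
  obtain ⟨Φ, hΦ⟩ := exists_isGlobalFlow hK hL'
  exact ⟨χ, Φ, K, L.toNNReal, fun z hz => hχ1.self_of_nhdsSet z hz,
    fun z hz => hχ0 z fun h => hz (hVU (subset_closure h)), hK, hL', hΦ⟩

end Cutoff

namespace RubberRolling

variable {n : ℕ}

/-! ### The action of `so(n)` on `ℝⁿ` and the wedge product -/

theorem So.mat_apply_swap (X : So n) (i j : Fin n) : X.mat j i = -X.mat i j := by
  have := congrFun (congrFun X.mat_transpose i) j
  simpa using this

theorem So.act_apply (X : So n) (x : E n) (i : Fin n) : X.act x i = ∑ j, X.mat i j * x j := rfl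

theorem mat_wedge_apply (x y : E n) (i j : Fin n) :
    (wedge x y).mat i j = x i * y j - y i * x j := rfl

theorem So.ext_mat {X Y : So n} (h : ∀ i j, X.mat i j = Y.mat i j) : X = Y :=
  So.mat_injective (Matrix.ext h)

theorem So.inner_act_left (X : So n) (x y : E n) :
    inner ℝ (X.act x) y = -inner ℝ x (X.act y) := by
  simp only [PiLp.inner_apply, RCLike.inner_apply, conj_trivial, So.act_apply, Finset.mul_sum,
    Finset.sum_mul]
  rw [Finset.sum_comm, ← Finset.sum_neg_distrib]
  refine Finset.sum_congr rfl fun i _ => ?_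
  rw [← Finset.sum_neg_distrib]
  refine Finset.sum_congr rfl fun j _ => ?_
  rw [X.mat_apply_swap i j]
  ring

theorem So.inner_act_self (X : So n) (x : E n) : inner ℝ (X.act x) x = 0 := by
  have := X.inner_act_left x x
  rw [real_inner_comm] at this ⊢
  linarith

theorem So.inner_wedge (X : So n) (x y : E n) : inner ℝ X (wedge x y) = inner ℝ (X.act y) x := by
  rw [So.inner_def]
  simp only [Matrix.trace, Matrix.diag, Matrix.mul_apply, mat_wedge_apply, PiLp.inner_apply,
    RCLike.inner_apply, conj_trivial, So.act_apply, Finset.mul_sum]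
  have h1 : ∑ i, ∑ j, -(1 / 2 : ℝ) * (X.mat i j * (x j * y i - y j * x i)) =
      ∑ i, ∑ j, (1 / 2 : ℝ) * (X.mat i j * y j * x i) +
      ∑ i, ∑ j, -(1 / 2 : ℝ) * (X.mat i j * y i * x j) := by
    rw [← Finset.sum_add_distrib]
    refine Finset.sum_congr rfl fun i _ => ?_
    rw [← Finset.sum_add_distrib]
    exact Finset.sum_congr rfl fun j _ => by ring
  rw [h1, Finset.sum_comm (f := fun i j => -(1 / 2 : ℝ) * (X.mat i j * y i * x j)),
    ← Finset.sum_add_distrib]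
  refine Finset.sum_congr rfl fun i _ => ?_
  rw [← Finset.sum_add_distrib]
  refine Finset.sum_congr rfl fun j _ => ?_
  rw [X.mat_apply_swap i j]
  ring

/-- The action of `so(n)` on `ℝⁿ` as a bilinear map. -/
def actL : So n →ₗ[ℝ] E n →ₗ[ℝ] E n :=
  LinearMap.mk₂ ℝ So.act
    (fun X Y x => by ext i; simp [So.act_apply, add_mul, Finset.sum_add_distrib])
    (fun c X x => by ext i; simp [So.act_apply, Finset.mul_sum, mul_assoc])
    (fun X x y => by ext i; simp [So.act_apply, mul_add, Finset.sum_add_distrib])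
    (fun c X x => by ext i; simp [So.act_apply, Finset.mul_sum, mul_left_comm])

/-- The wedge product as a bilinear map. -/
def wedgeL : E n →ₗ[ℝ] E n →ₗ[ℝ] So n :=
  LinearMap.mk₂ ℝ wedge
    (fun x y z => So.ext_mat fun i j => by simp [mat_wedge_apply]; ring)
    (fun c x y => So.ext_mat fun i j => by simp [mat_wedge_apply]; ring)
    (fun x y z => So.ext_mat fun i j => by simp [mat_wedge_apply]; ring)
    (fun c x y => So.ext_mat fun i j => by simp [mat_wedge_apply]; ring)

/-- The action of `so(n)` on `ℝⁿ` as a continuous bilinear map. -/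
def actC : So n →L[ℝ] E n →L[ℝ] E n :=
  actL.toContinuousBilinearMap

/-- The wedge product as a continuous bilinear map. -/
def wedgeC : E n →L[ℝ] E n →L[ℝ] So n :=
  wedgeL.toContinuousBilinearMap

/-- The Lie bracket of `so(n)` as a continuous bilinear map. -/
def bracketC : So n →L[ℝ] So n →L[ℝ] So n :=
  (LinearMap.mk₂ ℝ (fun X Y : So n => ⁅X, Y⁆) add_lie smul_lie lie_add
    (fun c X Y => lie_smul c X Y)).toContinuousBilinearMap

@[simp] theorem actL_apply (X : So n) (x : E n) : actL X x = X.act x := rfl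
@[simp] theorem wedgeL_apply (x y : E n) : wedgeL x y = wedge x y := rfl
@[simp] theorem actC_apply (X : So n) (x : E n) : actC X x = X.act x := rfl
@[simp] theorem bracketC_apply (X Y : So n) : bracketC X Y = ⁅X, Y⁆ := rfl
@[simp] theorem wedgeC_apply (x y : E n) : wedgeC x y = wedge x y := rfl

theorem act_wedge (x y z : E n) :
    (wedge x y).act z = (inner ℝ y z : ℝ) • x - (inner ℝ x z : ℝ) • y := by
  ext i
  simp only [So.act_apply, mat_wedge_apply, PiLp.inner_apply, RCLike.inner_apply, conj_trivial,
    PiLp.sub_apply, PiLp.smul_apply, smul_eq_mul, Finset.sum_mul, sub_mul, Finset.sum_sub_distrib]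
  congr 1 <;> exact Finset.sum_congr rfl fun j _ => by ring

theorem wedge_add_left (x y z : E n) : wedge (x + y) z = wedge x z + wedge y z :=
  wedgeL.map_add₂ x y z

theorem wedge_sub_left (x y z : E n) : wedge (x - y) z = wedge x z - wedge y z :=
  wedgeL.map_sub₂ x y z

theorem wedge_smul_left (c : ℝ) (x y : E n) : wedge (c • x) y = c • wedge x y :=
  wedgeL.map_smul₂ c x y

theorem wedge_smul_right (c : ℝ) (x y : E n) : wedge x (c • y) = c • wedge x y :=
  (wedgeL x).map_smul c y

theorem wedge_self (x : E n) : wedge x x = 0 :=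
  So.ext_mat fun i j => by simp [mat_wedge_apply]

theorem So.act_lie (X Y : So n) (x : E n) : (⁅X, Y⁆ : So n).act x =
    X.act (Y.act x) - Y.act (X.act x) := by
  simp only [So.act, So.mat_bracket, Matrix.sub_mulVec, Matrix.mulVec_mulVec]
  rfl

theorem inner_wedge_left (x y : E n) (X : So n) : inner ℝ (wedge x y) X = inner ℝ x (X.act y) := by
  rw [real_inner_comm, So.inner_wedge, real_inner_comm]

theorem So.inner_lie (X Y Z : So n) : inner ℝ ⁅X, Y⁆ Z = inner ℝ X ⁅Y, Z⁆ := by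
  simp only [So.inner_def, So.mat_bracket, Matrix.sub_mul, Matrix.mul_sub, Matrix.trace_sub]
  have h : (Y.mat * X.mat * Z.mat).trace = (X.mat * (Z.mat * Y.mat)).trace := by
    rw [Matrix.mul_assoc, Matrix.trace_mul_comm, Matrix.mul_assoc]
  rw [h, Matrix.mul_assoc]

theorem lie_wedge (X : So n) (x y : E n) :
    (⁅X, wedge x y⁆ : So n) = wedge (X.act x) y + wedge x (X.act y) := by
  refine So.ext_mat fun i j => ?_
  simp only [So.mat_bracket, Matrix.sub_apply, Matrix.mul_apply, map_add, Matrix.add_apply,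
    mat_wedge_apply, So.act_apply, Finset.mul_sum, Finset.sum_mul, mul_sub, sub_mul,
    Finset.sum_sub_distrib]
  have e1 : ∀ k, X.mat k j = -X.mat j k := fun k => X.mat_apply_swap j k
  simp_rw [e1]
  simp only [mul_neg, Finset.sum_neg_distrib]
  have e2 : ∀ a b : E n, ∀ k, ∑ l, a k * (X.mat j l * b l) = ∑ l, a k * b l * X.mat j l :=
    fun a b k => Finset.sum_congr rfl fun l _ => by ring
  have e3 : ∀ a b : E n, ∀ k l, ∑ m, X.mat k m * (a m * b l) = ∑ m, X.mat k m * a m * b l :=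
    fun a b k l => Finset.sum_congr rfl fun l _ => by ring
  simp only [e2, e3]
  ring

/-- Since `⟨X, x ∧ γ⟩ = ⟨Xγ, x⟩`, the choice `x = Xγ` shows that `𝔥_γ` is the stabilizer algebra of
`γ`. This is why evaluation at `γ` removes the multiplier. -/
theorem mem_hSpace {γ : E n} {X : So n} : X ∈ hSpace γ ↔ X.act γ = 0 := by
  rw [hSpace, vSpace, Submodule.mem_orthogonal']
  constructor
  · intro h
    have := h _ (Submodule.subset_span ⟨X.act γ, rfl⟩)
    rwa [So.inner_wedge, inner_self_eq_zero] at this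
  · intro h u hu
    induction hu using Submodule.span_induction with
    | mem u hu =>
      obtain ⟨x, rfl⟩ := hu
      rw [So.inner_wedge, h, inner_zero_left]
    | zero => simp
    | add u v _ _ hu hv => rw [inner_add_right, hu, hv, add_zero]
    | smul c u _ hu => rw [inner_smul_right, hu, mul_zero]

/-- For a unit vector, `X ↦ (Xγ) ∧ γ` is the orthogonal projection to `𝔳_γ`, because `X - (Xγ) ∧ γ`
annihilates `γ`. -/
theorem mem_hSpace_orthogonal {γ : E n} (hγ : ‖γ‖ = 1) {X : So n} :
    X ∈ (hSpace γ)ᗮ ↔ X = wedge (X.act γ) γ := by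
  constructor
  · intro h
    have hd : X - wedge (X.act γ) γ ∈ hSpace γ := by
      rw [mem_hSpace, ← actL_apply, map_sub, LinearMap.sub_apply, actL_apply, actL_apply, act_wedge,
        real_inner_self_eq_norm_sq, hγ, So.inner_act_self]
      simp
    have h1 := (Submodule.mem_orthogonal' _ _).1 h _ hd
    have h2 : inner ℝ (wedge (X.act γ) γ) (X - wedge (X.act γ) γ) = 0 := by
      rw [inner_wedge_left, mem_hSpace.1 hd, inner_zero_right]
    rw [← sub_eq_zero, ← inner_self_eq_zero (𝕜 := ℝ), inner_sub_left, h1, h2, sub_zero]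
  · intro h
    rw [h, Submodule.mem_orthogonal']
    intro u hu
    rw [inner_wedge_left, mem_hSpace.1 hu, inner_zero_right]

/-! ### Complementary minors of a linear isomorphism -/

/-- Jacobi's identity for complementary minors: if `V = ι P ⊕ j Q`, the compression of `M` to `P`
has the determinant of `M` times that of the compression of `M⁻¹` to `Q`. -/
theorem det_compression_eq_det_mul {V P Q : Type*} [AddCommGroup V] [Module ℝ V]
    [FiniteDimensional ℝ V] [AddCommGroup P] [Module ℝ P] [FiniteDimensional ℝ P]
    [AddCommGroup Q] [Module ℝ Q] [FiniteDimensional ℝ Q]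
    (ι : P →ₗ[ℝ] V) (ι' : V →ₗ[ℝ] P) (j : Q →ₗ[ℝ] V) (j' : V →ₗ[ℝ] Q)
    (h11 : ι' ∘ₗ ι = LinearMap.id) (h12 : ι' ∘ₗ j = 0) (h21 : j' ∘ₗ ι = 0)
    (h22 : j' ∘ₗ j = LinearMap.id) (hsum : ι ∘ₗ ι' + j ∘ₗ j' = LinearMap.id)
    (M N : V →ₗ[ℝ] V) (hMN : M ∘ₗ N = LinearMap.id) :
    LinearMap.det (ι' ∘ₗ M ∘ₗ ι) = LinearMap.det M * LinearMap.det (j' ∘ₗ N ∘ₗ j) := by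
  classical
  let e : V ≃ₗ[ℝ] P × Q := LinearEquiv.ofLinearMap (ι'.prod j') (ι.coprod j)
    (LinearMap.ext fun x => by
      have e1 := LinearMap.congr_fun h11 x.1
      have e2 := LinearMap.congr_fun h12 x.2
      have e3 := LinearMap.congr_fun h21 x.1
      have e4 := LinearMap.congr_fun h22 x.2
      simp only [LinearMap.comp_apply, LinearMap.id_apply, LinearMap.zero_apply] at e1 e2 e3 e4
      ext1 <;> simp [e1, e2, e3, e4])
    (by
      ext x
      have := LinearMap.congr_fun hsum x
      simpa using this)
  let b := Module.finBasis ℝ P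
  let b' := Module.finBasis ℝ Q
  let B := (b.prod b').map e.symm
  have hblock : ∀ T : V →ₗ[ℝ] V, LinearMap.toMatrix B B T =
      Matrix.fromBlocks (LinearMap.toMatrix b b (ι' ∘ₗ T ∘ₗ ι))
        (LinearMap.toMatrix b' b (ι' ∘ₗ T ∘ₗ j)) (LinearMap.toMatrix b b' (j' ∘ₗ T ∘ₗ ι))
        (LinearMap.toMatrix b' b' (j' ∘ₗ T ∘ₗ j)) := by
    intro T
    ext (i | i) (k | k) <;>
      simp [LinearMap.toMatrix_apply, B, e, LinearEquiv.ofLinearMap]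
  have h1 : LinearMap.toMatrix B B M * LinearMap.toMatrix B B N = 1 := by
    rw [← LinearMap.toMatrix_comp, hMN, LinearMap.toMatrix_id]
  rw [← LinearMap.det_toMatrix B M, ← LinearMap.det_toMatrix b, ← LinearMap.det_toMatrix b']
  rw [hblock M, hblock N] at h1
  rw [hblock M]
  set A11 := LinearMap.toMatrix b b (ι' ∘ₗ M ∘ₗ ι)
  set A12 := LinearMap.toMatrix b' b (ι' ∘ₗ M ∘ₗ j)
  set A21 := LinearMap.toMatrix b b' (j' ∘ₗ M ∘ₗ ι)
  set A22 := LinearMap.toMatrix b' b' (j' ∘ₗ M ∘ₗ j)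
  set N12 := LinearMap.toMatrix b' b (ι' ∘ₗ N ∘ₗ j)
  set N22 := LinearMap.toMatrix b' b' (j' ∘ₗ N ∘ₗ j)
  rw [Matrix.fromBlocks_multiply, ← Matrix.fromBlocks_one, Matrix.fromBlocks_inj] at h1
  obtain ⟨-, h2, -, h3⟩ := h1
  -- The second block column of `M N = 1` makes the product triangular. Taking determinants gives
  -- `det M · det N22 = det A11`.
  have h4 : Matrix.fromBlocks A11 A12 A21 A22 * Matrix.fromBlocks 1 N12 0 N22 =
      Matrix.fromBlocks A11 0 A21 1 := by
    rw [Matrix.fromBlocks_multiply, h2, h3]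
    simp
  have h5 := congrArg Matrix.det h4
  rw [Matrix.det_mul, Matrix.det_fromBlocks_zero₂₁, Matrix.det_fromBlocks_zero₁₂] at h5
  simpa using h5.symm

end RubberRolling

/-! ### Traces, and the derivative of the determinant -/

section DetTrace

variable {V : Type*} [NormedAddCommGroup V] [InnerProductSpace ℝ V] [FiniteDimensional ℝ V]

theorem trace_eq_of_inner_eq {T T' : V →ₗ[ℝ] V} (h : ∀ x y, inner ℝ (T x) y = inner ℝ x (T' y)) :
    LinearMap.trace ℝ V T = LinearMap.trace ℝ V T' := by
  rw [T.trace_eq_sum_inner (stdOrthonormalBasis ℝ V),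
    T'.trace_eq_sum_inner (stdOrthonormalBasis ℝ V)]
  exact Finset.sum_congr rfl fun i _ => by rw [← h, real_inner_comm]

theorem trace_eq_zero_of_skew {T : V →ₗ[ℝ] V} (h : ∀ x y, inner ℝ (T x) y = -inner ℝ x (T y)) :
    LinearMap.trace ℝ V T = 0 := by
  have := trace_eq_of_inner_eq (T := T) (T' := -T) fun x y => by
    rw [h, LinearMap.neg_apply, inner_neg_right]
  rw [map_neg] at this
  linarith

theorem trace_eq_inner_of_rank_one {T : V →ₗ[ℝ] V} {a b : V}
    (h : ∀ x, T x = (inner ℝ a x : ℝ) • b) : LinearMap.trace ℝ V T = inner ℝ a b := by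
  rw [T.trace_eq_sum_inner (stdOrthonormalBasis ℝ V)]
  simp only [h, inner_smul_right]
  exact (stdOrthonormalBasis ℝ V).sum_inner_mul_inner a b

theorem contDiff_linearMap_det {k : WithTop ℕ∞} :
    ContDiff ℝ k fun T : V →L[ℝ] V => LinearMap.det (T : V →ₗ[ℝ] V) := by
  classical
  let b := Module.finBasis ℝ V
  simp_rw [← LinearMap.det_toMatrix b, Matrix.det_apply]
  refine ContDiff.sum fun σ _ => ContDiff.const_smul _ (contDiff_prod fun i _ => ?_)
  simp only [LinearMap.toMatrix_apply]
  exact ((b.coord (σ i)).toContinuousLinearMap ∘L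
    ContinuousLinearMap.apply ℝ V (b i)).contDiff

/-- On the line `1 + rH` the determinant is a polynomial in `r` with linear part `1 + r tr H`; the
rest is divisible by `r²` and does not contribute at `r = 0`. -/
theorem fderiv_linearMap_det_one (H : V →L[ℝ] V) :
    fderiv ℝ (fun T : V →L[ℝ] V => LinearMap.det (T : V →ₗ[ℝ] V)) 1 H =
      LinearMap.trace ℝ V H := by
  classical
  let b := Module.finBasis ℝ V
  set M := LinearMap.toMatrix b b (H : V →ₗ[ℝ] V) with hM
  have h1 : HasDerivAt (fun r : ℝ => (1 : V →L[ℝ] V) + r • H) H 0 := by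
    simpa using ((hasDerivAt_id (0 : ℝ)).smul_const H).const_add (1 : V →L[ℝ] V)
  have h2 : HasFDerivAt (fun T : V →L[ℝ] V => LinearMap.det (T : V →ₗ[ℝ] V))
      (fderiv ℝ (fun T : V →L[ℝ] V => LinearMap.det (T : V →ₗ[ℝ] V)) 1)
      ((fun r : ℝ => (1 : V →L[ℝ] V) + r • H) 0) := by
    simpa using ((contDiff_linearMap_det (k := 1)).differentiable one_ne_zero
      (1 : V →L[ℝ] V)).hasFDerivAt
  have h3 := h2.comp_hasDerivAt (0 : ℝ) h1
  obtain ⟨p, hp⟩ : ∃ p : Polynomial ℝ, ∀ r : ℝ,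
      LinearMap.det (((1 : V →L[ℝ] V) + r • H : V →L[ℝ] V) : V →ₗ[ℝ] V) =
        1 + M.trace * r + p.eval r * r ^ 2 := by
    refine ⟨(Matrix.det (1 + (Polynomial.X : Polynomial ℝ) • M.map Polynomial.C)).divX.divX,
      fun r => ?_⟩
    rw [← LinearMap.det_toMatrix b, ← Matrix.det_one_add_smul]
    congr 1
    rw [ContinuousLinearMap.toLinearMap_add, map_add, ContinuousLinearMap.toLinearMap_smul,
        map_smul]
    congr 1
    exact LinearMap.toMatrix_one b
  have h4 : HasDerivAt (fun r : ℝ => 1 + M.trace * r + p.eval r * r ^ 2) M.trace 0 := by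
    have := (((hasDerivAt_id (0 : ℝ)).const_mul M.trace).const_add 1).add
      ((p.hasDerivAt 0).mul ((hasDerivAt_id (0 : ℝ)).pow 2))
    exact (this.congr_deriv (by simp)).congr_of_eventuallyEq
      (Eventually.of_forall fun r => by simp)
  have h5 := h3.unique (h4.congr_of_eventuallyEq (Eventually.of_forall fun r => hp r))
  rw [h5, LinearMap.trace_eq_matrix_trace ℝ b]

/-- Jacobi's formula, reduced to the derivative at the identity by `det T(s) = det T(t) · det(R
T(s))`. -/
theorem hasDerivAt_linearMap_det {T : ℝ → V →L[ℝ] V} {T' R : V →L[ℝ] V} {t : ℝ}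
    (hT : HasDerivAt T T' t) (hR : R * T t = 1) (hR' : T t * R = 1) :
    HasDerivAt (fun s => LinearMap.det (T s : V →ₗ[ℝ] V))
      (LinearMap.det (T t : V →ₗ[ℝ] V) * LinearMap.trace ℝ V (R * T' : V →L[ℝ] V)) t := by
  have h1 : HasDerivAt (fun s => R * T s) (R * T') t := hT.const_mul R
  have h2 : HasFDerivAt (fun T : V →L[ℝ] V => LinearMap.det (T : V →ₗ[ℝ] V))
      (fderiv ℝ (fun T : V →L[ℝ] V => LinearMap.det (T : V →ₗ[ℝ] V)) 1) (R * T t) := by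
    rw [hR]
    exact ((contDiff_linearMap_det (k := 1)).differentiable one_ne_zero
      (1 : V →L[ℝ] V)).hasFDerivAt
  have h3 := h2.comp_hasDerivAt t h1
  rw [fderiv_linearMap_det_one] at h3
  have h4 := h3.const_mul (LinearMap.det (T t : V →ₗ[ℝ] V))
  refine h4.congr_of_eventuallyEq (Eventually.of_forall fun s => ?_)
  simp only [Function.comp]
  rw [← LinearMap.det_comp]
  congr 1
  ext v
  have := congrArg (fun L : V →L[ℝ] V => L (T s v)) hR'
  simpa using this.symm

theorem trace_fderiv_prod {V₁ V₂ : Type*} [NormedAddCommGroup V₁] [NormedSpace ℝ V₁]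
    [FiniteDimensional ℝ V₁] [NormedAddCommGroup V₂] [NormedSpace ℝ V₂] [FiniteDimensional ℝ V₂]
    {X : V₁ × V₂ → V₁ × V₂} {x : V₁} {y : V₂} (hX : DifferentiableAt ℝ X (x, y))
    {D₁ : V₁ →L[ℝ] V₁} {D₂ : V₂ →L[ℝ] V₂} (h₁ : HasFDerivAt (fun x => (X (x, y)).1) D₁ x)
    (h₂ : HasFDerivAt (fun y => (X (x, y)).2) D₂ y) :
    LinearMap.trace ℝ (V₁ × V₂) (fderiv ℝ X (x, y)) =
      LinearMap.trace ℝ V₁ D₁ + LinearMap.trace ℝ V₂ D₂ := by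
  set L := fderiv ℝ X (x, y)
  have e₁ : D₁ = ContinuousLinearMap.fst ℝ V₁ V₂ ∘L L ∘L ContinuousLinearMap.inl ℝ V₁ V₂ :=
    h₁.unique (hasFDerivAt_fst.comp x (hX.hasFDerivAt.comp x (hasFDerivAt_prodMk_left x y)))
  have e₂ : D₂ = ContinuousLinearMap.snd ℝ V₁ V₂ ∘L L ∘L ContinuousLinearMap.inr ℝ V₁ V₂ :=
    h₂.unique (hasFDerivAt_snd.comp y (hX.hasFDerivAt.comp y (hasFDerivAt_prodMk_right x y)))
  have hL : (L : V₁ × V₂ →ₗ[ℝ] V₁ × V₂) =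
      (L.toLinearMap ∘ₗ LinearMap.inl ℝ V₁ V₂) ∘ₗ LinearMap.fst ℝ V₁ V₂ +
      (L.toLinearMap ∘ₗ LinearMap.inr ℝ V₁ V₂) ∘ₗ LinearMap.snd ℝ V₁ V₂ := by
    refine LinearMap.ext fun v => ?_
    simp [← map_add]
  rw [hL, map_add, LinearMap.trace_comp_comm' (LinearMap.fst ℝ V₁ V₂),
    LinearMap.trace_comp_comm' (LinearMap.snd ℝ V₁ V₂), e₁, e₂]
  rfl

end DetTrace

namespace RubberRolling

variable {n : ℕ}

theorem norm_wedge_sq (x y : E n) :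
    ‖wedge x y‖ ^ 2 = ‖x‖ ^ 2 * ‖y‖ ^ 2 - (inner ℝ x y : ℝ) ^ 2 := by
  rw [← real_inner_self_eq_norm_sq, inner_wedge_left, act_wedge, inner_sub_right, inner_smul_right,
    inner_smul_right, real_inner_self_eq_norm_sq, real_inner_self_eq_norm_sq]
  ring

namespace RubberBall

variable (S : RubberBall n)

/-! ### The inertia operator -/

theorem D_pos : 0 < S.D := mul_pos S.mass_pos (pow_pos S.ρ_pos 2)

/-- For the shell `ε` is negative, so only `ε ≠ 0` is available in all three cases. It is all that
the exponent `1/(2ε)` needs. -/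
theorem ε_ne_zero : S.ε ≠ 0 := by
  have h1 := S.σ_pos
  have h2 := S.ρ_pos
  unfold ε
  cases hk : S.kind with
  | outer => exact (div_pos h1 (by linarith)).ne'
  | inner => exact (div_pos h1 (by linarith [S.inner_lt hk])).ne'
  | shell => exact (div_neg_of_pos_of_neg h1 (by linarith [S.shell_lt hk])).ne

/-- The modified inertia operator as a continuous linear map. -/
def inertiaC : So n →L[ℝ] So n := S.modifiedInertia.toContinuousLinearMap

theorem inertiaC_apply (X : So n) : S.inertiaC X = S.modifiedInertia X := rfl

theorem inner_inertiaC_left (X Y : So n) : inner ℝ (S.inertiaC X) Y = inner ℝ X (S.inertiaC Y) := by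
  simp only [inertiaC_apply, modifiedInertia, LinearMap.add_apply, LinearMap.smul_apply,
    LinearMap.id_apply, inner_add_left, inner_add_right, real_inner_smul_left,
    real_inner_smul_right]
  rw [S.inertia_symm X Y]

theorem le_inner_inertiaC (X : So n) : S.D * ‖X‖ ^ 2 ≤ inner ℝ (S.inertiaC X) X := by
  have h : 0 ≤ inner ℝ (S.inertia X) X := by
    by_cases hX : X = 0
    · simp [hX]
    · exact (S.inertia_pos X hX).le
  simp only [inertiaC_apply, modifiedInertia, LinearMap.add_apply, LinearMap.smul_apply,
    LinearMap.id_apply, inner_add_left, real_inner_smul_left, real_inner_self_eq_norm_sq]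
  linarith

theorem angularVelocity_inertiaC (X : So n) : S.angularVelocity (S.inertiaC X) = X :=
  S.modifiedInertiaEquiv.symm_apply_apply X

theorem inertiaC_angularVelocity (X : So n) : S.inertiaC (S.angularVelocity X) = X :=
  S.modifiedInertiaEquiv.apply_symm_apply X

theorem inner_angularVelocity_left (X Y : So n) :
    inner ℝ (S.angularVelocity X) Y = inner ℝ X (S.angularVelocity Y) := by
  have := S.inner_inertiaC_left (S.angularVelocity X) (S.angularVelocity Y)
  rwa [inertiaC_angularVelocity, inertiaC_angularVelocity, eq_comm] at this

theorem twist_eq_zero_iff {γ : E n} (hγ : ‖γ‖ = 1) {m : So n} :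
    S.twist γ m = 0 ↔ S.angularVelocity m = wedge ((S.angularVelocity m).act γ) γ := by
  rw [← mem_hSpace_orthogonal hγ, ← Submodule.orthogonalProjectionOnto_eq_zero_iff]
  rfl

/-! ### The reduced inertia operator on `ℝⁿ` -/

/-- The bilinear map `(a, b) ↦ (h ↦ 𝐈(h ∧ a) b + ⟨a, h⟩ b)`. -/
def bopC : E n →L[ℝ] E n →L[ℝ] E n →L[ℝ] E n :=
  (LinearMap.mk₂ ℝ (fun a b => actC.flip b ∘L S.inertiaC ∘L wedgeC.flip a +
      (innerSL ℝ a).smulRight b)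
    (fun a b c => by ext1 h; simp [add_smul]; abel)
    (fun r a b => by ext1 h; simp [mul_smul])
    (fun a b c => by ext1 h; simp; abel)
    (fun r a b => by ext1 h; simp [smul_comm r])).toContinuousBilinearMap

theorem bopC_apply (a b h : E n) :
    S.bopC a b h = (S.inertiaC (wedge h a)).act b + (inner ℝ a h : ℝ) • b := rfl

/-- The operator of the quadratic form `⟨𝐈(h ∧ γ), h ∧ γ⟩ + ⟨h, γ⟩²`. -/
def bop (γ : E n) : E n →L[ℝ] E n := S.bopC γ γ

theorem bop_apply (γ h : E n) :
    S.bop γ h = (S.inertiaC (wedge h γ)).act γ + (inner ℝ γ h : ℝ) • γ := rfl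

theorem inner_bop (γ h k : E n) : inner ℝ (S.bop γ h) k =
    inner ℝ (S.inertiaC (wedge h γ)) (wedge k γ) + inner ℝ γ h * inner ℝ γ k := by
  rw [bop_apply, inner_add_left, ← So.inner_wedge, real_inner_smul_left]

theorem inner_bop_left (γ h k : E n) : inner ℝ (S.bop γ h) k = inner ℝ h (S.bop γ k) := by
  rw [real_inner_comm (S.bop γ k) h, inner_bop, inner_bop, inner_inertiaC_left,
    real_inner_comm (S.inertiaC _)]
  ring

theorem bop_self (γ : E n) : S.bop γ γ = (‖γ‖ ^ 2) • γ := by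
  rw [bop_apply, wedge_self, map_zero, ← actL_apply, map_zero, LinearMap.zero_apply, zero_add,
    real_inner_self_eq_norm_sq]

theorem bop_smul (r : ℝ) (γ : E n) : S.bop (r • γ) = r ^ 2 • S.bop γ := by
  simp only [bop, map_smul, smul_apply, smul_smul, sq]

/-- The quadratic form of `B_γ` is at least `D(|h|²|γ|² - ⟨h, γ⟩²) + ⟨γ, h⟩²`, a sum of two
non-negative terms. If both vanish, then `|h||γ| = 0`. The rank-one term makes `B_γ` invertible on
all of `ℝⁿ`, in the direction of `γ` too. -/
theorem bop_injective {γ : E n} (hγ : γ ≠ 0) : Function.Injective (S.bop γ) := by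
  refine (injective_iff_map_eq_zero _).2 fun h hh => ?_
  have h1 : inner ℝ (S.bop γ h) h = 0 := by rw [hh, inner_zero_left]
  rw [inner_bop] at h1
  have h2 := S.le_inner_inertiaC (wedge h γ)
  rw [norm_wedge_sq] at h2
  have h3 : 0 ≤ S.D * ‖wedge h γ‖ ^ 2 := mul_nonneg S.D_pos.le (sq_nonneg _)
  rw [norm_wedge_sq, real_inner_comm] at h3
  rw [real_inner_comm] at h2
  have h4 : (inner ℝ γ h : ℝ) ^ 2 = 0 := by nlinarith [sq_nonneg (inner ℝ γ h : ℝ)]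
  rw [h4, sub_zero] at h2 h3
  have h5 : S.D * (‖h‖ ^ 2 * ‖γ‖ ^ 2) = 0 := by nlinarith
  have h6 : ‖γ‖ ≠ 0 := norm_ne_zero_iff.2 hγ
  have h7 := S.D_pos.ne'
  simpa [h6, h7] using h5

theorem isUnit_bop {γ : E n} (hγ : γ ≠ 0) : IsUnit (S.bop γ) := by
  rw [ContinuousLinearMap.isUnit_iff_bijective]
  exact ⟨S.bop_injective hγ, LinearMap.surjective_of_injective (f := (S.bop γ).toLinearMap)
    (S.bop_injective hγ)⟩

/-- The inverse of `bop`. -/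
def bopInv (γ : E n) : E n →L[ℝ] E n := Ring.inverse (S.bop γ)

theorem bop_mul_bopInv {γ : E n} (hγ : γ ≠ 0) : S.bop γ * S.bopInv γ = 1 :=
  Ring.mul_inverse_cancel _ (S.isUnit_bop hγ)

theorem bopInv_mul_bop {γ : E n} (hγ : γ ≠ 0) : S.bopInv γ * S.bop γ = 1 :=
  Ring.inverse_mul_cancel _ (S.isUnit_bop hγ)

theorem bop_bopInv {γ : E n} (hγ : γ ≠ 0) (h : E n) : S.bop γ (S.bopInv γ h) = h :=
  congrArg (fun T : E n →L[ℝ] E n => T h) (S.bop_mul_bopInv hγ)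

theorem inner_bopInv_left {γ : E n} (hγ : γ ≠ 0) (h k : E n) :
    inner ℝ (S.bopInv γ h) k = inner ℝ h (S.bopInv γ k) := by
  have := S.inner_bop_left γ (S.bopInv γ h) (S.bopInv γ k)
  rwa [S.bop_bopInv hγ, S.bop_bopInv hγ, eq_comm] at this

/-- `γ` is an eigenvector of the symmetric operator `B_γ`. In particular the inverse preserves the
orthogonal complement of `γ`. -/
theorem norm_sq_mul_inner_bopInv {γ : E n} (hγ : γ ≠ 0) (h : E n) :
    ‖γ‖ ^ 2 * inner ℝ γ (S.bopInv γ h) = inner ℝ γ h := by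
  rw [← real_inner_smul_left, ← bop_self, inner_bop_left, S.bop_bopInv hγ]

theorem inner_self_bopInv_eq_zero {γ : E n} (hγ : γ ≠ 0) {h : E n} (hh : inner ℝ γ h = 0) :
    inner ℝ γ (S.bopInv γ h) = 0 := by
  have h1 := S.norm_sq_mul_inner_bopInv hγ h
  rw [hh] at h1
  simpa [hγ] using h1

/-! ### The equations of motion on `ℝⁿ × ℝⁿ` -/

/-- The component orthogonal to `γ` of the acceleration. -/
def accel (x γ : E n) : E n :=
  S.bopInv γ ((⁅S.inertiaC (wedge x γ), wedge x γ⁆ : So n).act γ)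

theorem bop_accel (x : E n) {γ : E n} (hγ : γ ≠ 0) :
    S.bop γ (S.accel x γ) = (⁅S.inertiaC (wedge x γ), wedge x γ⁆ : So n).act γ :=
  S.bop_bopInv hγ _

theorem inner_accel (x : E n) {γ : E n} (hγ : γ ≠ 0) : inner ℝ γ (S.accel x γ) = 0 :=
  S.inner_self_bopInv_eq_zero hγ (by rw [real_inner_comm, So.inner_act_self])

/-- The reduced equations of motion in the variables `(x, γ)`, `ω = x ∧ γ`. -/
def field (z : E n × E n) : E n × E n :=
  (S.accel z.1 z.2 - S.ε • (wedge z.1 z.2).act z.1, -S.ε • (wedge z.1 z.2).act z.2)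

/-- The kinetic energy, up to a factor. -/
def energy (x γ : E n) : ℝ := inner ℝ (S.inertiaC (wedge x γ)) (wedge x γ)

theorem _root_.HasDerivAt.wedge {x y : ℝ → E n} {x' y' : E n} {t : ℝ} (hx : HasDerivAt x x' t)
    (hy : HasDerivAt y y' t) : HasDerivAt (fun s => wedge (x s) (y s))
      (RubberRolling.wedge x' (y t) + RubberRolling.wedge (x t) y') t := by
  have := (wedgeC.hasFDerivAt.comp_hasDerivAt t hx).clm_apply hy
  exact this

section Conservation

variable {x γ : ℝ → E n} {t c : ℝ}

/-- The terms with `ε` rotate `x` and `γ` by the same `ω`, so they contribute `-ε[ω, x ∧ γ] = -ε[ω,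
ω] = 0`. The factor `c` stands for the value of a cutoff along the curve. -/
theorem hasDerivAt_wedge_of_field
    (hx : HasDerivAt x (c • (S.field (x t, γ t)).1) t)
    (hγ : HasDerivAt γ (c • (S.field (x t, γ t)).2) t) :
    HasDerivAt (fun s => wedge (x s) (γ s)) (c • wedge (S.accel (x t) (γ t)) (γ t)) t := by
  refine (hx.wedge hγ).congr_deriv ?_
  have h : wedge ((wedge (x t) (γ t)).act (x t)) (γ t) +
      wedge (x t) ((wedge (x t) (γ t)).act (γ t)) = 0 := by
    rw [← lie_wedge, lie_self]
  have h' : wedge (x t) ((wedge (x t) (γ t)).act (γ t)) =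
      -wedge ((wedge (x t) (γ t)).act (x t)) (γ t) := eq_neg_of_add_eq_zero_right h
  simp only [field, wedge_smul_left, wedge_smul_right, wedge_sub_left, h']
  simp only [neg_smul, smul_neg, smul_sub, neg_neg, sub_add_cancel]

/-- The acceleration is orthogonal to `γ`, and the common rotation of `x` and `γ` preserves their
product. The alternative `c = 0` covers cut-off fields at `γ = 0`, where `B_γ` is not invertible. -/
theorem hasDerivAt_inner_field_field (hγ0 : γ t ≠ 0 ∨ c = 0)
    (hx : HasDerivAt x (c • (S.field (x t, γ t)).1) t)
    (hγ : HasDerivAt γ (c • (S.field (x t, γ t)).2) t) :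
    HasDerivAt (fun s => (inner ℝ (x s) (γ s) : ℝ)) 0 t := by
  refine (hx.inner ℝ hγ).congr_deriv ?_
  have h : c * inner ℝ (S.accel (x t) (γ t)) (γ t) = 0 := by
    rcases hγ0 with h | h
    · rw [real_inner_comm, S.inner_accel _ h, mul_zero]
    · rw [h, zero_mul]
  simp only [field, real_inner_smul_left, real_inner_smul_right, inner_sub_left]
  rw [So.inner_act_left]
  linarith

theorem hasDerivAt_inner_self_field
    (hγ : HasDerivAt γ (c • (S.field (x t, γ t)).2) t) :
    HasDerivAt (fun s => (inner ℝ (γ s) (γ s) : ℝ)) 0 t := by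
  refine (hγ.inner ℝ hγ).congr_deriv ?_
  simp only [field, real_inner_smul_left, real_inner_smul_right]
  rw [real_inner_comm, So.inner_act_self]
  ring

/-- By the definition of `a`, `⟨𝐈(a ∧ γ), x ∧ γ⟩ = ⟨B_γ a, x⟩ = ⟨[𝐈ω, ω], ω⟩ = ⟨𝐈ω, [ω, ω]⟩ = 0`,
using the invariance of the scalar product. -/
theorem hasDerivAt_energy_field (hγ0 : γ t ≠ 0 ∨ c = 0)
    (hx : HasDerivAt x (c • (S.field (x t, γ t)).1) t)
    (hγ : HasDerivAt γ (c • (S.field (x t, γ t)).2) t) :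
    HasDerivAt (fun s => S.energy (x s) (γ s)) 0 t := by
  have h1 := S.hasDerivAt_wedge_of_field hx hγ
  have h2 := S.inertiaC.hasFDerivAt.comp_hasDerivAt t h1
  refine (h2.inner ℝ h1).congr_deriv ?_
  rcases hγ0 with h | h
  · have h3 : inner ℝ (S.inertiaC (wedge (S.accel (x t) (γ t)) (γ t))) (wedge (x t) (γ t)) = 0 := by
      have h4 := S.inner_bop (γ t) (S.accel (x t) (γ t)) (x t)
      rw [S.inner_accel _ h, zero_mul, add_zero, S.bop_accel _ h, ← So.inner_wedge,
        So.inner_lie, lie_self, inner_zero_right] at h4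
      exact h4.symm
    simp only [Function.comp, map_smul, real_inner_smul_left, real_inner_smul_right]
    rw [inner_inertiaC_left, real_inner_comm, h3]
    ring
  · simp [h]

end Conservation

end RubberBall

end RubberRolling

/-! ### Positive determinants and the calculus of quadratic maps -/

theorem LinearMap.IsSymmetric.det_pos {V : Type*} [NormedAddCommGroup V] [InnerProductSpace ℝ V]
    [FiniteDimensional ℝ V] {T : V →ₗ[ℝ] V} (hT : T.IsSymmetric)
    (hpos : ∀ x, x ≠ 0 → 0 < inner ℝ (T x) x) : 0 < LinearMap.det T := by
  classical
  rw [hT.det_eq_prod_eigenvalues rfl]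
  simp only [RCLike.ofReal_real_eq_id]
  refine Finset.prod_pos fun i _ => ?_
  have hv : hT.eigenvectorBasis rfl i ≠ 0 := (hT.eigenvectorBasis rfl).toBasis.ne_zero i
  have h := hpos _ hv
  rw [hT.apply_eigenvectorBasis rfl i] at h
  simpa [real_inner_smul_left, real_inner_self_eq_norm_sq] using h

section Bilinear

variable {V W : Type*} [NormedAddCommGroup V] [NormedSpace ℝ V] [NormedAddCommGroup W]
  [NormedSpace ℝ W]

theorem contDiff_bilinear_self (B : V →L[ℝ] V →L[ℝ] W) {k : WithTop ℕ∞} :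
    ContDiff ℝ k fun v => B v v :=
  B.contDiff.clm_apply contDiff_id

theorem hasDerivAt_bilinear_self (B : V →L[ℝ] V →L[ℝ] W) {γ : ℝ → V} {γ' : V} {t : ℝ}
    (hγ : HasDerivAt γ γ' t) :
    HasDerivAt (fun s => B (γ s) (γ s)) (B γ' (γ t) + B (γ t) γ') t :=
  (B.hasFDerivAt.comp_hasDerivAt t hγ).clm_apply hγ

end Bilinear

namespace RubberRolling

variable {n : ℕ}

namespace RubberBall

variable (S : RubberBall n)

/-! ### Smoothness -/

theorem contDiff_bop {k : WithTop ℕ∞} : ContDiff ℝ k S.bop := by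
  exact contDiff_bilinear_self S.bopC

theorem contDiffAt_bopInv {k : WithTop ℕ∞} {γ : E n} (hγ : γ ≠ 0) : ContDiffAt ℝ k S.bopInv γ := by
  obtain ⟨u, hu⟩ := S.isUnit_bop hγ
  have h : ContDiffAt ℝ k Ring.inverse (S.bop γ) := hu ▸ contDiffAt_ringInverse ℝ u
  exact h.comp γ S.contDiff_bop.contDiffAt

theorem contDiff_wedge {k : WithTop ℕ∞} : ContDiff ℝ k fun z : E n × E n => wedge z.1 z.2 :=
  (wedgeC.contDiff.comp contDiff_fst).clm_apply contDiff_snd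

theorem contDiff_energy {k : WithTop ℕ∞} : ContDiff ℝ k fun z : E n × E n => S.energy z.1 z.2 :=
  (S.inertiaC.contDiff.comp contDiff_wedge).inner ℝ contDiff_wedge

theorem contDiffAt_field {k : WithTop ℕ∞} {z : E n × E n} (hz : z.2 ≠ 0) :
    ContDiffAt ℝ k S.field z := by
  have hw : ContDiff ℝ k fun z : E n × E n => wedge z.1 z.2 := contDiff_wedge
  have ha : ContDiff ℝ k fun z : E n × E n => (wedge z.1 z.2).act z.1 :=
    (actC.contDiff.comp hw).clm_apply contDiff_fst
  have hb : ContDiff ℝ k fun z : E n × E n => (wedge z.1 z.2).act z.2 :=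
    (actC.contDiff.comp hw).clm_apply contDiff_snd
  have hc : ContDiff ℝ k fun z : E n × E n =>
      (⁅S.inertiaC (wedge z.1 z.2), wedge z.1 z.2⁆ : So n).act z.2 :=
    (actC.contDiff.comp ((bracketC.contDiff.comp (S.inertiaC.contDiff.comp hw)).clm_apply
      hw)).clm_apply contDiff_snd
  have hd : ContDiffAt ℝ k (fun z : E n × E n => S.bopInv z.2) z :=
    (S.contDiffAt_bopInv hz).comp z contDiffAt_snd
  exact ((hd.clm_apply hc.contDiffAt).sub (ha.contDiffAt.const_smul S.ε)).prodMk
    (hb.contDiffAt.const_smul (-S.ε))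

/-! ### The divergence identity -/

theorem hasDerivAt_bop {γ : ℝ → E n} {γ' : E n} {t : ℝ} (hγ : HasDerivAt γ γ' t) :
    HasDerivAt (fun s => S.bop (γ s)) (S.bopC γ' (γ t) + S.bopC (γ t) γ') t :=
  hasDerivAt_bilinear_self S.bopC hγ

/-- With `γ̇ = -εu`, the derivative of `B_γ` is `-ε` times the sum of `h ↦ 𝐈(h ∧ u)γ`, its adjoint
`h ↦ 𝐈(h ∧ γ)u`, and two operators of rank one. The first two have equal traces against the
symmetric `B_γ⁻¹`, hence the factor `2`. The others have the trace `⟨γ, B_γ⁻¹u⟩ = 0`, as `u` is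
orthogonal to `γ`. -/
theorem trace_bopInv_bopDeriv {x γ : E n} (hγ : γ ≠ 0) :
    LinearMap.trace ℝ (E n) (S.bopInv γ *
      (S.bopC (-S.ε • (wedge x γ).act γ) γ + S.bopC γ (-S.ε • (wedge x γ).act γ)) :
        E n →L[ℝ] E n) =
      -(2 * S.ε) * LinearMap.trace ℝ (E n)
        (S.bopInv γ ∘L actC.flip ((wedge x γ).act γ) ∘L S.inertiaC ∘L wedgeC.flip γ) := by
  set u := (wedge x γ).act γ with hu
  have hγu : inner ℝ γ u = 0 := by rw [real_inner_comm, So.inner_act_self]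
  set R := S.bopInv γ
  have hlin : (S.bopInv γ * (S.bopC (-S.ε • u) γ + S.bopC γ (-S.ε • u)) : E n →L[ℝ] E n) =
      (-S.ε) • ((R ∘L actC.flip γ ∘L S.inertiaC ∘L wedgeC.flip u) +
        (R ∘L actC.flip u ∘L S.inertiaC ∘L wedgeC.flip γ) +
        ((innerSL ℝ γ).smulRight (R u) + (innerSL ℝ u).smulRight (R γ))) := by
    ext1 h
    simp only [map_smul, smul_apply, mul_apply_eq_comp, add_apply, bopC_apply,
      ContinuousLinearMap.comp_apply, ContinuousLinearMap.smulRight_apply, map_add,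
      ContinuousLinearMap.flip_apply, innerSL_apply_apply, smul_add, actC_apply, wedgeC_apply]
    rw [show S.bopInv γ = R from rfl]
    abel
  have e1 : LinearMap.trace ℝ (E n) ((innerSL ℝ γ).smulRight (R u) : E n →L[ℝ] E n) = 0 := by
    rw [trace_eq_inner_of_rank_one (a := γ) (b := R u) fun _ => rfl]
    exact S.inner_self_bopInv_eq_zero hγ hγu
  have e2 : LinearMap.trace ℝ (E n) ((innerSL ℝ u).smulRight (R γ) : E n →L[ℝ] E n) = 0 := by
    rw [trace_eq_inner_of_rank_one (a := u) (b := R γ) fun _ => rfl]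
    rw [← S.inner_bopInv_left hγ, real_inner_comm]
    exact S.inner_self_bopInv_eq_zero hγ hγu
  have e3 : LinearMap.trace ℝ (E n)
        (R ∘L actC.flip γ ∘L S.inertiaC ∘L wedgeC.flip u : E n →L[ℝ] E n) =
      LinearMap.trace ℝ (E n)
        (R ∘L actC.flip u ∘L S.inertiaC ∘L wedgeC.flip γ : E n →L[ℝ] E n) := by
    have h1 : LinearMap.trace ℝ (E n)
        (R ∘L actC.flip γ ∘L S.inertiaC ∘L wedgeC.flip u : E n →L[ℝ] E n) =
      LinearMap.trace ℝ (E n)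
        ((actC.flip u ∘L S.inertiaC ∘L wedgeC.flip γ) ∘L R : E n →L[ℝ] E n) := by
      refine trace_eq_of_inner_eq fun h k => ?_
      simp only [ContinuousLinearMap.coe_coe, ContinuousLinearMap.comp_apply,
        ContinuousLinearMap.flip_apply, actC_apply, wedgeC_apply]
      rw [S.inner_bopInv_left hγ, ← So.inner_wedge, inner_inertiaC_left, inner_wedge_left]
    rw [h1]
    exact LinearMap.trace_mul_comm ℝ
      (actC.flip u ∘L S.inertiaC ∘L wedgeC.flip γ : E n →L[ℝ] E n).toLinearMap R.toLinearMap
  rw [hlin]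
  simp only [ContinuousLinearMap.toLinearMap_smul, ContinuousLinearMap.toLinearMap_add, map_add,
    map_smul, e1, e2, e3, smul_eq_mul]
  ring

/-- The derivative in `x` of `accel x γ`. -/
def accelDeriv (x γ : E n) : E n →L[ℝ] E n :=
  S.bopInv γ ∘L actC.flip γ ∘L
    (bracketC.flip (wedge x γ) ∘L S.inertiaC + bracketC (S.inertiaC (wedge x γ))) ∘L wedgeC.flip γ

theorem hasFDerivAt_accel (x γ : E n) :
    HasFDerivAt (fun x => S.accel x γ) (S.accelDeriv x γ) x := by
  have h1 : HasFDerivAt (fun x : E n => wedge x γ) (wedgeC.flip γ) x :=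
    ((wedgeC (n := n)).flip γ).hasFDerivAt
  have h2 := S.inertiaC.hasFDerivAt.comp x h1
  have h3 := (bracketC.hasFDerivAt.comp x h2).clm_apply h1
  have h4 := (S.bopInv γ ∘L actC.flip γ).hasFDerivAt.comp x h3
  refine h4.congr_fderiv ?_
  ext1 h
  simp [accelDeriv, add_comm]

/-- Differentiating `[𝐈Ω, Ω]γ` in the direction `h` gives `𝐈(h ∧ γ)u - Ω𝐈(h ∧ γ)γ + [𝐈Ω, h ∧ γ]γ`,
and `𝐈(h ∧ γ)γ = B_γ h - ⟨γ, h⟩γ`. After applying `R = B_γ⁻¹`, only the first term has a trace: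
`RΩB_γ` has the trace of the skew `Ω`, the rank-one term gives `⟨γ, Ru⟩ = 0`, and the last is the
product of the symmetric `R` and the skew `S₂`. -/
theorem trace_accelDeriv (x : E n) {γ : E n} (hγ : γ ≠ 0) :
    LinearMap.trace ℝ (E n) (S.accelDeriv x γ) = LinearMap.trace ℝ (E n)
        (S.bopInv γ ∘L actC.flip ((wedge x γ).act γ) ∘L S.inertiaC ∘L wedgeC.flip γ) := by
  set Ω := wedge x γ with hΩ
  set R := S.bopInv γ
  set u := Ω.act γ with hu
  have hγu : inner ℝ γ u = 0 := by rw [real_inner_comm, So.inner_act_self]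
  set S₂ : E n →L[ℝ] E n := actC.flip γ ∘L bracketC (S.inertiaC Ω) ∘L wedgeC.flip γ with hS₂
  have hlin : S.accelDeriv x γ = R ∘L actC.flip u ∘L S.inertiaC ∘L wedgeC.flip γ -
      (R ∘L actC Ω) ∘L S.bop γ + (innerSL ℝ γ).smulRight (R u) + R ∘L S₂ := by
    ext1 h
    simp only [accelDeriv, add_apply, sub_apply,
      ContinuousLinearMap.comp_apply, ContinuousLinearMap.smulRight_apply, map_add, map_smul,
      ContinuousLinearMap.flip_apply, innerSL_apply_apply, bop_apply, wedgeC_apply, actC_apply,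
      bracketC_apply, hS₂, So.act_lie, ← hΩ]
    simp only [← hu, map_sub]
    rw [show S.bopInv γ = R from rfl]
    abel
  have e1 : LinearMap.trace ℝ (E n) ((innerSL ℝ γ).smulRight (R u) : E n →L[ℝ] E n) = 0 := by
    rw [trace_eq_inner_of_rank_one (a := γ) (b := R u) fun _ => rfl]
    exact S.inner_self_bopInv_eq_zero hγ hγu
  have e2 : LinearMap.trace ℝ (E n) ((R ∘L actC Ω) ∘L S.bop γ : E n →L[ℝ] E n) = 0 := by
    have h1 : LinearMap.trace ℝ (E n) ((R ∘L actC Ω) ∘L S.bop γ : E n →L[ℝ] E n) =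
        LinearMap.trace ℝ (E n) (S.bop γ ∘L (R ∘L actC Ω) : E n →L[ℝ] E n) :=
      LinearMap.trace_mul_comm ℝ (R ∘L actC Ω).toLinearMap (S.bop γ).toLinearMap
    rw [h1]
    refine trace_eq_zero_of_skew fun h k => ?_
    simp only [ContinuousLinearMap.coe_coe, ContinuousLinearMap.comp_apply, actC_apply]
    rw [S.bop_bopInv hγ, S.bop_bopInv hγ, So.inner_act_left]
  have hskew : ∀ h k, inner ℝ (S₂ h) k = -inner ℝ h (S₂ k) := by
    intro h k
    simp only [hS₂, ContinuousLinearMap.comp_apply, ContinuousLinearMap.flip_apply, wedgeC_apply,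
      actC_apply, bracketC_apply]
    rw [← So.inner_wedge, real_inner_comm _ h, ← So.inner_wedge, So.inner_lie, So.inner_lie,
      ← inner_neg_right, lie_skew]
  have e3 : LinearMap.trace ℝ (E n) (R ∘L S₂ : E n →L[ℝ] E n) = 0 := by
    have h1 : LinearMap.trace ℝ (E n) (R ∘L S₂ : E n →L[ℝ] E n) =
        LinearMap.trace ℝ (E n) (-(S₂ ∘L R) : E n →L[ℝ] E n) := by
      refine trace_eq_of_inner_eq fun h k => ?_
      simp only [ContinuousLinearMap.coe_coe, ContinuousLinearMap.comp_apply, neg_apply]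
      rw [S.inner_bopInv_left hγ, hskew, inner_neg_right]
    have h2 : LinearMap.trace ℝ (E n) (S₂ ∘L R : E n →L[ℝ] E n) =
        LinearMap.trace ℝ (E n) (R ∘L S₂ : E n →L[ℝ] E n) :=
      LinearMap.trace_mul_comm ℝ S₂.toLinearMap R.toLinearMap
    rw [ContinuousLinearMap.toLinearMap_neg, map_neg, h2] at h1
    linarith
  rw [hlin]
  simp only [ContinuousLinearMap.toLinearMap_sub, ContinuousLinearMap.toLinearMap_add, map_add,
    map_sub, e1, e2, e3]
  ring

/-- The terms with `ε` are divergence free as a pair: besides the skew `ω`, they produce `(h ∧ γ)x`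
from the `x`-derivative and `(x ∧ h)γ` from the `γ`-derivative. -/
theorem trace_fderiv_field (x : E n) {γ : E n} (hγ : γ ≠ 0) :
    LinearMap.trace ℝ (E n × E n) (fderiv ℝ S.field (x, γ)) =
      LinearMap.trace ℝ (E n) (S.accelDeriv x γ) := by
  have hd : DifferentiableAt ℝ S.field (x, γ) :=
    (S.contDiffAt_field (k := 1) (z := (x, γ)) hγ).differentiableAt one_ne_zero
  have h1 : HasFDerivAt (fun x => wedge x γ) (wedgeC.flip γ) x :=
    ((wedgeC (n := n)).flip γ).hasFDerivAt
  have h2 : HasFDerivAt (fun γ => wedge x γ) (wedgeC x) γ := (wedgeC x).hasFDerivAt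
  have h3 : HasFDerivAt (fun x => (wedge x γ).act x)
      ((actC (n := n)).flip x ∘L wedgeC.flip γ + actC (wedge x γ)) x :=
    ((actC.hasFDerivAt.comp x h1).clm_apply (hasFDerivAt_id x)).congr_fderiv (by
      ext1 h
      simp [add_comm])
  have h4 : HasFDerivAt (fun γ => (wedge x γ).act γ)
      ((actC (n := n)).flip γ ∘L wedgeC x + actC (wedge x γ)) γ :=
    ((actC.hasFDerivAt.comp γ h2).clm_apply (hasFDerivAt_id γ)).congr_fderiv (by
      ext1 h
      simp [add_comm])
  have h5 := (S.hasFDerivAt_accel x γ).sub (h3.const_smul S.ε)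
  have h6 := h4.const_smul (-S.ε)
  rw [trace_fderiv_prod hd h5 h6]
  have e0 : LinearMap.trace ℝ (E n) (actC (wedge x γ)) = 0 :=
    trace_eq_zero_of_skew fun h k => So.inner_act_left _ h k
  -- Separately the two traces are `±(n - 1)⟨x, γ⟩`. The sum of the operators is `h ↦ ⟨h, γ⟩x - ⟨h,
  -- x⟩γ`, which is skew.
  have e1 : LinearMap.trace ℝ (E n) ((actC (n := n)).flip x ∘L wedgeC.flip γ +
      (actC (n := n)).flip γ ∘L wedgeC x : E n →L[ℝ] E n) = 0 := by
    refine trace_eq_zero_of_skew fun h k => ?_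
    simp only [ContinuousLinearMap.coe_coe, add_apply, ContinuousLinearMap.comp_apply,
      ContinuousLinearMap.flip_apply, wedgeC_apply, actC_apply, act_wedge, inner_add_left,
      inner_add_right, inner_sub_left, inner_sub_right, real_inner_smul_left, real_inner_smul_right]
    rw [real_inner_comm γ x, real_inner_comm x k, real_inner_comm γ k]
    ring
  rw [ContinuousLinearMap.toLinearMap_add, map_add] at e1
  simp only [ContinuousLinearMap.toLinearMap_sub, ContinuousLinearMap.toLinearMap_smul,
    ContinuousLinearMap.toLinearMap_add, map_add, map_sub, map_smul, e0, smul_eq_mul]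
  linear_combination (-S.ε) * e1

end RubberBall

end RubberRolling

namespace RubberRolling

variable {n : ℕ}

namespace RubberBall

variable (S : RubberBall n)

/-! ### An invariant density on `ℝⁿ × ℝⁿ` -/

theorem det_bop_pos {γ : E n} (hγ : γ ≠ 0) : 0 < LinearMap.det (S.bop γ : E n →ₗ[ℝ] E n) := by
  refine LinearMap.IsSymmetric.det_pos (S.inner_bop_left γ) fun h hh => ?_
  have h0 : 0 ≤ inner ℝ (S.bop γ h) h := by
    rw [inner_bop]
    have h1 := S.le_inner_inertiaC (wedge h γ)
    have h2 : 0 ≤ S.D * ‖wedge h γ‖ ^ 2 := mul_nonneg S.D_pos.le (sq_nonneg _)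
    nlinarith [mul_self_nonneg (inner ℝ γ h : ℝ)]
  refine lt_of_le_of_ne h0 fun h1 => hh ?_
  have h1' : inner ℝ (S.bop γ h) h = 0 := h1.symm
  rw [inner_bop] at h1'
  have h2 := S.le_inner_inertiaC (wedge h γ)
  have h3 : 0 ≤ S.D * ‖wedge h γ‖ ^ 2 := mul_nonneg S.D_pos.le (sq_nonneg _)
  have h4 : (inner ℝ γ h : ℝ) = 0 := by
    have : (inner ℝ γ h : ℝ) * inner ℝ γ h = 0 := by
      nlinarith [mul_self_nonneg (inner ℝ γ h : ℝ)]
    simpa using this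
  have h5 : wedge h γ = 0 := by
    rw [h4, mul_zero, add_zero] at h1'
    have : S.D * ‖wedge h γ‖ ^ 2 = 0 := by linarith
    simpa [S.D_pos.ne'] using this
  refine S.bop_injective hγ ?_
  rw [bop_apply, h5, h4, map_zero, map_zero, ← actC_apply, map_zero]
  simp

/-- The density `(det bop)^{1/(2ε)}`, times functions of the first integrals. -/
def weight (θ η ζ : ℝ → ℝ) (z : E n × E n) : ℝ :=
  LinearMap.det (S.bop z.2 : E n →ₗ[ℝ] E n) ^ (1 / (2 * S.ε)) *
    (θ (inner ℝ z.2 z.2) * η (inner ℝ z.1 z.2) * ζ (S.energy z.1 z.2))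

/-- A compact set of `ℝⁿ × ℝⁿ` cut out by bounds on the first integrals. -/
def slab (c : ℝ) : Set (E n × E n) :=
  {z | 1 / 2 ≤ (inner ℝ z.2 z.2 : ℝ) ∧ (inner ℝ z.2 z.2 : ℝ) ≤ 2 ∧
    |(inner ℝ z.1 z.2 : ℝ)| ≤ 1 ∧ S.energy z.1 z.2 ≤ c}

theorem snd_ne_zero_of_mem_slab {c : ℝ} {z : E n × E n} (hz : z ∈ S.slab c) : z.2 ≠ 0 := by
  intro h
  have := hz.1
  rw [h, inner_zero_left] at this
  norm_num at this

/-- The energy is at least `D|x ∧ γ|² = D(|x|²|γ|² - ⟨x, γ⟩²)`, so with `|γ|² ≥ 1/2` and `|⟨x, γ⟩| ≤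
1` it bounds `|x|`. -/
theorem isCompact_slab (c : ℝ) : IsCompact (S.slab c) := by
  refine Metric.isCompact_of_isClosed_isBounded ?_ ?_
  · have h1 : Continuous fun z : E n × E n => (inner ℝ z.2 z.2 : ℝ) := by fun_prop
    have h2 : Continuous fun z : E n × E n => |(inner ℝ z.1 z.2 : ℝ)| := by fun_prop
    have h3 : Continuous fun z : E n × E n => S.energy z.1 z.2 :=
      (S.contDiff_energy (k := 0)).continuous
    exact (isClosed_le continuous_const h1).inter ((isClosed_le h1 continuous_const).inter
      ((isClosed_le h2 continuous_const).inter (isClosed_le h3 continuous_const)))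
  -- The bound obtained is `|x|² ≤ 2(c/D + 1)`; the radius uses `|x| ≤ |x|² + 1`, and `|γ| ≤ 2`.
  · refine (Metric.isBounded_closedBall (x := (0 : E n × E n))
      (r := max (2 * (c / S.D + 1) + 1) 2)).subset fun z hz => ?_
    obtain ⟨h1, h2, h3, h4⟩ := hz
    rw [real_inner_self_eq_norm_sq] at h1 h2
    have h5 := (S.le_inner_inertiaC (wedge z.1 z.2)).trans h4
    rw [norm_wedge_sq] at h5
    have h6 : ‖z.1‖ ^ 2 * ‖z.2‖ ^ 2 - (inner ℝ z.1 z.2 : ℝ) ^ 2 ≤ c / S.D := by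
      rw [le_div_iff₀ S.D_pos]
      linarith
    have h7 : (inner ℝ z.1 z.2 : ℝ) ^ 2 ≤ 1 := by
      rw [sq_le_one_iff_abs_le_one]
      exact h3
    have h8 : ‖z.1‖ ^ 2 ≤ 2 * (c / S.D + 1) := by
      nlinarith [sq_nonneg ‖z.1‖]
    rw [mem_closedBall_zero_iff, Prod.norm_def]
    refine max_le_max ?_ ?_
    · nlinarith [norm_nonneg z.1]
    · nlinarith [norm_nonneg z.2]

section Weight

variable {θ η ζ : ℝ → ℝ} {c : ℝ}

theorem mem_slab_of_weight_ne_zero (hθs : ∀ s, θ s ≠ 0 → 1 / 2 ≤ s ∧ s ≤ 2)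
    (hηs : ∀ s, η s ≠ 0 → |s| ≤ 1)
    (hζs : ∀ s, ζ s ≠ 0 → s ≤ c) {z : E n × E n} (hz : S.weight θ η ζ z ≠ 0) :
    z ∈ S.slab c := by
  simp only [weight, mul_ne_zero_iff] at hz
  obtain ⟨-, ⟨h1, h2⟩, h3⟩ := hz
  exact ⟨(hθs _ h1).1, (hθs _ h1).2, hηs _ h2, hζs _ h3⟩

theorem hasCompactSupport_weight (hθs : ∀ s, θ s ≠ 0 → 1 / 2 ≤ s ∧ s ≤ 2)
    (hηs : ∀ s, η s ≠ 0 → |s| ≤ 1)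
    (hζs : ∀ s, ζ s ≠ 0 → s ≤ c) : HasCompactSupport (S.weight θ η ζ) :=
  HasCompactSupport.of_support_subset_isCompact (S.isCompact_slab c) fun _ hz =>
    S.mem_slab_of_weight_ne_zero hθs hηs hζs hz

theorem weight_eventuallyEq_zero (hθs : ∀ s, θ s ≠ 0 → 1 / 2 ≤ s ∧ s ≤ 2)
    {z : E n × E n} (hz : z.2 = 0) : S.weight θ η ζ =ᶠ[𝓝 z] 0 := by
  have h1 : Continuous fun z : E n × E n => (inner ℝ z.2 z.2 : ℝ) := by fun_prop
  have h2 : ∀ᶠ w in 𝓝 z, (inner ℝ w.2 w.2 : ℝ) < 1 / 2 := by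
    refine h1.continuousAt.eventually_lt_const ?_
    simp only [hz, inner_zero_left]
    norm_num
  filter_upwards [h2] with w hw
  have h3 : θ (inner ℝ w.2 w.2) = 0 := by
    by_contra h
    linarith [(hθs _ h).1]
  simp only [weight, h3, zero_mul, mul_zero, Pi.zero_apply]

theorem contDiffAt_weight (hθ : ContDiff ℝ 1 θ) (hη : ContDiff ℝ 1 η)
    (hζ : ContDiff ℝ 1 ζ) {z : E n × E n} (hz : z.2 ≠ 0) :
    ContDiffAt ℝ 1 (S.weight θ η ζ) z := by
  have h1 : ContDiff ℝ 1 fun z : E n × E n => LinearMap.det (S.bop z.2 : E n →ₗ[ℝ] E n) :=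
    contDiff_linearMap_det.comp (S.contDiff_bop.comp contDiff_snd)
  have h2 : ContDiff ℝ 1 fun z : E n × E n => θ (inner ℝ z.2 z.2) :=
    hθ.comp (contDiff_snd.inner ℝ contDiff_snd)
  have h3 : ContDiff ℝ 1 fun z : E n × E n => η (inner ℝ z.1 z.2) :=
    hη.comp (contDiff_fst.inner ℝ contDiff_snd)
  have h4 : ContDiff ℝ 1 fun z : E n × E n => ζ (S.energy z.1 z.2) :=
    hζ.comp S.contDiff_energy
  exact (h1.contDiffAt.rpow_const_of_ne (S.det_bop_pos hz).ne').mul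
    ((h2.mul h3).mul h4).contDiffAt

theorem contDiff_weight (hθ : ContDiff ℝ 1 θ) (hη : ContDiff ℝ 1 η)
    (hζ : ContDiff ℝ 1 ζ) (hθs : ∀ s, θ s ≠ 0 → 1 / 2 ≤ s ∧ s ≤ 2) :
    ContDiff ℝ 1 (S.weight θ η ζ) := by
  rw [contDiff_iff_contDiffAt]
  intro z
  by_cases hz : z.2 = 0
  · exact contDiffAt_const.congr_of_eventuallyEq (S.weight_eventuallyEq_zero hθs hz)
  · exact S.contDiffAt_weight hθ hη hζ hz

theorem contDiff_weight_smul_field (hθ : ContDiff ℝ 1 θ) (hη : ContDiff ℝ 1 η)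
    (hζ : ContDiff ℝ 1 ζ) (hθs : ∀ s, θ s ≠ 0 → 1 / 2 ≤ s ∧ s ≤ 2) :
    ContDiff ℝ 1 fun z => S.weight θ η ζ z • S.field z := by
  rw [contDiff_iff_contDiffAt]
  intro z
  by_cases hz : z.2 = 0
  · refine contDiffAt_const.congr_of_eventuallyEq
      (f := fun _ => 0) ((S.weight_eventuallyEq_zero (η := η) (ζ := ζ) hθs hz).mono fun w hw => ?_)
    simp only [hw, Pi.zero_apply, zero_smul]
  · exact (S.contDiffAt_weight hθ hη hζ hz).smul (S.contDiffAt_field hz)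

/-- The functions of the first integrals are constant to first order, and the exponent `1/(2ε)`
turns the logarithmic rate `-2ετ` of `det B_γ` into `-τ`. -/
theorem hasDerivAt_weight_field (hθ : ContDiff ℝ 1 θ) (hη : ContDiff ℝ 1 η) (hζ : ContDiff ℝ 1 ζ)
    {x γ : ℝ → E n} {t : ℝ} (hγ0 : γ t ≠ 0) (hx : HasDerivAt x (S.field (x t, γ t)).1 t)
    (hγ : HasDerivAt γ (S.field (x t, γ t)).2 t) :
    HasDerivAt (fun s => S.weight θ η ζ (x s, γ s))
      (-(S.weight θ η ζ (x t, γ t) * LinearMap.trace ℝ (E n) (S.accelDeriv (x t) (γ t)))) t := by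
  have hx' : HasDerivAt x ((1 : ℝ) • (S.field (x t, γ t)).1) t := by rwa [one_smul]
  have hγ' : HasDerivAt γ ((1 : ℝ) • (S.field (x t, γ t)).2) t := by rwa [one_smul]
  have f1 := (hθ.differentiable one_ne_zero _).hasDerivAt.comp t
    (S.hasDerivAt_inner_self_field hγ')
  have f2 := (hη.differentiable one_ne_zero _).hasDerivAt.comp t
    (S.hasDerivAt_inner_field_field (Or.inl hγ0) hx' hγ')
  have f3 := (hζ.differentiable one_ne_zero _).hasDerivAt.comp t
    (S.hasDerivAt_energy_field (Or.inl hγ0) hx' hγ')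
  have hdet := S.det_bop_pos hγ0
  have f4 := (hasDerivAt_linearMap_det (S.hasDerivAt_bop hγ) (S.bopInv_mul_bop hγ0)
    (S.bop_mul_bopInv hγ0)).rpow_const (p := 1 / (2 * S.ε)) (Or.inl hdet.ne')
  refine (f4.mul ((f1.mul f2).mul f3)).congr_deriv ?_
  have htr := S.trace_bopInv_bopDeriv (x := x t) hγ0
  rw [← S.trace_accelDeriv (x t) hγ0] at htr
  rw [show (S.field (x t, γ t)).2 = -S.ε • (wedge (x t) (γ t)).act (γ t) from rfl, htr]
  have hpow : LinearMap.det (S.bop (γ t) : E n →ₗ[ℝ] E n) ^ (1 / (2 * S.ε) - 1) *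
      LinearMap.det (S.bop (γ t) : E n →ₗ[ℝ] E n) =
      LinearMap.det (S.bop (γ t) : E n →ₗ[ℝ] E n) ^ (1 / (2 * S.ε)) := by
    rw [← Real.rpow_add_one hdet.ne', sub_add_cancel]
  have hε : 2 * S.ε * (1 / (2 * S.ε)) = 1 := by
    have := S.ε_ne_zero
    field_simp
  simp only [mul_zero, zero_mul, add_zero, Pi.mul_apply, Function.comp, weight]
  rw [← hpow]
  generalize LinearMap.det (S.bop (γ t) : E n →ₗ[ℝ] E n) = d
  generalize d ^ (1 / (2 * S.ε) - 1) = p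
  generalize LinearMap.trace ℝ (E n) (S.accelDeriv (x t) (γ t)) = τ
  generalize θ (inner ℝ (γ t) (γ t)) * η (inner ℝ (x t) (γ t)) * ζ (S.energy (x t) (γ t)) = q
  linear_combination (-(τ * d * p * q)) * hε

/-- The preceding lemma uses the curve only through its velocity at one instant, so a straight line
serves and no trajectory is needed. -/
theorem fderiv_weight_field (hθ : ContDiff ℝ 1 θ) (hη : ContDiff ℝ 1 η) (hζ : ContDiff ℝ 1 ζ)
    {z : E n × E n} (hz : z.2 ≠ 0) :
    fderiv ℝ (S.weight θ η ζ) z (S.field z) =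
      -(S.weight θ η ζ z * LinearMap.trace ℝ (E n) (S.accelDeriv z.1 z.2)) := by
  have hJ := ((S.contDiffAt_weight hθ hη hζ hz).differentiableAt one_ne_zero).hasFDerivAt
  have hline : HasDerivAt (fun s : ℝ => z + s • S.field z) (S.field z) 0 := by
    simpa using ((hasDerivAt_id (0 : ℝ)).smul_const (S.field z)).const_add z
  have h0 : z + (0 : ℝ) • S.field z = z := by simp
  have hJ' : HasFDerivAt (S.weight θ η ζ) (fderiv ℝ (S.weight θ η ζ) z)
      (z + (0 : ℝ) • S.field z) := by rwa [h0]
  have h1 := hJ'.comp_hasDerivAt (0 : ℝ) hline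
  have h2 := S.hasDerivAt_weight_field hθ hη hζ (t := 0)
    (x := fun s => (z + s • S.field z).1) (γ := fun s => (z + s • S.field z).2)
    (by rwa [h0]) (by rw [h0]; exact hline.fst) (by rw [h0]; exact hline.snd)
  rw [h0] at h2
  exact h1.unique h2

/-- `div(JX) = J div X + dJ(X) = Jτ - Jτ` for `γ ≠ 0`. Near `γ = 0` the factor `θ(|γ|²)` vanishes.
-/
theorem trace_fderiv_weight_smul_field (hθ : ContDiff ℝ 1 θ) (hη : ContDiff ℝ 1 η)
    (hζ : ContDiff ℝ 1 ζ) (hθs : ∀ s, θ s ≠ 0 → 1 / 2 ≤ s ∧ s ≤ 2) (z : E n × E n) :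
    LinearMap.trace ℝ (E n × E n) (fderiv ℝ (fun z => S.weight θ η ζ z • S.field z) z) = 0 := by
  by_cases hz : z.2 = 0
  · have : (fun z => S.weight θ η ζ z • S.field z) =ᶠ[𝓝 z] fun _ => 0 :=
      (S.weight_eventuallyEq_zero (η := η) (ζ := ζ) hθs hz).mono fun w hw => by
        simp only [hw, Pi.zero_apply, zero_smul]
    rw [this.fderiv_eq]
    simp
  · have hJ := (S.contDiffAt_weight hθ hη hζ hz).differentiableAt one_ne_zero
    have hX := (S.contDiffAt_field (k := 1) hz).differentiableAt one_ne_zero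
    rw [fderiv_fun_smul hJ hX, ContinuousLinearMap.toLinearMap_add, map_add,
      ContinuousLinearMap.toLinearMap_smul, map_smul]
    have h1 : LinearMap.trace ℝ (E n × E n)
        ((fderiv ℝ (S.weight θ η ζ) z).smulRight (S.field z) : _ →L[ℝ] _) =
        fderiv ℝ (S.weight θ η ζ) z (S.field z) :=
      LinearMap.trace_smulRight _ _
    rw [h1, S.fderiv_weight_field hθ hη hζ hz, ← S.trace_fderiv_field z.1 hz, smul_eq_mul,
      add_neg_cancel]

end Weight

end RubberBall

end RubberRolling

/-! ### Flows on compact invariant sets -/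

section InvariantCompact

variable {F : Type*} [NormedAddCommGroup F] [NormedSpace ℝ F]

/-- `Φ` consists of the solutions of `ż = X(z)` in the invariant set `C`. It comes from the flow of
a globally Lipschitz and bounded vector field `χ X` that agrees with `X` on `C`. -/
structure IsFlowOn (X : F → F) (U C : Set F) (χ : F → ℝ) (Φ : ℝ → F → F) : Prop where
  eq_one : ∀ z ∈ C, χ z = 1
  exists_lipschitzWith : ∃ K, LipschitzWith K fun z => χ z • X z
  exists_bound : ∃ L : ℝ≥0, ∀ z, ‖χ z • X z‖ ≤ L
  isGlobalFlow : IsGlobalFlow (fun z => χ z • X z) Φ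
  mem : ∀ z ∈ C, ∀ t, Φ t z ∈ C
  eq_of_hasDerivAt : ∀ z : ℝ → F, z 0 ∈ C → (∀ t, z t ∈ U) → (∀ t, HasDerivAt z (X (z t)) t) →
    ∀ t, z t = Φ t (z 0)

theorem IsFlowOn.continuous {X : F → F} {U C : Set F} {χ : F → ℝ} {Φ : ℝ → F → F}
    (h : IsFlowOn X U C χ Φ) (t : ℝ) : Continuous (Φ t) := by
  obtain ⟨K, hK⟩ := h.exists_lipschitzWith
  exact (h.isGlobalFlow.exists_lipschitzWith hK t).choose_spec.continuous

theorem IsFlowOn.hasDerivAt {X : F → F} {U C : Set F} {χ : F → ℝ} {Φ : ℝ → F → F}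
    (h : IsFlowOn X U C χ Φ) {z : F} (hz : z ∈ C) (t : ℝ) :
    HasDerivAt (fun s => Φ s z) (X (Φ t z)) t := by
  have := h.isGlobalFlow.hasDerivAt z t
  rwa [h.eq_one _ (h.mem z hz t), one_smul] at this

/-- The invariance hypothesis allows an arbitrary scalar factor, as sets defined by first integrals
do: a factor only changes the speed. It therefore applies to the cut-off flow and to true solutions
in `U` alike, and on `C` the two equations coincide. -/
theorem exists_isFlowOn [FiniteDimensional ℝ F] {X : F → F} {U C : Set F} (hU : IsOpen U)
    (hC : IsCompact C) (hCU : C ⊆ U) (hX : ContDiffOn ℝ 1 X U)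
    (hinv : ∀ (χ : F → ℝ) (z : ℝ → F), (∀ w ∉ U, χ w = 0) →
      (∀ t, HasDerivAt z (χ (z t) • X (z t)) t) → z 0 ∈ C → ∀ t, z t ∈ C) :
    ∃ χ Φ, IsFlowOn X U C χ Φ := by
  classical
  obtain ⟨χ, Φ, K, L, h1, h0, hK, hL, hΦ⟩ := exists_cutoff_isGlobalFlow hU hC hCU hX
  refine ⟨χ, Φ, h1, ⟨K, hK⟩, ⟨L, hL⟩, hΦ, fun z hz => ?_, fun z hz0 hzU hz t => ?_⟩
  · exact hinv χ (fun t => Φ t z) h0 (hΦ.hasDerivAt z) (by rwa [hΦ.zero])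
  -- For a solution that stays in `U`, the indicator of `U` serves as the factor.
  · have hzC : ∀ t, z t ∈ C := hinv (fun w => if w ∈ U then 1 else 0) z
      (fun w hw => if_neg hw) (fun t => by simpa [hzU t] using hz t) hz0
    refine congrFun (eq_of_hasDerivAt_of_lipschitzWith hK (f := z) (g := fun t => Φ t (z 0))
      (fun t => ?_) (hΦ.hasDerivAt _) (hΦ.zero _).symm) t
    rw [h1 _ (hzC t), one_smul]
    exact hz t

end InvariantCompact

namespace RubberRolling

variable {n : ℕ}

namespace RubberBall

variable (S : RubberBall n)

/-! ### Global solutions of the extended equations -/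

theorem isOpen_snd_ne_zero : IsOpen {z : E n × E n | z.2 ≠ 0} :=
  isOpen_ne_fun continuous_snd continuous_const

section Curve

variable {χ : ℝ → ℝ} {z : ℝ → E n × E n}

theorem inner_self_eq_of_field (hz : ∀ t, HasDerivAt z (χ t • S.field (z t)) t) (t : ℝ) :
    (inner ℝ (z t).2 (z t).2 : ℝ) = inner ℝ (z 0).2 (z 0).2 := by
  have h : ∀ t, HasDerivAt (fun s => (inner ℝ (z s).2 (z s).2 : ℝ)) 0 t := fun t =>
    S.hasDerivAt_inner_self_field (x := fun s => (z s).1) (γ := fun s => (z s).2) (hz t).snd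
  exact is_const_of_deriv_eq_zero (fun t => (h t).differentiableAt) (fun t => (h t).deriv) t 0

theorem inner_eq_of_field (hχ : ∀ t, (z t).2 = 0 → χ t = 0)
    (hz : ∀ t, HasDerivAt z (χ t • S.field (z t)) t) (t : ℝ) :
    (inner ℝ (z t).1 (z t).2 : ℝ) = inner ℝ (z 0).1 (z 0).2 := by
  have h : ∀ t, HasDerivAt (fun s => (inner ℝ (z s).1 (z s).2 : ℝ)) 0 t := fun t =>
    S.hasDerivAt_inner_field_field (x := fun s => (z s).1) (γ := fun s => (z s).2)
      (or_iff_not_imp_left.2 fun h => hχ t (not_not.1 h)) (hz t).fst (hz t).snd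
  exact is_const_of_deriv_eq_zero (fun t => (h t).differentiableAt) (fun t => (h t).deriv) t 0

theorem energy_eq_of_field (hχ : ∀ t, (z t).2 = 0 → χ t = 0)
    (hz : ∀ t, HasDerivAt z (χ t • S.field (z t)) t) (t : ℝ) :
    S.energy (z t).1 (z t).2 = S.energy (z 0).1 (z 0).2 := by
  have h : ∀ t, HasDerivAt (fun s => S.energy (z s).1 (z s).2) 0 t := fun t =>
    S.hasDerivAt_energy_field (x := fun s => (z s).1) (γ := fun s => (z s).2)
      (or_iff_not_imp_left.2 fun h => hχ t (not_not.1 h)) (hz t).fst (hz t).snd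
  exact is_const_of_deriv_eq_zero (fun t => (h t).differentiableAt) (fun t => (h t).deriv) t 0

theorem mem_slab_of_field {c : ℝ} (hχ : ∀ t, (z t).2 = 0 → χ t = 0)
    (hz : ∀ t, HasDerivAt z (χ t • S.field (z t)) t) (h0 : z 0 ∈ S.slab c) (t : ℝ) :
    z t ∈ S.slab c := by
  simpa only [slab, Set.mem_ofPred_eq, S.inner_self_eq_of_field hz t,
    S.inner_eq_of_field hχ hz t, S.energy_eq_of_field hχ hz t] using h0

end Curve

theorem exists_isFlowOn_field (c : ℝ) :
    ∃ χ Φ, IsFlowOn S.field {z | z.2 ≠ 0} (S.slab c) χ Φ := by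
  refine exists_isFlowOn isOpen_snd_ne_zero (S.isCompact_slab c)
    (fun z hz => S.snd_ne_zero_of_mem_slab hz)
    (fun z hz => (S.contDiffAt_field hz).contDiffWithinAt) fun χ z hχ hz h0 => ?_
  exact S.mem_slab_of_field (χ := fun t => χ (z t)) (fun t ht => hχ _ (by simpa using ht)) hz h0

/-- The weight vanishes off the slab and `χ = 1` on it, so the cutoff disappears from the product of
weight and field. -/
theorem measurePreserving_of_isFlowOn_field {c : ℝ} {χ : E n × E n → ℝ}
    {Φ : ℝ → E n × E n → E n × E n} (hΦ : IsFlowOn S.field {z | z.2 ≠ 0} (S.slab c) χ Φ)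
    {θ η ζ : ℝ → ℝ} (hθ : ContDiff ℝ 1 θ) (hη : ContDiff ℝ 1 η)
    (hζ : ContDiff ℝ 1 ζ) (hθs : ∀ s, θ s ≠ 0 → 1 / 2 ≤ s ∧ s ≤ 2) (hηs : ∀ s, η s ≠ 0 → |s| ≤ 1)
    (hζs : ∀ s, ζ s ≠ 0 → s ≤ c) (hw : ∀ z, 0 ≤ S.weight θ η ζ z) (t : ℝ) :
    MeasurePreserving (Φ t)
      ((volume : Measure (E n × E n)).withDensity fun z => ENNReal.ofReal (S.weight θ η ζ z))
      ((volume : Measure (E n × E n)).withDensity fun z => ENNReal.ofReal (S.weight θ η ζ z)) := by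
  obtain ⟨K, hK⟩ := hΦ.exists_lipschitzWith
  obtain ⟨L, hL⟩ := hΦ.exists_bound
  have heq : (fun z => S.weight θ η ζ z • (χ z • S.field z)) =
      fun z => S.weight θ η ζ z • S.field z := by
    funext z
    by_cases hz : S.weight θ η ζ z = 0
    · simp only [hz, zero_smul]
    · rw [hΦ.eq_one z (S.mem_slab_of_weight_ne_zero hθs hηs hζs hz), one_smul]
  have hWC := S.contDiff_weight hθ hη hζ hθs
  have hH : (volume : Measure (E n × E n)).IsAddHaarMeasure := by
    rw [Measure.volume_eq_prod]
    infer_instance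
  refine hΦ.isGlobalFlow.measurePreserving_withDensity volume hK hL hw hWC.continuous
    (S.hasCompactSupport_weight hθs hηs hζs) ?_ ?_ t
  · rw [heq]
    exact S.contDiff_weight_smul_field hθ hη hζ hθs
  · rw [heq]
    exact S.trace_fderiv_weight_smul_field hθ hη hζ hθs

/-- The equations of motion with the rotation of the ball, `ġ = gω` for the rows of `g`. -/
def fullField (p : (E n × E n) × (Fin n → E n)) : (E n × E n) × (Fin n → E n) :=
  (S.field p.1, fun i => -(wedge p.1.1 p.1.2).act (p.2 i))

theorem contDiffAt_fullField {p : (E n × E n) × (Fin n → E n)} (hp : p.1.2 ≠ 0) :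
    ContDiffAt ℝ 1 S.fullField p := by
  refine ((S.contDiffAt_field hp).comp p contDiffAt_fst).prodMk ?_
  refine ContDiff.contDiffAt (contDiff_pi.2 fun i => ContDiff.neg ?_)
  exact (actC.contDiff.comp (contDiff_wedge.comp contDiff_fst)).clm_apply
    ((contDiff_apply ℝ (E n) i).comp contDiff_snd)

theorem inner_rows_eq_of_fullField {χ : ℝ → ℝ} {p : ℝ → (E n × E n) × (Fin n → E n)}
    (hp : ∀ t, HasDerivAt p (χ t • S.fullField (p t)) t) (i j : Fin n) (t : ℝ) :
    (inner ℝ ((p t).2 i) ((p t).2 j) : ℝ) = inner ℝ ((p 0).2 i) ((p 0).2 j) := by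
  have hi : ∀ i t, HasDerivAt (fun s => (p s).2 i)
      (χ t • -(wedge (p t).1.1 (p t).1.2).act ((p t).2 i)) t := fun i t =>
    hasDerivAt_pi.1 (hp t).snd i
  have h : ∀ t, HasDerivAt (fun s => (inner ℝ ((p s).2 i) ((p s).2 j) : ℝ)) 0 t := fun t => by
    refine ((hi i t).inner ℝ (hi j t)).congr_deriv ?_
    simp only [real_inner_smul_left, real_inner_smul_right, inner_neg_left, inner_neg_right,
      So.inner_act_left]
    ring
  exact is_const_of_deriv_eq_zero (fun t => (h t).differentiableAt) (fun t => (h t).deriv) t 0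

/-- The products of the rows are conserved since `ω` is skew, so the unit ball in the maximum norm
is invariant. It contains the rows of every orthogonal matrix. -/
theorem exists_isFlowOn_fullField (c : ℝ) :
    ∃ χ Φ, IsFlowOn S.fullField {p | p.1.2 ≠ 0} (S.slab c ×ˢ Metric.closedBall 0 1) χ Φ := by
  refine exists_isFlowOn (isOpen_snd_ne_zero.preimage continuous_fst)
    ((S.isCompact_slab c).prod (isCompact_closedBall 0 1))
    (fun z hz => S.snd_ne_zero_of_mem_slab hz.1)
    (fun z hz => (S.contDiffAt_fullField hz).contDiffWithinAt) fun χ p hχ hp h0 t => ⟨?_, ?_⟩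
  · exact S.mem_slab_of_field (χ := fun t => χ (p t)) (z := fun t => (p t).1)
      (fun t ht => hχ _ (by simpa using ht)) (fun t => (hp t).fst) h0.1 t
  · have h2 := h0.2
    rw [mem_closedBall_zero_iff, pi_norm_le_iff_of_nonneg zero_le_one] at h2 ⊢
    intro i
    have h3 := S.inner_rows_eq_of_fullField (χ := fun t => χ (p t)) hp i i t
    rw [real_inner_self_eq_norm_sq, real_inner_self_eq_norm_sq] at h3
    rw [(pow_left_inj₀ (norm_nonneg _) (norm_nonneg _) two_ne_zero).1 h3]
    exact h2 i

end RubberBall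

end RubberRolling

/-! ### Radial projection to the sphere and the passage to the phase spaces -/

namespace RubberRolling

variable {n : ℕ}

/-- The projection `γ ↦ γ / |γ|` to the sphere, with value `p` at the origin. -/
def toSph (p : Sph n) (γ : E n) : Sph n := by
  classical
  exact if h : γ = 0 then p else ⟨‖γ‖⁻¹ • γ, by
    rw [mem_sphere_zero_iff_norm, norm_smul, norm_inv, norm_norm,
      inv_mul_cancel₀ (norm_ne_zero_iff.2 h)]⟩

theorem coe_toSph (p : Sph n) {γ : E n} (hγ : γ ≠ 0) : (toSph p γ : E n) = ‖γ‖⁻¹ • γ := by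
  simp [toSph, hγ]

theorem toSph_coe (p : Sph n) (γ : Sph n) : toSph p (γ : E n) = γ := by
  have h : ‖(γ : E n)‖ = 1 := mem_sphere_zero_iff_norm.1 γ.2
  refine Subtype.ext ?_
  rw [coe_toSph p (norm_ne_zero_iff.1 (by rw [h]; exact one_ne_zero)), h, inv_one, one_smul]

theorem norm_coe_sph (γ : Sph n) : ‖(γ : E n)‖ = 1 := mem_sphere_zero_iff_norm.1 γ.2

theorem coe_sph_ne_zero (γ : Sph n) : (γ : E n) ≠ 0 :=
  norm_ne_zero_iff.1 (by rw [norm_coe_sph]; exact one_ne_zero)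

namespace RubberBall

variable (S : RubberBall n)

/-! ### Correspondence between solutions -/

theorem act_wedge_self (x : E n) {γ : E n} (hγ : ‖γ‖ = 1) :
    wedge ((wedge x γ).act γ) γ = wedge x γ := by
  rw [act_wedge, wedge_sub_left, wedge_smul_left, wedge_smul_left, wedge_self, smul_zero, sub_zero,
    real_inner_self_eq_norm_sq, hγ, one_pow, one_smul]

theorem twist_inertiaC_wedge (x : E n) {γ : E n} (hγ : ‖γ‖ = 1) :
    S.twist γ (S.inertiaC (wedge x γ)) = 0 := by
  rw [S.twist_eq_zero_iff hγ, angularVelocity_inertiaC, act_wedge_self x hγ]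

/-- `x ∧ γ = (|γ|x) ∧ (γ/|γ|)`, and at `γ = 0` the momentum is zero. The projection to the phase
space is thus defined everywhere. -/
theorem twist_inertiaC_wedge_toSph (p : Sph n) (x γ : E n) :
    S.twist (toSph p γ : E n) (S.inertiaC (wedge x γ)) = 0 := by
  by_cases hγ : γ = 0
  · have h0 : wedge x γ = 0 := by rw [hγ, ← wedgeL_apply, map_zero]
    rw [h0, map_zero, map_zero]
  · have h1 : wedge x γ = wedge (‖γ‖ • x) (toSph p γ : E n) := by
      rw [coe_toSph p hγ, wedge_smul_left, wedge_smul_right, smul_smul,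
        mul_inv_cancel₀ (norm_ne_zero_iff.2 hγ), one_smul]
    rw [h1]
    exact S.twist_inertiaC_wedge _ (norm_coe_sph _)

/-- The coordinates `x = ωγ` and `γ` of a point of the reduced phase space. -/
def lift (m : So n) (γ : E n) : E n × E n := ((S.angularVelocity m).act γ, γ)

theorem wedge_lift {m : So n} {γ : E n} (hγ : ‖γ‖ = 1) (h : S.twist γ m = 0) :
    wedge (S.lift m γ).1 (S.lift m γ).2 = S.angularVelocity m :=
  ((S.twist_eq_zero_iff hγ).1 h).symm

theorem inertiaC_wedge_lift {m : So n} {γ : E n} (hγ : ‖γ‖ = 1) (h : S.twist γ m = 0) :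
    S.inertiaC (wedge (S.lift m γ).1 (S.lift m γ).2) = m := by
  rw [S.wedge_lift hγ h, inertiaC_angularVelocity]

theorem energy_lift {m : So n} {γ : E n} (hγ : ‖γ‖ = 1) (h : S.twist γ m = 0) :
    S.energy (S.lift m γ).1 (S.lift m γ).2 = inner ℝ m (S.angularVelocity m) := by
  rw [energy, S.wedge_lift hγ h, inertiaC_angularVelocity]

theorem lift_mem_slab {m : So n} {γ : E n} (hγ : ‖γ‖ = 1) (h : S.twist γ m = 0) {c : ℝ}
    (hc : inner ℝ m (S.angularVelocity m) ≤ c) : S.lift m γ ∈ S.slab c := by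
  refine ⟨?_, ?_, ?_, ?_⟩
  · change 1 / 2 ≤ (inner ℝ γ γ : ℝ)
    rw [real_inner_self_eq_norm_sq, hγ]
    norm_num
  · change (inner ℝ γ γ : ℝ) ≤ 2
    rw [real_inner_self_eq_norm_sq, hγ]
    norm_num
  · change |(inner ℝ ((S.angularVelocity m).act γ) γ : ℝ)| ≤ 1
    rw [So.inner_act_self]
    simp
  · rwa [S.energy_lift hγ h]

theorem hasDerivAt_lift {m : ℝ → So n} {γ : ℝ → E n} {v : So n} {t : ℝ} (hγ1 : ‖γ t‖ = 1)
    (htw : S.twist (γ t) (m t) = 0) (hv : S.IsMomentumVelocity (m t) (γ t) v)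
    (hm : HasDerivAt m v t) (hγ : HasDerivAt γ (-S.ε • (S.angularVelocity (m t)).act (γ t)) t) :
    HasDerivAt (fun s => S.lift (m s) (γ s)) (S.field (S.lift (m t) (γ t))) t := by
  have hγ0 : γ t ≠ 0 := norm_ne_zero_iff.1 (by rw [hγ1]; exact one_ne_zero)
  obtain ⟨l, hl, hvl, htv⟩ := hv
  have hω := S.wedge_lift hγ1 htw
  have h1 : HasDerivAt (fun s => S.angularVelocity (m s)) (S.angularVelocity v) t :=
    (S.angularVelocity.toContinuousLinearMap).hasFDerivAt.comp_hasDerivAt t hm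
  have h2 : HasDerivAt (fun s => (S.angularVelocity (m s)).act (γ s))
      ((S.angularVelocity v).act (γ t) + (S.angularVelocity (m t)).act
        (-S.ε • (S.angularVelocity (m t)).act (γ t))) t :=
    (actC.hasFDerivAt.comp_hasDerivAt t h1).clm_apply hγ
  -- As `B_γ` is injective, it is enough to compare images. The constraint on `v` gives `ω̇ = (ω̇γ)
  -- ∧ γ`, so `B_γ(ω̇γ) = vγ`, and `vγ = [m, ω]γ` because the multiplier annihilates `γ`.
  have h3 : (S.angularVelocity v).act (γ t) = S.accel (S.lift (m t) (γ t)).1 (γ t) := by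
    refine S.bop_injective hγ0 ?_
    rw [S.bop_accel _ hγ0, bop_apply, real_inner_comm, So.inner_act_self, zero_smul, add_zero,
      ← (S.twist_eq_zero_iff hγ1).1 htv, inertiaC_angularVelocity]
    change _ = (⁅S.inertiaC (wedge (S.lift (m t) (γ t)).1 (S.lift (m t) (γ t)).2),
      wedge (S.lift (m t) (γ t)).1 (S.lift (m t) (γ t)).2⁆ : So n).act (γ t)
    rw [hω, inertiaC_angularVelocity, hvl, ← actC_apply, map_add, add_apply, actC_apply,
      actC_apply, mem_hSpace.1 hl, add_zero]
  refine (h2.prodMk hγ).congr_deriv (Prod.ext ?_ ?_)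
  · change _ = S.accel (S.lift (m t) (γ t)).1 (γ t) -
      S.ε • (wedge (S.lift (m t) (γ t)).1 (S.lift (m t) (γ t)).2).act (S.lift (m t) (γ t)).1
    rw [hω, ← h3, ← actC_apply _ (-S.ε • _), map_smul, neg_smul, sub_eq_add_neg]
    rfl
  · change _ = -S.ε • (wedge (S.lift (m t) (γ t)).1 (S.lift (m t) (γ t)).2).act (γ t)
    rw [hω]

/-- The multiplier is recovered as `𝐈(a ∧ γ) - [m, ω]`. It lies in `𝔥_γ` because `B_γ a = [m, ω]γ`
and `a` is orthogonal to `γ`. -/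
theorem exists_isMomentumVelocity {z : ℝ → E n × E n} {t : ℝ} (p : Sph n) (h0 : (z t).2 ≠ 0)
    (hz : HasDerivAt z (S.field (z t)) t) :
    ∃ v, S.IsMomentumVelocity (S.inertiaC (wedge (z t).1 (z t).2)) (toSph p (z t).2) v ∧
      HasDerivAt (fun s => S.inertiaC (wedge (z s).1 (z s).2)) v t := by
  refine ⟨S.inertiaC (wedge (S.accel (z t).1 (z t).2) (z t).2),
      ⟨S.inertiaC (wedge (S.accel (z t).1 (z t).2) (z t).2) -
    ⁅S.inertiaC (wedge (z t).1 (z t).2), wedge (z t).1 (z t).2⁆, ?_, ?_, ?_⟩, ?_⟩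
  · rw [mem_hSpace, coe_toSph p h0, ← actC_apply, map_smul, map_sub, sub_apply, actC_apply,
      actC_apply, ← S.bop_accel _ h0, bop_apply, S.inner_accel _ h0, zero_smul, add_zero, sub_self,
      smul_zero]
  · rw [angularVelocity_inertiaC, add_sub_cancel]
  · exact S.twist_inertiaC_wedge_toSph p _ _
  · have h1 := S.hasDerivAt_wedge_of_field (x := fun s => (z s).1) (γ := fun s => (z s).2) (c := 1)
      (by rw [one_smul]; exact hz.fst) (by rw [one_smul]; exact hz.snd)
    rw [one_smul] at h1
    exact S.inertiaC.hasFDerivAt.comp_hasDerivAt t h1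

/-- `|γ|` is constant along the curve, so normalizing is multiplication by a constant in an equation
that is linear in `γ` for given `ω`. -/
theorem hasDerivAt_toSph {z : ℝ → E n × E n} (p : Sph n) (h0 : ∀ t, (z t).2 ≠ 0)
    (hz : ∀ t, HasDerivAt z (S.field (z t)) t) (t : ℝ) :
    HasDerivAt (fun s => (toSph p (z s).2 : E n))
      (-S.ε • (S.angularVelocity (S.inertiaC (wedge (z t).1 (z t).2))).act (toSph p (z t).2)) t := by
  have hn : ∀ t, ‖(z t).2‖ = ‖(z 0).2‖ := fun t => by
    have := S.inner_self_eq_of_field (χ := fun _ => 1) (fun t => by simpa using hz t) t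
    rw [real_inner_self_eq_norm_sq, real_inner_self_eq_norm_sq] at this
    exact (pow_left_inj₀ (norm_nonneg _) (norm_nonneg _) two_ne_zero).1 this
  have h1 : (fun s => (toSph p (z s).2 : E n)) = fun s => ‖(z 0).2‖⁻¹ • (z s).2 := by
    funext s
    rw [coe_toSph p (h0 s), hn]
  rw [h1, angularVelocity_inertiaC, coe_toSph p (h0 t), hn t]
  have h2 : HasDerivAt (fun s => (z s).2) (S.field (z t)).2 t := (hz t).snd
  refine (h2.const_smul (‖(z 0).2‖⁻¹)).congr_deriv ?_
  rw [← actC_apply _ (_ • _), map_smul, smul_comm]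
  rfl

/-- The point of the reduced phase space with the coordinates `(x, γ/|γ|)`. -/
def toReduced (p : Sph n) (z : E n × E n) : S.reducedPhaseSpace :=
  ⟨(S.inertiaC (wedge z.1 z.2), toSph p z.2), S.twist_inertiaC_wedge_toSph p z.1 z.2⟩

theorem toReduced_lift (p : Sph n) (y : S.reducedPhaseSpace) :
    S.toReduced p (S.lift y.1.1 y.1.2) = y :=
  Subtype.ext (Prod.ext (S.inertiaC_wedge_lift (norm_coe_sph _) y.2) (toSph_coe p _))

theorem isReducedSolution_toReduced {z : ℝ → E n × E n} (p : Sph n) (h0 : ∀ t, (z t).2 ≠ 0)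
    (hz : ∀ t, HasDerivAt z (S.field (z t)) t) :
    S.IsReducedSolution fun t => S.toReduced p (z t) := fun t =>
  ⟨S.exists_isMomentumVelocity p (h0 t) (hz t), S.hasDerivAt_toSph p h0 hz t⟩

theorem IsReducedSolution.hasDerivAt_lift {c : ℝ → S.reducedPhaseSpace}
    (hc : S.IsReducedSolution c) (t : ℝ) :
    HasDerivAt (fun s => S.lift (c s).1.1 (c s).1.2) (S.field (S.lift (c t).1.1 (c t).1.2)) t := by
  obtain ⟨⟨v, hv, hm⟩, hγ⟩ := hc t
  exact S.hasDerivAt_lift (m := fun s => (c s).1.1) (γ := fun s => ((c s).1.2 : E n))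
    (norm_coe_sph _) (c t).2 hv hm hγ

theorem IsReducedSolution.lift_eq_flow {k : ℝ} {χ : E n × E n → ℝ} {Φ : ℝ → E n × E n → E n × E n}
    (hΦ : IsFlowOn S.field {z | z.2 ≠ 0} (S.slab k) χ Φ) {c : ℝ → S.reducedPhaseSpace}
    (hc : S.IsReducedSolution c)
    (hk : inner ℝ (c 0).1.1 (S.angularVelocity (c 0).1.1) ≤ k) (t : ℝ) :
    S.lift (c t).1.1 (c t).1.2 = Φ t (S.lift (c 0).1.1 (c 0).1.2) :=
  hΦ.eq_of_hasDerivAt (fun s => S.lift (c s).1.1 (c s).1.2)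
    (S.lift_mem_slab (norm_coe_sph _) (c 0).2 hk) (fun _ => coe_sph_ne_zero _)
    (fun t => IsReducedSolution.hasDerivAt_lift S hc t) t

/-- Conservation of energy keeps everything in the slab at the energy of the initial point.
Existence projects the flow there; uniqueness lifts a solution to it, since projecting after lifting
is the identity. -/
theorem existsUnique_isReducedSolution (y : S.reducedPhaseSpace) :
    ∃! c : ℝ → S.reducedPhaseSpace, S.IsReducedSolution c ∧ c 0 = y := by
  obtain ⟨χ, Φ, hΦ⟩ := S.exists_isFlowOn_field (inner ℝ y.1.1 (S.angularVelocity y.1.1))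
  have hmem := S.lift_mem_slab (norm_coe_sph _) y.2 le_rfl
  refine ⟨fun t => S.toReduced y.1.2 (Φ t (S.lift y.1.1 y.1.2)),
    ⟨S.isReducedSolution_toReduced _
      (fun t => S.snd_ne_zero_of_mem_slab (hΦ.mem _ hmem t)) (hΦ.hasDerivAt hmem), ?_⟩, ?_⟩
  · simp only [hΦ.isGlobalFlow.zero, toReduced_lift]
  · rintro c ⟨hc, rfl⟩
    funext t
    rw [← IsReducedSolution.lift_eq_flow S hΦ hc le_rfl t, toReduced_lift]

/-! ### Solutions of the full system -/

/-- The rows of a matrix. -/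
def rows (g : Matrix (Fin n) (Fin n) ℝ) (i : Fin n) : E n := WithLp.toLp 2 (g i)

theorem rows_apply (g : Matrix (Fin n) (Fin n) ℝ) (i j : Fin n) : rows g i j = g i j := rfl

theorem inner_rows (g : Matrix (Fin n) (Fin n) ℝ) (i j : Fin n) :
    (inner ℝ (rows g i) (rows g j) : ℝ) = (g * gᵀ) i j := by
  simp only [PiLp.inner_apply, RCLike.inner_apply, conj_trivial, rows_apply, Matrix.mul_apply,
    Matrix.transpose_apply]
  exact Finset.sum_congr rfl fun k _ => mul_comm _ _

/-- Skewness turns right multiplication of a row by `ω` into `-ω` acting on a column, hence the sign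
in `fullField`. -/
theorem neg_act_rows (X : So n) (g : Matrix (Fin n) (Fin n) ℝ) (i j : Fin n) :
    (-(X.act (rows g i))) j = (g * X.mat) i j := by
  simp only [PiLp.neg_apply, So.act_apply, rows_apply, Matrix.mul_apply]
  rw [← Finset.sum_neg_distrib]
  refine Finset.sum_congr rfl fun k _ => ?_
  rw [X.mat_apply_swap k j]
  ring

theorem mem_specialOrthogonalGroup_iff' {g : Matrix (Fin n) (Fin n) ℝ} :
    g ∈ Matrix.specialOrthogonalGroup (Fin n) ℝ ↔ g * gᵀ = 1 ∧ g.det = 1 := by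
  rw [Matrix.mem_specialOrthogonalGroup_iff, Matrix.mem_orthogonalGroup_iff]

/-- The coordinates `x = ωγ`, `γ` and the rows of `g` of a point of the phase space. -/
def fullLift (y : S.phaseSpace) : (E n × E n) × (Fin n → E n) :=
  (S.lift y.1.1 y.1.2.2, rows y.1.2.1)

theorem fullLift_mem (y : S.phaseSpace) {k : ℝ} (hk : inner ℝ y.1.1 (S.angularVelocity y.1.1) ≤ k) :
    S.fullLift y ∈ S.slab k ×ˢ Metric.closedBall (0 : Fin n → E n) 1 := by
  refine ⟨S.lift_mem_slab (norm_coe_sph _) y.2 hk, ?_⟩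
  rw [mem_closedBall_zero_iff, pi_norm_le_iff_of_nonneg zero_le_one]
  intro i
  have h := inner_rows (y.1.2.1 : Matrix (Fin n) (Fin n) ℝ) i i
  rw [(mem_specialOrthogonalGroup_iff'.1 y.1.2.1.2).1, Matrix.one_apply_eq,
    real_inner_self_eq_norm_sq] at h
  exact (pow_le_one_iff_of_nonneg (norm_nonneg _) two_ne_zero).1 h.le

theorem hasDerivAt_rows_iff {g : ℝ → Matrix (Fin n) (Fin n) ℝ} {g' : Fin n → E n} {t : ℝ} :
    HasDerivAt (fun s => rows (g s)) g' t ↔ ∀ i j, HasDerivAt (fun s => g s i j) (g' i j) t := by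
  rw [hasDerivAt_pi]
  refine forall_congr' fun i => ?_
  constructor
  · intro h j
    exact ((EuclideanSpace.proj j : E n →L[ℝ] ℝ)).hasFDerivAt.comp_hasDerivAt t h
  · intro h
    have h1 : HasDerivAt (fun s => g s i) (g' i).ofLp t := hasDerivAt_pi.2 h
    exact ((EuclideanSpace.equiv (Fin n) ℝ).symm : (Fin n → ℝ) →L[ℝ] E n)
      |>.hasFDerivAt.comp_hasDerivAt t h1

theorem IsSolution.hasDerivAt_fullLift {c : ℝ → S.phaseSpace} (hc : S.IsSolution c) (t : ℝ) :
    HasDerivAt (fun s => S.fullLift (c s)) (S.fullField (S.fullLift (c t))) t := by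
  obtain ⟨⟨v, hv, hm⟩, hg, hγ⟩ := hc t
  refine (S.hasDerivAt_lift (m := fun s => (c s).1.1) (γ := fun s => ((c s).1.2.2 : E n))
    (norm_coe_sph _) (c t).2 hv hm hγ).prodMk (hasDerivAt_rows_iff.2 fun i j => ?_)
  have h1 : (-(wedge (S.fullLift (c t)).1.1 (S.fullLift (c t)).1.2).act ((S.fullLift (c t)).2 i)) j =
      (((c t).1.2.1 : Matrix (Fin n) (Fin n) ℝ) * (S.angularVelocity (c t).1.1).mat) i j := by
    rw [← neg_act_rows, ← S.wedge_lift (norm_coe_sph _) (c t).2]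
    rfl
  rw [h1]
  exact hg i j

theorem IsSolution.fullLift_eq_flow {k : ℝ} {χ : (E n × E n) × (Fin n → E n) → ℝ}
    {Φ : ℝ → (E n × E n) × (Fin n → E n) → (E n × E n) × (Fin n → E n)}
    (hΦ : IsFlowOn S.fullField {p | p.1.2 ≠ 0} (S.slab k ×ˢ Metric.closedBall 0 1) χ Φ)
    {c : ℝ → S.phaseSpace} (hc : S.IsSolution c)
    (hk : inner ℝ (c 0).1.1 (S.angularVelocity (c 0).1.1) ≤ k) (t : ℝ) :
    S.fullLift (c t) = Φ t (S.fullLift (c 0)) :=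
  hΦ.eq_of_hasDerivAt (fun s => S.fullLift (c s)) (S.fullLift_mem _ hk)
    (fun _ => coe_sph_ne_zero _) (fun t => IsSolution.hasDerivAt_fullLift S hc t) t

theorem fullLift_injective : Function.Injective S.fullLift := by
  intro y y' h
  have h1 : (y.1.2.2 : E n) = y'.1.2.2 := congrArg (fun p => p.1.2) h
  have h2 : rows (y.1.2.1 : Matrix (Fin n) (Fin n) ℝ) = rows y'.1.2.1 := congrArg Prod.snd h
  have h3 : y.1.1 = y'.1.1 := by
    rw [← S.inertiaC_wedge_lift (norm_coe_sph _) y.2, ← S.inertiaC_wedge_lift (norm_coe_sph _) y'.2]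
    exact congrArg (fun p => S.inertiaC (wedge p.1.1 p.1.2)) h
  refine Subtype.ext (Prod.ext h3 (Prod.ext (Subtype.ext ?_) (Subtype.ext h1)))
  ext i j
  exact congrArg (fun r : Fin n → E n => r i j) h2

theorem exists_isSolution (y : S.phaseSpace) : ∃ c : ℝ → S.phaseSpace, S.IsSolution c ∧ c 0 = y := by
  obtain ⟨χ, Φ, hΦ⟩ := S.exists_isFlowOn_fullField (inner ℝ y.1.1 (S.angularVelocity y.1.1))
  have hmem := S.fullLift_mem y le_rfl
  set p : ℝ → (E n × E n) × (Fin n → E n) := fun t => Φ t (S.fullLift y) with hp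
  have hd : ∀ t, HasDerivAt p (S.fullField (p t)) t := hΦ.hasDerivAt hmem
  have hp0 : p 0 = S.fullLift y := hΦ.isGlobalFlow.zero _
  have hne : ∀ t, (p t).1.2 ≠ 0 := fun t => S.snd_ne_zero_of_mem_slab (hΦ.mem _ hmem t).1
  set g : ℝ → Matrix (Fin n) (Fin n) ℝ := fun t => Matrix.of fun i j => (p t).2 i j with hg
  have hrows : ∀ t, rows (g t) = (p t).2 := fun t => rfl
  have hg0 : g 0 = y.1.2.1 := by
    ext i j
    change (p 0).2 i j = _
    rw [hp0]
    rfl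
  have horth : ∀ t, g t * (g t)ᵀ = 1 := fun t => by
    ext i j
    have h1 := S.inner_rows_eq_of_fullField (χ := fun _ => 1) (fun t => by simpa using hd t) i j t
    rw [← hrows, ← hrows, inner_rows, inner_rows, hg0,
      (mem_specialOrthogonalGroup_iff'.1 y.1.2.1.2).1] at h1
    exact h1
  have hgd : ∀ t i j, HasDerivAt (fun s => g s i j)
      (((-(wedge (p t).1.1 (p t).1.2).act (rows (g t) i))) j) t := fun t i j =>
    hasDerivAt_rows_iff.1 (hd t).snd i j
  have hdetc : Continuous fun t => (g t).det := Continuous.matrix_det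
    (continuous_matrix fun i j => continuous_iff_continuousAt.2 fun t => (hgd t i j).continuousAt)
  -- Orthogonality only gives `det² = 1`. The determinant is continuous in time and equals `1` at
  -- time `0`, so it cannot jump to `-1`.
  have hdet : ∀ t, (g t).det = 1 := fun t => by
    have hsq : ∀ t, (g t).det ^ 2 = 1 := fun t => by
      have := congrArg Matrix.det (horth t)
      rwa [Matrix.det_mul, Matrix.det_transpose, Matrix.det_one, ← sq] at this
    have h0 : (g 0).det = 1 := by
      rw [hg0]
      exact (mem_specialOrthogonalGroup_iff'.1 y.1.2.1.2).2
    rcases isPreconnected_univ.eq_one_or_eq_neg_one_of_sq_eq hdetc.continuousOn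
      (fun t _ => hsq t) with h | h
    · exact h (Set.mem_univ t)
    · have : (g 0).det = -1 := h (Set.mem_univ 0)
      rw [h0] at this
      norm_num at this
  have hSO : ∀ t, g t ∈ Matrix.specialOrthogonalGroup (Fin n) ℝ := fun t =>
    mem_specialOrthogonalGroup_iff'.2 ⟨horth t, hdet t⟩
  refine ⟨fun t => ⟨(S.inertiaC (wedge (p t).1.1 (p t).1.2), ⟨g t, hSO t⟩, toSph y.1.2.2 (p t).1.2),
    S.twist_inertiaC_wedge_toSph _ _ _⟩, fun t => ⟨?_, ?_, ?_⟩, ?_⟩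
  · exact S.exists_isMomentumVelocity (z := fun t => (p t).1) _ (hne t) (hd t).fst
  · intro i j
    rw [angularVelocity_inertiaC, ← neg_act_rows]
    exact hgd t i j
  · exact S.hasDerivAt_toSph (z := fun t => (p t).1) _ hne (fun t => (hd t).fst) t
  · refine Subtype.ext (Prod.ext ?_ (Prod.ext (Subtype.ext hg0) ?_))
    · change S.inertiaC (wedge (p 0).1.1 (p 0).1.2) = _
      rw [hp0]
      exact S.inertiaC_wedge_lift (norm_coe_sph _) y.2
    · change toSph y.1.2.2 (p 0).1.2 = _
      rw [hp0]
      exact toSph_coe _ _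

theorem existsUnique_isSolution (y : S.phaseSpace) :
    ∃! c : ℝ → S.phaseSpace, S.IsSolution c ∧ c 0 = y := by
  refine existsUnique_of_exists_of_unique (S.exists_isSolution y) ?_
  rintro c c' ⟨hc, hc0⟩ ⟨hc', hc0'⟩
  obtain ⟨χ, Φ, hΦ⟩ := S.exists_isFlowOn_fullField (inner ℝ y.1.1 (S.angularVelocity y.1.1))
  funext t
  refine S.fullLift_injective ?_
  rw [IsSolution.fullLift_eq_flow S hΦ hc (by rw [hc0]) t,
    IsSolution.fullLift_eq_flow S hΦ hc' (by rw [hc0']) t, hc0, hc0']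

end RubberBall

end RubberRolling

/-! ### Volumes under linear isomorphisms -/

theorem LinearMap.det_adjoint_real {F : Type*} [NormedAddCommGroup F] [InnerProductSpace ℝ F]
    [FiniteDimensional ℝ F] (f : F →ₗ[ℝ] F) :
    LinearMap.det (LinearMap.adjoint f) = LinearMap.det f := by
  let b := stdOrthonormalBasis ℝ F
  rw [← LinearMap.det_toMatrix b.toBasis, ← LinearMap.det_toMatrix b.toBasis,
    LinearMap.toMatrix_adjoint, Matrix.det_conjTranspose, star_trivial]

/-- A linear isomorphism `L` of Euclidean spaces multiplies the volume by `√det(L* L)`. -/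
theorem LinearEquiv.map_volume_eq_smul {F W : Type*} [NormedAddCommGroup F]
    [InnerProductSpace ℝ F] [FiniteDimensional ℝ F] [MeasurableSpace F] [BorelSpace F]
    [NormedAddCommGroup W] [InnerProductSpace ℝ W] [FiniteDimensional ℝ W] [MeasurableSpace W]
    [BorelSpace W] (L : F ≃ₗ[ℝ] W) (G : F →ₗ[ℝ] F)
    (hG : ∀ x y, (inner ℝ (G x) y : ℝ) = inner ℝ (L x) (L y)) :
    (volume : Measure F).map L =
      ENNReal.ofReal (1 / Real.sqrt (LinearMap.det G)) • (volume : Measure W) := by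
  let T : W ≃ₗᵢ[ℝ] F := (stdOrthonormalBasis ℝ W).equiv (stdOrthonormalBasis ℝ F)
    (finCongr L.finrank_eq.symm)
  let f : F ≃ₗ[ℝ] F := L.trans T.toLinearEquiv
  have hGf : G = LinearMap.adjoint (f : F →ₗ[ℝ] F) ∘ₗ (f : F →ₗ[ℝ] F) := by
    refine LinearMap.ext fun x => ext_inner_right ℝ fun y => ?_
    rw [hG, LinearMap.comp_apply, LinearMap.adjoint_inner_left]
    exact (T.inner_map_map _ _).symm
  have hdet : LinearMap.det G = LinearMap.det (f : F →ₗ[ℝ] F) ^ 2 := by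
    rw [hGf, LinearMap.det_comp, LinearMap.det_adjoint_real, sq]
  have hT := T.symm.measurePreserving
  have hLm : Measurable L := L.toLinearMap.continuous_of_finiteDimensional.measurable
  have hf0 : LinearMap.det (f : F →ₗ[ℝ] F) ≠ 0 := (LinearEquiv.isUnit_det' f).ne_zero
  have h1 := Measure.map_linearMap_addHaar_eq_smul_addHaar (volume : Measure F) hf0
  have h2 : (L : F → W) = T.symm ∘ (f : F →ₗ[ℝ] F) := by
    funext x
    exact (T.symm_apply_apply (L x)).symm
  rw [h2, ← Measure.map_map hT.measurable
    (LinearMap.continuous_of_finiteDimensional (f : F →ₗ[ℝ] F)).measurable, h1,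
    Measure.map_smul, hT.map_eq, hdet, Real.sqrt_sq_eq_abs, one_div, abs_inv]

namespace RubberRolling

variable {n : ℕ}

/-- For a unit vector `γ`, the minors of `M` along `𝔳_γ` and of `M⁻¹` along `𝔥_γ` agree up to
`det M`. -/
theorem det_wedge_compression {γ : E n} (hγ : ‖γ‖ = 1) (M N : So n →ₗ[ℝ] So n)
    (hMN : M ∘ₗ N = LinearMap.id) (G : E n →ₗ[ℝ] E n)
    (hG : ∀ x, G x = (M (wedge x γ)).act γ + (inner ℝ γ x : ℝ) • γ) :
    LinearMap.det G = LinearMap.det M * LinearMap.det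
      ((hSpace γ).orthogonalProjectionOnto.toLinearMap ∘ₗ N ∘ₗ (hSpace γ).subtype) := by
  have hγγ : (inner ℝ γ γ : ℝ) = 1 := by rw [real_inner_self_eq_norm_sq, hγ, one_pow]
  let pr : So n →ₗ[ℝ] hSpace γ := (hSpace γ).orthogonalProjectionOnto.toLinearMap
  have hpr : ∀ X : So n, ((pr X : hSpace γ) : So n) = X - wedge (X.act γ) γ := fun X => by
    refine (Submodule.eq_starProjection_of_mem_of_inner_eq_zero (K := hSpace γ)
      (u := X) ?_ ?_)
    · rw [mem_hSpace, ← actC_apply, map_sub, sub_apply, actC_apply, actC_apply, act_wedge,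
        hγγ, one_smul, So.inner_act_self, zero_smul, sub_zero, sub_self]
    · intro w hw
      rw [sub_sub_cancel, inner_wedge_left, mem_hSpace.1 hw, inner_zero_right]
  -- Wedging with `γ` loses the component along `γ`. An extra factor `ℝ` records it, so that `so(n)
  -- × ℝ` splits as `ℝⁿ ⊕ 𝔥_γ`; extending `M` by the identity leaves its determinant unchanged.
  let ι : E n →ₗ[ℝ] So n × ℝ := (wedgeC.flip γ).toLinearMap.prod (innerSL ℝ γ).toLinearMap
  let ι' : So n × ℝ →ₗ[ℝ] E n :=
    (actC.flip γ).toLinearMap.coprod (LinearMap.toSpanSingleton ℝ (E n) γ)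
  let j : hSpace γ →ₗ[ℝ] So n × ℝ := (hSpace γ).subtype.prod 0
  let j' : So n × ℝ →ₗ[ℝ] hSpace γ := pr.coprod 0
  have hι : ∀ x, ι x = (wedge x γ, (inner ℝ γ x : ℝ)) := fun x => rfl
  have hι' : ∀ p, ι' p = p.1.act γ + p.2 • γ := fun p => rfl
  have hj : ∀ X, j X = ((X : So n), 0) := fun X => rfl
  have hj' : ∀ p, j' p = pr p.1 := fun p => add_zero _
  have hA : ∀ x : E n, (wedge x γ).act γ = x - (inner ℝ x γ : ℝ) • γ := fun x => by
    rw [act_wedge, hγγ, one_smul]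
  have key := det_compression_eq_det_mul ι ι' j j' ?_ ?_ ?_ ?_ ?_ (M.prodMap LinearMap.id)
    (N.prodMap LinearMap.id) ?_
  · rw [LinearMap.det_prodMap, LinearMap.det_id, mul_one] at key
    have h1 : G = ι' ∘ₗ M.prodMap LinearMap.id ∘ₗ ι := LinearMap.ext fun x => by
      rw [hG]
      rfl
    have h2 : pr ∘ₗ N ∘ₗ (hSpace γ).subtype = j' ∘ₗ N.prodMap LinearMap.id ∘ₗ j :=
      LinearMap.ext fun x => (hj' (N x, 0)).symm
    rw [h1, h2, key]
  · refine LinearMap.ext fun x => ?_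
    rw [LinearMap.comp_apply, hι, hι', hA, real_inner_comm, sub_add_cancel, LinearMap.id_apply]
  · refine LinearMap.ext fun X => ?_
    rw [LinearMap.comp_apply, hj, hι', mem_hSpace.1 X.2, zero_smul, add_zero, LinearMap.zero_apply]
  · refine LinearMap.ext fun x => Subtype.ext ?_
    rw [LinearMap.comp_apply, hι, hj', hpr, hA, ← wedgeL_apply, ← wedgeL_apply]
    simp [wedge_self, wedgeL_apply]
  · refine LinearMap.ext fun X => Subtype.ext ?_
    rw [LinearMap.comp_apply, hj, hj', hpr, mem_hSpace.1 X.2, ← wedgeL_apply]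
    simp
  · refine LinearMap.ext fun p => ?_
    rw [LinearMap.add_apply, LinearMap.comp_apply, LinearMap.comp_apply, hι, hj, hj', hpr, hι',
      LinearMap.id_apply]
    refine Prod.ext ?_ ?_
    · change wedge (p.1.act γ + p.2 • γ) γ + (p.1 - wedge (p.1.act γ) γ) = p.1
      rw [wedge_add_left, wedge_smul_left, wedge_self, smul_zero, add_zero, add_sub_cancel]
    · change (inner ℝ γ (p.1.act γ + p.2 • γ) : ℝ) + 0 = p.2
      rw [inner_add_right, real_inner_smul_right, hγγ, real_inner_comm, So.inner_act_self]
      ring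
  · exact LinearMap.ext fun p => Prod.ext (LinearMap.congr_fun hMN p.1) rfl

namespace RubberBall

variable (S : RubberBall n)

theorem modifiedInertia_comp_angularVelocity :
    S.modifiedInertia ∘ₗ S.angularVelocity = LinearMap.id :=
  LinearMap.ext S.inertiaC_angularVelocity

theorem det_modifiedInertia_pos : 0 < LinearMap.det S.modifiedInertia := by
  refine LinearMap.IsSymmetric.det_pos (fun X Y => S.inner_inertiaC_left X Y) fun X hX => ?_
  have h1 := S.le_inner_inertiaC X
  have h2 : 0 < S.D * ‖X‖ ^ 2 := mul_pos S.D_pos (pow_pos (norm_pos_iff.2 hX) 2)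
  exact h2.trans_le h1

theorem det_bop_eq {γ : E n} (hγ : ‖γ‖ = 1) :
    LinearMap.det (S.bop γ : E n →ₗ[ℝ] E n) =
      LinearMap.det S.modifiedInertia * LinearMap.det (S.twist γ ∘ₗ (hSpace γ).subtype) :=
  det_wedge_compression hγ S.modifiedInertia S.angularVelocity
    S.modifiedInertia_comp_angularVelocity _ fun _ => rfl

theorem density_eq {γ : E n} (hγ : ‖γ‖ = 1) :
    LinearMap.det (S.bop γ : E n →ₗ[ℝ] E n) ^ (1 / (2 * S.ε)) =
      LinearMap.det S.modifiedInertia ^ (1 / (2 * S.ε)) * S.density γ := by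
  have hγ0 : γ ≠ 0 := norm_ne_zero_iff.1 (by rw [hγ]; exact one_ne_zero)
  have h1 := S.det_bop_pos hγ0
  rw [S.det_bop_eq hγ] at h1 ⊢
  rw [Real.mul_rpow S.det_modifiedInertia_pos.le
    (pos_of_mul_pos_right h1 S.det_modifiedInertia_pos.le).le, density]

/-- The Gram operator of the constraints is the compression of `𝐈⁻²` to `𝔥_γ`, a form to which the
minor identity with `M = 𝐈²` applies. -/
theorem twist_comp_adjoint (γ : E n) :
    S.twist γ ∘ₗ LinearMap.adjoint (S.twist γ) =
      (hSpace γ).orthogonalProjectionOnto.toLinearMap ∘ₗ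
        (S.angularVelocity ∘ₗ S.angularVelocity) ∘ₗ (hSpace γ).subtype := by
  have h : LinearMap.adjoint (S.twist γ) = S.angularVelocity ∘ₗ (hSpace γ).subtype := by
    refine ((LinearMap.eq_adjoint_iff _ _).2 fun X Y => ?_).symm
    change inner ℝ (S.angularVelocity X) Y =
      inner ℝ X ((hSpace γ).orthogonalProjectionOnto (S.angularVelocity Y))
    rw [inner_angularVelocity_left]
    exact (Submodule.inner_orthogonalProjectionOnto_eq_of_mem_left X _).symm
  rw [h]
  rfl

/-- The coordinates `(𝐈(y ∧ γ), ⟨y, γ⟩)` on `ℝⁿ`. -/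
def fibreEquiv {γ : E n} (hγ : ‖γ‖ = 1) :
    E n ≃ₗ[ℝ] WithLp 2 (LinearMap.ker (S.twist γ) × ℝ) where
  toFun y := WithLp.toLp 2 (⟨S.inertiaC (wedge y γ), S.twist_inertiaC_wedge y hγ⟩, inner ℝ y γ)
  map_add' y y' := by
    refine WithLp.ofLp_injective 2 (Prod.ext (Subtype.ext ?_) ?_)
    · change S.inertiaC (wedge (y + y') γ) = S.inertiaC (wedge y γ) + S.inertiaC (wedge y' γ)
      rw [wedge_add_left, map_add]
    · exact inner_add_left _ _ _
  map_smul' r y := by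
    refine WithLp.ofLp_injective 2 (Prod.ext (Subtype.ext ?_) ?_)
    · change S.inertiaC (wedge (r • y) γ) = r • S.inertiaC (wedge y γ)
      rw [wedge_smul_left, map_smul]
    · exact real_inner_smul_left _ _ _
  invFun p := (S.angularVelocity p.fst).act γ + p.snd • γ
  left_inv y := by
    change (S.angularVelocity (S.inertiaC (wedge y γ))).act γ + (inner ℝ y γ : ℝ) • γ = y
    rw [angularVelocity_inertiaC, act_wedge, real_inner_self_eq_norm_sq, hγ, one_pow, one_smul,
      sub_add_cancel]
  right_inv p := by
    refine WithLp.ofLp_injective 2 (Prod.ext (Subtype.ext ?_) ?_)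
    · change S.inertiaC (wedge ((S.angularVelocity p.fst).act γ + p.snd • γ) γ) = p.fst
      rw [wedge_add_left, wedge_smul_left, wedge_self, smul_zero, add_zero,
        ← (S.twist_eq_zero_iff hγ).1 p.fst.2, inertiaC_angularVelocity]
    · change (inner ℝ ((S.angularVelocity p.fst).act γ + p.snd • γ) γ : ℝ) = p.snd
      rw [inner_add_left, real_inner_smul_left, real_inner_self_eq_norm_sq, hγ,
        So.inner_act_self]
      ring

/-- The Gram operator `G` of these coordinates is `B_γ` with `𝐈²` in place of `𝐈`, so `det G = (det
𝐈)² det(φφ*)` with `φ = S.twist γ`. The Jacobian is the factor in `fibreMeasure` times a constant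
independent of `γ`. -/
theorem map_fibreEquiv {γ : E n} (hγ : ‖γ‖ = 1) :
    (volume : Measure (E n)).map (S.fibreEquiv hγ) =
      ENNReal.ofReal (1 / LinearMap.det S.modifiedInertia) •
        ENNReal.ofReal (1 / Real.sqrt (LinearMap.det
          (S.twist γ ∘ₗ LinearMap.adjoint (S.twist γ)))) • volume := by
  let G : E n →ₗ[ℝ] E n := (actC.flip γ).toLinearMap ∘ₗ
    (S.modifiedInertia ∘ₗ S.modifiedInertia) ∘ₗ (wedgeC.flip γ).toLinearMap +
      (LinearMap.toSpanSingleton ℝ (E n) γ) ∘ₗ (innerSL ℝ γ).toLinearMap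
  have hG : ∀ x, G x =
      ((S.modifiedInertia ∘ₗ S.modifiedInertia) (wedge x γ)).act γ + (inner ℝ γ x : ℝ) • γ :=
    fun x => rfl
  have hdet := det_wedge_compression hγ (S.modifiedInertia ∘ₗ S.modifiedInertia)
    (S.angularVelocity ∘ₗ S.angularVelocity) (LinearMap.ext fun X => by
      change S.inertiaC (S.inertiaC (S.angularVelocity (S.angularVelocity X))) = X
      rw [inertiaC_angularVelocity, inertiaC_angularVelocity]) G hG
  rw [← twist_comp_adjoint, LinearMap.det_comp] at hdet
  rw [(S.fibreEquiv hγ).map_volume_eq_smul G, hdet, Real.sqrt_mul (mul_self_nonneg _),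
    Real.sqrt_mul_self S.det_modifiedInertia_pos.le, smul_smul, ← ENNReal.ofReal_mul
      (one_div_nonneg.2 S.det_modifiedInertia_pos.le), one_div_mul_one_div]
  intro x y
  rw [WithLp.prod_inner_apply]
  change _ = (inner ℝ (S.inertiaC (wedge x γ)) (S.inertiaC (wedge y γ)) : ℝ) +
    inner ℝ (inner ℝ x γ : ℝ) (inner ℝ y γ : ℝ)
  rw [hG, inner_add_left, ← So.inner_wedge, real_inner_smul_left]
  change inner ℝ (S.inertiaC (S.inertiaC (wedge x γ))) (wedge y γ) + _ = _
  rw [inner_inertiaC_left]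
  simp [real_inner_comm, mul_comm]

/-- Integration over the fibre in the coordinate `y ∈ ℝⁿ`. -/
theorem lintegral_fibreMeasure {γ : E n} (hγ : ‖γ‖ = 1) {f : So n → ENNReal} (hf : Measurable f)
    {h : ℝ → ENNReal} (hh : Measurable h) :
    ∫⁻ y : E n, f (S.inertiaC (wedge y γ)) * h (inner ℝ y γ) =
      ENNReal.ofReal (1 / LinearMap.det S.modifiedInertia) * (∫⁻ s, h s) *
        ∫⁻ m, f m ∂fibreMeasure (S.twist γ) := by
  have hm : Measurable (S.fibreEquiv hγ) :=
    (S.fibreEquiv hγ).toLinearMap.continuous_of_finiteDimensional.measurable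
  have hF : Measurable fun q : LinearMap.ker (S.twist γ) × ℝ => f q.1 * h q.2 :=
    (hf.comp (measurable_subtype_coe.comp measurable_fst)).mul (hh.comp measurable_snd)
  have hF' : Measurable fun p : WithLp 2 (LinearMap.ker (S.twist γ) × ℝ) =>
      f (WithLp.ofLp p).1 * h (WithLp.ofLp p).2 :=
    hF.comp (WithLp.volume_preserving_ofLp (LinearMap.ker (S.twist γ)) ℝ).measurable
  have h1 : ∫⁻ y : E n, f (S.inertiaC (wedge y γ)) * h (inner ℝ y γ) =
      ∫⁻ p, f (WithLp.ofLp p).1 * h (WithLp.ofLp p).2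
        ∂(volume : Measure (E n)).map (S.fibreEquiv hγ) := (lintegral_map hF' hm).symm
  rw [h1, map_fibreEquiv, lintegral_smul_measure, lintegral_smul_measure,
    (WithLp.volume_preserving_ofLp (LinearMap.ker (S.twist γ)) ℝ).lintegral_comp hF,
    Measure.volume_eq_prod, lintegral_prod_mul (f := fun m : LinearMap.ker (S.twist γ) => f m)
      (hf.comp measurable_subtype_coe).aemeasurable hh.aemeasurable, fibreMeasure,
        lintegral_smul_measure,
    lintegral_map hf measurable_subtype_coe]
  simp only [smul_eq_mul]
  ring

end RubberBall

end RubberRolling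

/-- Integration in polar coordinates. -/
theorem lintegral_eq_lintegral_sphere {F : Type*} [NormedAddCommGroup F] [NormedSpace ℝ F]
    [FiniteDimensional ℝ F] [Nontrivial F] [MeasurableSpace F] [BorelSpace F] (μ : Measure F)
    [μ.IsAddHaarMeasure] {f : F → ENNReal} (hf : Measurable f) :
    ∫⁻ x, f x ∂μ = ∫⁻ u, ∫⁻ r, f ((r : ℝ) • (u : F))
      ∂Measure.volumeIoiPow (Module.finrank ℝ F - 1) ∂μ.toSphere := by
  have h0 : MeasurableSet ({0}ᶜ : Set F) := (measurableSet_singleton 0).compl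
  have h1 : ∫⁻ x, f x ∂μ = ∫⁻ x : ({0}ᶜ : Set F), f x ∂μ.comap (↑) := by
    rw [lintegral_subtype_comap h0, restrict_compl_singleton]
  have hm : Measurable fun q : Metric.sphere (0 : F) 1 × Set.Ioi (0 : ℝ) =>
      f ((q.2 : ℝ) • (q.1 : F)) := by
    refine hf.comp (Continuous.measurable ?_)
    fun_prop
  rw [h1, ← lintegral_prod _ hm.aemeasurable,
    ← (μ.measurePreserving_homeomorphUnitSphereProd).lintegral_comp hm]
  refine lintegral_congr fun x => ?_
  have := homeomorphUnitSphereProd_symm_apply_coe F (homeomorphUnitSphereProd F x)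
  rw [Homeomorph.symm_apply_apply] at this
  rw [this]

theorem lintegral_comp_smul {F : Type*} [NormedAddCommGroup F] [NormedSpace ℝ F]
    [FiniteDimensional ℝ F] [MeasurableSpace F] [BorelSpace F] (μ : Measure F)
    [μ.IsAddHaarMeasure] {f : F → ENNReal} (hf : Measurable f) {r : ℝ} (hr : r ≠ 0) :
    ∫⁻ x, f (r • x) ∂μ = ENNReal.ofReal |(r ^ Module.finrank ℝ F)⁻¹| * ∫⁻ x, f x ∂μ := by
  rw [← smul_eq_mul, ← lintegral_smul_measure, ← Measure.map_addHaar_smul μ hr,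
    lintegral_map hf (measurable_const_smul r)]

namespace RubberRolling

variable {n : ℕ}

namespace RubberBall

variable (S : RubberBall n)

/-! ### Integrals over the phase spaces -/

instance sFinite_fibreMeasure (γ : E n) : SFinite (fibreMeasure (S.twist γ)) := by
  unfold fibreMeasure
  infer_instance

/-- The fibres are varying subspaces. Rewriting the integral over the fixed space `ℝⁿ` makes the
dependence on `b` visibly measurable; the indicator of `[0, 1]` gives the superfluous variable `⟨y,
γ⟩` total mass one. -/
theorem measurable_lintegral_fibreMeasure {B : Type*} [MeasurableSpace B] {u : B → Sph n}
    (hu : Measurable u) {f : So n × B → ENNReal} (hf : Measurable f) :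
    Measurable fun b => ∫⁻ m, f (m, b) ∂fibreMeasure (S.twist (u b : E n)) := by
  have hh : Measurable ((Set.Icc (0 : ℝ) 1).indicator (fun _ => (1 : ENNReal))) :=
    measurable_const.indicator measurableSet_Icc
  have hd : ENNReal.ofReal (1 / LinearMap.det S.modifiedInertia) ≠ 0 := by
    simpa using S.det_modifiedInertia_pos
  have h1 : ∀ b, ∫⁻ m, f (m, b) ∂fibreMeasure (S.twist (u b : E n)) =
      (ENNReal.ofReal (1 / LinearMap.det S.modifiedInertia))⁻¹ *
        ∫⁻ y : E n, f (S.inertiaC (wedge y (u b)), b) *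
          (Set.Icc (0 : ℝ) 1).indicator (fun _ => (1 : ENNReal)) (inner ℝ y (u b : E n)) :=
            fun b => by
    rw [S.lintegral_fibreMeasure (f := fun m => f (m, b)) (norm_coe_sph (u b))
      (hf.comp measurable_prodMk_right) hh,
      lintegral_indicator measurableSet_Icc, setLIntegral_const, Real.volume_Icc, sub_zero,
      ENNReal.ofReal_one, mul_one, mul_one, ← mul_assoc,
      ENNReal.inv_mul_cancel hd ENNReal.ofReal_ne_top, one_mul]
  simp_rw [h1]
  refine Measurable.const_mul (Measurable.lintegral_prod_right' (f := fun q : B × E n =>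
    f (S.inertiaC (wedge q.2 (u q.1)), q.1) *
      (Set.Icc (0 : ℝ) 1).indicator (fun _ => (1 : ENNReal)) (inner ℝ q.2 (u q.1 : E n))) ?_) _
  have h2 : Measurable fun q : B × E n => (q.2, (u q.1 : E n)) :=
    measurable_snd.prodMk (measurable_subtype_coe.comp (hu.comp measurable_fst))
  have h3 : Measurable fun q : E n × E n => S.inertiaC (wedge q.1 q.2) :=
    (S.inertiaC.continuous.comp (contDiff_wedge (k := 0)).continuous).measurable
  have h4 : Measurable fun q : E n × E n => (inner ℝ q.1 q.2 : ℝ) :=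
    (continuous_fst.inner continuous_snd).measurable
  exact (hf.comp ((h3.comp h2).prodMk measurable_fst)).mul (hh.comp (h4.comp h2))

theorem lintegral_restrictToZeroLevel {B : Type*} [MeasurableSpace B] (β : Measure B)
    {u : B → Sph n} (hu : Measurable u) {f : So n × B → ENNReal} (hf : Measurable f) :
    ∫⁻ x, f x ∂restrictToZeroLevel β (fun b => hSpace (u b : E n))
      (fun b => S.twist (u b : E n)) =
      ∫⁻ b, ∫⁻ m, f (m, b) ∂fibreMeasure (S.twist (u b : E n)) ∂β := by
  have hk : Measurable fun b => (fibreMeasure (S.twist (u b : E n))).map fun m => (m, b) := by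
    refine Measure.measurable_of_measurable_coe _ fun s hs => ?_
    have h1 := S.measurable_lintegral_fibreMeasure hu
      ((measurable_const (a := (1 : ENNReal))).indicator hs)
    convert h1 using 2 with b
    rw [← lintegral_map (measurable_const.indicator hs) measurable_prodMk_right,
      lintegral_indicator hs, setLIntegral_const, one_mul]
  rw [restrictToZeroLevel, Measure.lintegral_bind hk.aemeasurable hf.aemeasurable]
  exact lintegral_congr fun b => lintegral_map hf measurable_prodMk_right

theorem continuous_bop : Continuous fun γ : E n => LinearMap.det (S.bop γ : E n →ₗ[ℝ] E n) :=
  (contDiff_linearMap_det (k := 0)).continuous.comp (S.contDiff_bop (k := 0)).continuous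

theorem measurable_density : Measurable fun γ : Sph n => S.density γ := by
  have h1 : ∀ γ : Sph n, S.density γ =
      (LinearMap.det S.modifiedInertia ^ (1 / (2 * S.ε)))⁻¹ *
        LinearMap.det (S.bop γ : E n →ₗ[ℝ] E n) ^ (1 / (2 * S.ε)) := fun γ => by
    rw [S.density_eq (norm_coe_sph γ), inv_mul_cancel_left₀
      (Real.rpow_pos_of_pos S.det_modifiedInertia_pos _).ne']
  simp_rw [h1]
  exact ((S.continuous_bop.measurable.comp measurable_subtype_coe).pow_const _).const_mul _

theorem lintegral_reducedVolume {f : So n × Sph n → ENNReal} (hf : Measurable f) :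
    ∫⁻ x, f x ∂S.reducedVolume = ∫⁻ γ : Sph n, ENNReal.ofReal (S.density γ) *
      ∫⁻ m, f (m, γ) ∂fibreMeasure (S.twist (γ : E n)) ∂sphereVolume n := by
  have hd : Measurable fun x : So n × Sph n => ENNReal.ofReal (S.density (x.2 : E n)) :=
    (S.measurable_density.comp measurable_snd).ennreal_ofReal
  rw [reducedVolume, lintegral_withDensity_eq_lintegral_mul _ hd hf,
    S.lintegral_restrictToZeroLevel (u := fun γ => γ) (sphereVolume n) measurable_id (hd.mul hf)]
  refine lintegral_congr fun γ => ?_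
  exact lintegral_const_mul (f := fun m => f (m, γ)) (ENNReal.ofReal (S.density (γ : E n)))
    (hf.comp measurable_prodMk_right)

/-- In the frame the Gram matrix is `[[A, 1], [-1, 0]]`, where only `A` depends on `m`. Multiplying
by the standard symplectic matrix gives a unitriangular matrix, so the determinant is `±1` whatever
`A` is. -/
theorem liouvilleDensity_eq (m : So n) :
    liouvilleDensity m = (Module.finrank ℝ (So n)).factorial := by
  have hA : (Matrix.of fun i j => canonicalSymplectic m (frame n i) (frame n j)) =
      Matrix.fromBlocks (Matrix.of fun i j => inner ℝ m
        ⁅stdOrthonormalBasis ℝ (So n) i, stdOrthonormalBasis ℝ (So n) j⁆) 1 (-1) 0 := by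
    have ho := orthonormal_iff_ite.1 (stdOrthonormalBasis ℝ (So n)).orthonormal
    ext i j
    rcases i with i | i <;> rcases j with j | j <;>
      simp [canonicalSymplectic, frame, ho, Matrix.one_apply]
  have h1 : (Matrix.of fun i j => canonicalSymplectic m (frame n i) (frame n j)).det *
      (Matrix.J (Fin (Module.finrank ℝ (So n))) ℝ).det = 1 := by
    rw [hA, ← Matrix.det_mul, Matrix.J, Matrix.fromBlocks_multiply]
    simp
  have h2 := Matrix.J_det_mul_J_det (Fin (Module.finrank ℝ (So n))) ℝ
  have h3 : |(Matrix.of fun i j => canonicalSymplectic m (frame n i) (frame n j)).det| = 1 := by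
    have h4 : |(Matrix.J (Fin (Module.finrank ℝ (So n))) ℝ).det| = 1 := by
      rw [← pow_left_inj₀ (abs_nonneg _) zero_le_one two_ne_zero, sq_abs, sq, h2, one_pow]
    have h5 := congrArg abs h1
    rwa [abs_mul, h4, mul_one, abs_one] at h5
  rw [liouvilleDensity, h3, Real.sqrt_one, mul_one]

theorem lintegral_phaseVolume (ν : Measure (SO n)) [SFinite ν] {f : Ambient n → ENNReal}
    (hf : Measurable f) :
    ∫⁻ x, f x ∂S.phaseVolume ν = ENNReal.ofReal (Module.finrank ℝ (So n)).factorial *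
      ∫⁻ y, ∫⁻ g, f (y.1, g, y.2) ∂ν ∂S.reducedVolume := by
  have hd : Measurable fun x : Ambient n =>
      ENNReal.ofReal (S.density (x.2.2 : E n) * liouvilleDensity x.1) := by
    simp_rw [liouvilleDensity_eq]
    exact ((S.measurable_density.comp (measurable_snd.comp measurable_snd)).mul_const
      _).ennreal_ofReal
  have hfin : IsFiniteMeasure (sphereVolume n) := by
    unfold sphereVolume
    infer_instance
  have hsh : Measurable fun q : (So n × Sph n) × SO n => (q.1.1, q.2, q.1.2) := by fun_prop
  have hf1 : Measurable fun y : So n × Sph n => ∫⁻ g, f (y.1, g, y.2) ∂ν :=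
    Measurable.lintegral_prod_right' (hf.comp hsh)
  rw [phaseVolume, lintegral_withDensity_eq_lintegral_mul _ hd hf,
    S.lintegral_restrictToZeroLevel (ν.prod (sphereVolume n)) measurable_snd (hd.mul hf),
    S.lintegral_reducedVolume hf1,
    lintegral_prod_symm' _ (S.measurable_lintegral_fibreMeasure measurable_snd (hd.mul hf)),
    ← lintegral_const_mul]
  · refine lintegral_congr fun γ => ?_
    have hg : Measurable fun q : SO n × So n => f (q.2, q.1, γ) :=
      hf.comp (measurable_snd.prodMk (measurable_fst.prodMk measurable_const))
    have hk : (fun q : SO n × So n => ((fun x : Ambient n => ENNReal.ofReal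
        (S.density (x.2.2 : E n) * liouvilleDensity x.1)) * f) (q.2, q.1, γ)) = fun q =>
        ENNReal.ofReal (Module.finrank ℝ (So n)).factorial * ENNReal.ofReal (S.density γ) *
          f (q.2, q.1, γ) := by
      funext q
      rw [Pi.mul_apply, liouvilleDensity_eq, mul_comm (S.density _),
        ENNReal.ofReal_mul (Nat.cast_nonneg _)]
    change ∫⁻ g, ∫⁻ m, (fun q : SO n × So n => ((fun x : Ambient n => ENNReal.ofReal
        (S.density (x.2.2 : E n) * liouvilleDensity x.1)) * f) (q.2, q.1, γ)) (g, m)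
          ∂fibreMeasure (S.twist (γ : E n)) ∂ν = _
    rw [hk, lintegral_lintegral_swap (hg.const_mul _).aemeasurable, ← mul_assoc,
      ← lintegral_const_mul _ (Measurable.lintegral_prod_left' hg)]
    refine lintegral_congr fun m => ?_
    exact lintegral_const_mul (f := fun g => f (m, g, γ)) _ (hg.comp measurable_prodMk_right)
  · exact (S.measurable_density.ennreal_ofReal).mul
      (S.measurable_lintegral_fibreMeasure (u := fun γ => γ) measurable_id hf1)

end RubberBall

end RubberRolling

/-! ### Push-forward of the weighted volume to the reduced phase space -/

namespace RubberRolling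

variable {n : ℕ}

theorem measurable_toSph (p : Sph n) : Measurable (toSph p) := by
  refine Measurable.subtype_mk (f := fun γ : E n => (toSph p γ : E n)) ?_
    (h := fun γ => (toSph p γ).2)
  have h : (fun γ : E n => (toSph p γ : E n)) =
      fun γ => if γ = 0 then (p : E n) else ‖γ‖⁻¹ • γ := by
    funext γ
    by_cases hγ : γ = 0 <;> simp [toSph, hγ]
  rw [h]
  exact Measurable.ite (measurableSet_singleton 0) measurable_const
    (measurable_norm.inv.smul measurable_id)

theorem toSph_smul (p : Sph n) (u : Sph n) {r : ℝ} (hr : 0 < r) :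
    toSph p (r • (u : E n)) = u := by
  refine Subtype.ext ?_
  rw [coe_toSph p (smul_ne_zero hr.ne' (coe_sph_ne_zero u)), norm_smul, norm_coe_sph, mul_one,
    Real.norm_of_nonneg hr.le, smul_smul, inv_mul_cancel₀ hr.ne', one_smul]

namespace RubberBall

variable (S : RubberBall n)

/-- The function `e(m) = ⟨m, ω⟩` on the reduced phase space. -/
def momentumEnergy (m : So n) : ℝ := inner ℝ m (S.angularVelocity m)

theorem continuous_momentumEnergy : Continuous S.momentumEnergy :=
  continuous_id.inner S.angularVelocity.continuous_of_finiteDimensional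

theorem energy_eq (x γ : E n) : S.energy x γ = S.momentumEnergy (S.inertiaC (wedge x γ)) := by
  rw [momentumEnergy, angularVelocity_inertiaC]
  rfl

theorem bop_det_smul (r : ℝ) (γ : E n) : LinearMap.det (S.bop (r • γ) : E n →ₗ[ℝ] E n) =
    (r ^ 2) ^ n * LinearMap.det (S.bop γ : E n →ₗ[ℝ] E n) := by
  rw [bop_smul, ContinuousLinearMap.toLinearMap_smul, LinearMap.det_smul, finrank_euclideanSpace,
    Fintype.card_fin]

/-- The ratio of the weighted volume of `ℝⁿ × ℝⁿ` and of the reduced volume. -/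
def volumeRatio (θ η : ℝ → ℝ) : ENNReal :=
  (∫⁻ r : Set.Ioi (0 : ℝ), ENNReal.ofReal |((r : ℝ) ^ n)⁻¹| *
      (ENNReal.ofReal ((((r : ℝ) ^ 2) ^ n) ^ (1 / (2 * S.ε))) * ENNReal.ofReal (θ ((r : ℝ) ^ 2)))
      ∂Measure.volumeIoiPow (n - 1)) *
    (ENNReal.ofReal (LinearMap.det S.modifiedInertia ^ (1 / (2 * S.ε))) *
      (ENNReal.ofReal (1 / LinearMap.det S.modifiedInertia) * ∫⁻ s, ENNReal.ofReal (η s)))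

/-- In polar coordinates `γ = ru` and with `y = rx`, the integrand splits into a function of `r`, a
function of `⟨y, u⟩` and a function on the fibre over `u`. The first two integrate to constants, and
the powers of `det 𝐈` from the density and from the fibre coordinates are constants too. -/
theorem lintegral_weight [Nontrivial (E n)] (p : Sph n) {θ η ζ : ℝ → ℝ} (hθ : Measurable θ)
    (hη : Measurable η) (hζ : Measurable ζ) (hθ0 : ∀ s, 0 ≤ θ s) (hη0 : ∀ s, 0 ≤ η s)
    {f : So n × Sph n → ENNReal} (hf : Measurable f) :
    ∫⁻ z : E n × E n, f (S.inertiaC (wedge z.1 z.2), toSph p z.2) *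
        ENNReal.ofReal (S.weight θ η ζ z) =
      S.volumeRatio θ η *
        ∫⁻ x, f x * ENNReal.ofReal (ζ (S.momentumEnergy x.1)) ∂S.reducedVolume := by
  set q : ℝ := 1 / (2 * S.ε) with hq
  let F : So n × Sph n → ENNReal := fun x => f x * ENNReal.ofReal (ζ (S.momentumEnergy x.1))
  have hF : Measurable F := hf.mul
    (hζ.comp (S.continuous_momentumEnergy.measurable.comp measurable_fst)).ennreal_ofReal
  have hdet : Measurable fun γ : E n =>
      ENNReal.ofReal (LinearMap.det (S.bop γ : E n →ₗ[ℝ] E n) ^ q) :=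
    (S.continuous_bop.measurable.pow_const q).ennreal_ofReal
  have hI : Measurable fun z : E n × E n => S.inertiaC (wedge z.1 z.2) :=
    (S.inertiaC.continuous.comp (contDiff_wedge (k := 0)).continuous).measurable
  have hin : Measurable fun z : E n × E n => (inner ℝ z.1 z.2 : ℝ) :=
    (continuous_fst.inner continuous_snd).measurable
  have hnn : Measurable fun γ : E n => (inner ℝ γ γ : ℝ) :=
    (continuous_id.inner continuous_id).measurable
  let W : E n × E n → ENNReal := fun z =>
    ENNReal.ofReal (LinearMap.det (S.bop z.2 : E n →ₗ[ℝ] E n) ^ q) *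
      ENNReal.ofReal (θ (inner ℝ z.2 z.2)) *
        (F (S.inertiaC (wedge z.1 z.2), toSph p z.2) * ENNReal.ofReal (η (inner ℝ z.1 z.2)))
  have hW : Measurable W := ((hdet.comp measurable_snd).mul
    ((hθ.comp hnn).ennreal_ofReal.comp measurable_snd)).mul
      ((hF.comp (hI.prodMk ((measurable_toSph p).comp measurable_snd))).mul
        (hη.comp hin).ennreal_ofReal)
  have hfW : ∀ z : E n × E n, f (S.inertiaC (wedge z.1 z.2), toSph p z.2) *
      ENNReal.ofReal (S.weight θ η ζ z) = W z := fun z => by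
    have hd : 0 ≤ LinearMap.det (S.bop z.2 : E n →ₗ[ℝ] E n) ^ q := by
      by_cases h : z.2 = 0
      · have h0 : S.bop z.2 = (0 : ℝ) ^ 2 • S.bop z.2 := by rw [← bop_smul, zero_smul, h]
        rw [h0, ContinuousLinearMap.toLinearMap_smul, LinearMap.det_smul]
        refine Real.rpow_nonneg ?_ _
        rw [finrank_euclideanSpace, Fintype.card_fin]
        have : n ≠ 0 := by
          rintro rfl
          exact not_subsingleton (E 0) inferInstance
        simp [this]
      · exact (Real.rpow_pos_of_pos (S.det_bop_pos h) _).le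
    simp only [W, F]
    rw [weight, ENNReal.ofReal_mul hd, ENNReal.ofReal_mul (mul_nonneg (hθ0 _) (hη0 _)),
      ENNReal.ofReal_mul (hθ0 _), energy_eq]
    ring
  have hinner : ∀ (u : Sph n) (r : Set.Ioi (0 : ℝ)), ∫⁻ x, W (x, (r : ℝ) • (u : E n)) =
      (ENNReal.ofReal |((r : ℝ) ^ n)⁻¹| * (ENNReal.ofReal ((((r : ℝ) ^ 2) ^ n) ^ q) *
        ENNReal.ofReal (θ ((r : ℝ) ^ 2)))) *
      (ENNReal.ofReal (LinearMap.det S.modifiedInertia ^ q) *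
        (ENNReal.ofReal (1 / LinearMap.det S.modifiedInertia) * ∫⁻ s, ENNReal.ofReal (η s))) *
      (ENNReal.ofReal (S.density (u : E n)) *
        ∫⁻ m, F (m, u) ∂fibreMeasure (S.twist (u : E n))) := fun u r => by
    have hr : (0 : ℝ) < r := r.2
    -- `x ∧ ru = rx ∧ u` and `⟨x, ru⟩ = ⟨rx, u⟩`, so `x` enters only through `rx`, and `det B_{ru} =
    -- r^{2n} det B_u`. The substitution `y = rx` then costs the factor `r⁻ⁿ`.
    have h1 : ∀ x : E n, W (x, (r : ℝ) • (u : E n)) =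
        ENNReal.ofReal ((((r : ℝ) ^ 2) ^ n) ^ q) * ENNReal.ofReal (θ ((r : ℝ) ^ 2)) *
        ENNReal.ofReal (LinearMap.det (S.bop (u : E n) : E n →ₗ[ℝ] E n) ^ q) *
        (F (S.inertiaC (wedge ((r : ℝ) • x) u), u) *
          ENNReal.ofReal (η (inner ℝ ((r : ℝ) • x) (u : E n)))) := fun x => by
      simp only [W]
      rw [toSph_smul p u hr, bop_det_smul, Real.mul_rpow (by positivity)
        (S.det_bop_pos (coe_sph_ne_zero u)).le, ENNReal.ofReal_mul (by positivity),
        real_inner_smul_left, real_inner_smul_right, real_inner_self_eq_norm_sq, norm_coe_sph,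
        one_pow, mul_one, ← sq, real_inner_smul_left, real_inner_smul_right, wedge_smul_left,
        wedge_smul_right]
      ring
    have hFu : Measurable fun m => F (m, u) := hF.comp measurable_prodMk_right
    have hy : Measurable fun y : E n => F (S.inertiaC (wedge y u), u) *
        ENNReal.ofReal (η (inner ℝ y (u : E n))) :=
      (hFu.comp (hI.comp measurable_prodMk_right)).mul
        (hη.comp (hin.comp measurable_prodMk_right)).ennreal_ofReal
    simp_rw [h1]
    rw [lintegral_const_mul (f := fun x : E n => F (S.inertiaC (wedge ((r : ℝ) • x) u), u) *
          ENNReal.ofReal (η (inner ℝ ((r : ℝ) • x) (u : E n)))) _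
        (hy.comp (measurable_const_smul (r : ℝ))),
      lintegral_comp_smul volume hy hr.ne', S.lintegral_fibreMeasure (norm_coe_sph u) hFu
        hη.ennreal_ofReal, S.density_eq (norm_coe_sph u), finrank_euclideanSpace, Fintype.card_fin,
      ENNReal.ofReal_mul (Real.rpow_nonneg S.det_modifiedInertia_pos.le _)]
    ring
  have hr : Measurable fun r : Set.Ioi (0 : ℝ) => ENNReal.ofReal |((r : ℝ) ^ n)⁻¹| *
      (ENNReal.ofReal ((((r : ℝ) ^ 2) ^ n) ^ q) * ENNReal.ofReal (θ ((r : ℝ) ^ 2))) := by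
    have h1 : Measurable fun r : Set.Ioi (0 : ℝ) => (r : ℝ) := measurable_subtype_coe
    exact (((h1.pow_const n).inv.norm).ennreal_ofReal).mul
      (((((h1.pow_const 2).pow_const n).pow_const q).ennreal_ofReal).mul
        (hθ.comp (h1.pow_const 2)).ennreal_ofReal)
  simp_rw [hfW]
  rw [Measure.volume_eq_prod, lintegral_prod_symm' _ hW,
    lintegral_eq_lintegral_sphere volume (Measurable.lintegral_prod_left' hW)]
  simp_rw [hinner]
  rw [S.lintegral_reducedVolume hF, finrank_euclideanSpace, Fintype.card_fin, volumeRatio,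
    ← lintegral_const_mul (f := fun γ : Sph n => ENNReal.ofReal (S.density (γ : E n)) *
      ∫⁻ m, F (m, γ) ∂fibreMeasure (S.twist (γ : E n)))]
  · refine lintegral_congr fun u => ?_
    rw [lintegral_mul_const _ (hr.mul_const _), lintegral_mul_const _ hr]
  · exact (S.measurable_density.ennreal_ofReal).mul
      (S.measurable_lintegral_fibreMeasure (u := fun γ => γ) measurable_id hF)

end RubberBall

end RubberRolling

/-! ### Cutoff functions and the non-degeneracy of the volume ratio -/

namespace RubberRolling

variable {n : ℕ}

theorem exists_cutoff (c : ℝ) {a b : ℝ} (ha : 0 < a) (hab : a < b) :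
    ∃ f : ℝ → ℝ, ContDiff ℝ 1 f ∧ (∀ s, 0 ≤ f s) ∧ (∀ s, |s - c| ≤ a → f s = 1) ∧
      ∀ s, f s ≠ 0 → |s - c| ≤ b := by
  let φ : ContDiffBump c := ⟨a, b, ha, hab⟩
  refine ⟨φ, φ.contDiff, fun s => φ.nonneg, fun s hs => φ.one_of_mem_closedBall ?_,
    fun s hs => ?_⟩
  · rwa [Metric.mem_closedBall, Real.dist_eq]
  · by_contra h
    exact hs (φ.zero_of_le_dist (by rw [Real.dist_eq]; exact (not_le.1 h).le))

namespace RubberBall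

variable (S : RubberBall n)

theorem weight_nonneg {θ η ζ : ℝ → ℝ} (hθ0 : ∀ s, 0 ≤ θ s) (hη0 : ∀ s, 0 ≤ η s)
    (hζ0 : ∀ s, 0 ≤ ζ s) (hθs : ∀ s, θ s ≠ 0 → 1 / 2 ≤ s ∧ s ≤ 2) (z : E n × E n) :
    0 ≤ S.weight θ η ζ z := by
  by_cases h : z.2 = 0
  · have : θ (inner ℝ z.2 z.2) = 0 := by
      by_contra h1
      have := (hθs _ h1).1
      rw [h, inner_zero_left] at this
      norm_num at this
    rw [weight, this, zero_mul, zero_mul, mul_zero]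
  · exact mul_nonneg (Real.rpow_pos_of_pos (S.det_bop_pos h) _).le
      (mul_nonneg (mul_nonneg (hθ0 _) (hη0 _)) (hζ0 _))

/-- The ratio need not be computed. For `f = 1` the weighted integral is that of a non-negative
continuous function with compact support, positive at `(0, p)`, so it is finite and positive; then
both factors are nonzero and the ratio is finite. -/
theorem volumeRatio_ne [Nontrivial (E n)] (p : Sph n) {θ η : ℝ → ℝ} (hθ : ContDiff ℝ 1 θ)
    (hη : ContDiff ℝ 1 η) (hθ0 : ∀ s, 0 ≤ θ s) (hη0 : ∀ s, 0 ≤ η s)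
    (hθs : ∀ s, θ s ≠ 0 → 1 / 2 ≤ s ∧ s ≤ 2) (hηs : ∀ s, η s ≠ 0 → |s| ≤ 1)
    (hθ1 : θ 1 = 1) (hη1 : η 0 = 1) :
    S.volumeRatio θ η ≠ 0 ∧ S.volumeRatio θ η ≠ ⊤ := by
  obtain ⟨ζ, hζ, hζ0, hζ1, hζs⟩ := exists_cutoff 0 zero_lt_one one_lt_two
  have hζs' : ∀ s, ζ s ≠ 0 → s ≤ 2 := fun s hs => by
    have := hζs s hs
    rw [sub_zero] at this
    exact (le_abs_self s).trans this
  have key := S.lintegral_weight p hθ.continuous.measurable hη.continuous.measurable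
    hζ.continuous.measurable hθ0 hη0 (f := fun _ => 1) measurable_const
  simp only [one_mul] at key
  have hw0 := S.weight_nonneg hθ0 hη0 hζ0 hθs
  have hc := (S.contDiff_weight hθ hη hζ hθs).continuous
  have hsupp := S.hasCompactSupport_weight hθs hηs hζs'
  have : (volume : Measure (E n × E n)).IsAddHaarMeasure := by
    rw [Measure.volume_eq_prod]
    infer_instance
  have hint : Integrable (S.weight θ η ζ) volume := 
    Continuous.integrable_of_hasCompactSupport (μ := (volume : Measure (E n × E n))) hc hsupp
  have hne : S.weight θ η ζ (0, (p : E n)) ≠ 0 := by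
    have h1 : S.energy 0 (p : E n) = 0 := by
      rw [energy_eq, ← wedgeL_apply, map_zero, LinearMap.zero_apply, map_zero, momentumEnergy,
        map_zero, inner_zero_left]
    simp only [weight]
    rw [inner_zero_left, h1, real_inner_self_eq_norm_sq, norm_coe_sph, one_pow, hθ1, hη1,
      hζ1 0 (by simp), mul_one, mul_one, mul_one]
    exact (Real.rpow_pos_of_pos (S.det_bop_pos (coe_sph_ne_zero p)) _).ne'
  have hpos := Continuous.integral_pos_of_hasCompactSupport_nonneg_nonzero
    (μ := (volume : Measure (E n × E n))) hc hsupp hw0 hne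
  rw [← ofReal_integral_eq_lintegral_ofReal hint (Eventually.of_forall hw0)] at key
  have hA : ENNReal.ofReal (∫ z, S.weight θ η ζ z) ≠ 0 := by simpa using hpos
  rw [key] at hA
  refine ⟨left_ne_zero_of_mul hA, fun h => ?_⟩
  rw [h, ENNReal.top_mul (right_ne_zero_of_mul hA)] at key
  exact ENNReal.ofReal_ne_top key

/-! ### The flows -/

theorem momentumEnergy_nonneg (m : So n) : 0 ≤ S.momentumEnergy m := by
  have h := S.le_inner_inertiaC (S.angularVelocity m)
  rw [inertiaC_angularVelocity] at h
  exact (mul_nonneg S.D_pos.le (sq_nonneg _)).trans h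

theorem IsReducedSolution.momentumEnergy_eq {c : ℝ → S.reducedPhaseSpace}
    (hc : S.IsReducedSolution c) (t : ℝ) :
    S.momentumEnergy (c t).1.1 = S.momentumEnergy (c 0).1.1 := by
  have h := S.energy_eq_of_field (χ := fun _ => 1)
    (z := fun s => S.lift (c s).1.1 (c s).1.2) (fun t h => absurd h (coe_sph_ne_zero (c t).1.2))
      (fun t => by
      simpa using IsReducedSolution.hasDerivAt_lift S hc t) t
  rwa [S.energy_lift (norm_coe_sph _) (c t).2, S.energy_lift (norm_coe_sph _) (c 0).2] at h

/-- The lift has a continuous left inverse up to the inclusion of the sphere. Continuity of the flow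
can therefore be tested in `ℝⁿ × ℝⁿ`. -/
theorem isInducing_lift :
    IsInducing fun y : S.reducedPhaseSpace => S.lift y.1.1 y.1.2 := by
  have h1 : Continuous fun m : So n => S.angularVelocity m :=
    S.angularVelocity.continuous_of_finiteDimensional
  have h2 : Continuous fun q : So n × E n => q.1.act q.2 := by
    have : Continuous fun q : So n × E n => actC q.1 q.2 :=
      (actC.continuous.comp continuous_fst).clm_apply continuous_snd
    exact this
  have h3 : Continuous fun z : E n × E n => (S.inertiaC (wedge z.1 z.2), z.2) :=
    (S.inertiaC.continuous.comp (contDiff_wedge (k := 0)).continuous).prodMk continuous_snd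
  have h4 : Continuous fun y : S.reducedPhaseSpace => (y.1.1, (y.1.2 : E n)) := by fun_prop
  refine IsInducing.of_comp (g := fun z : E n × E n => (S.inertiaC (wedge z.1 z.2), z.2)) ?_ h3 ?_
  · exact (h2.comp ((h1.comp continuous_fst).prodMk continuous_snd)).comp h4 |>.prodMk
      (continuous_snd.comp h4)
  · have h5 : ((fun z : E n × E n => (S.inertiaC (wedge z.1 z.2), z.2)) ∘
        fun y : S.reducedPhaseSpace => S.lift y.1.1 y.1.2) =
        (Prod.map id Subtype.val) ∘ (Subtype.val : S.reducedPhaseSpace → _) := by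
      funext y
      exact Prod.ext (S.inertiaC_wedge_lift (norm_coe_sph _) y.2) rfl
    rw [h5]
    exact (IsInducing.id.prodMap IsInducing.subtypeVal).comp IsInducing.subtypeVal

theorem isOpen_momentumEnergy_lt {X : Type*} [TopologicalSpace X] {f : X → So n}
    (hf : Continuous f) (k : ℝ) : IsOpen {y | S.momentumEnergy (f y) < k} :=
  isOpen_lt (S.continuous_momentumEnergy.comp hf) continuous_const

/-- Near `y` the energy stays below that of `y` plus one, so a single cut-off flow governs a whole
neighbourhood. -/
theorem continuous_reducedFlow {Φ : ℝ → S.reducedPhaseSpace → S.reducedPhaseSpace}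
    (hΦ : ∀ x, S.IsReducedSolution (fun t => Φ t x) ∧ Φ 0 x = x) (t : ℝ) : Continuous (Φ t) := by
  rw [S.isInducing_lift.continuous_iff, continuous_iff_continuousAt]
  intro y
  obtain ⟨χ, Ψ, hΨ⟩ := S.exists_isFlowOn_field (S.momentumEnergy y.1.1 + 1)
  have h1 : ContinuousAt (fun y : S.reducedPhaseSpace => Ψ t (S.lift y.1.1 y.1.2)) y :=
    ((hΨ.continuous t).comp S.isInducing_lift.continuous).continuousAt
  refine h1.congr ?_
  filter_upwards [(S.isOpen_momentumEnergy_lt (X := S.reducedPhaseSpace) (f := fun y => y.1.1)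
    (by fun_prop) _).mem_nhds (lt_add_one (S.momentumEnergy y.1.1))] with x hx
  have := IsReducedSolution.lift_eq_flow S hΨ (hΦ x).1 (by rw [(hΦ x).2]; exact hx.le) t
  rw [(hΦ x).2] at this
  exact this.symm

theorem isInducing_fullLift : IsInducing S.fullLift := by
  have h1 : Continuous fun m : So n => S.angularVelocity m :=
    S.angularVelocity.continuous_of_finiteDimensional
  have h2 : Continuous fun q : So n × E n => q.1.act q.2 := by
    have : Continuous fun q : So n × E n => actC q.1 q.2 :=
      (actC.continuous.comp continuous_fst).clm_apply continuous_snd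
    exact this
  let R : (E n × E n) × (Fin n → E n) → So n × Matrix (Fin n) (Fin n) ℝ × E n := fun p =>
    (S.inertiaC (wedge p.1.1 p.1.2), Matrix.of fun i j => p.2 i j, p.1.2)
  have h3 : Continuous R := by
    refine ((S.inertiaC.continuous.comp (contDiff_wedge (k := 0)).continuous).comp
      continuous_fst).prodMk (Continuous.prodMk ?_ (by fun_prop))
    exact continuous_matrix fun i j => by
      change Continuous fun p : (E n × E n) × (Fin n → E n) => p.2 i j
      fun_prop
  have h4 : Continuous fun y : S.phaseSpace => (y.1.1, (y.1.2.2 : E n)) := by fun_prop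
  refine IsInducing.of_comp (g := R) ?_ h3 ?_
  · refine Continuous.prodMk ((h2.comp ((h1.comp continuous_fst).prodMk continuous_snd)).comp h4
      |>.prodMk (continuous_snd.comp h4)) (continuous_pi fun i => ?_)
    have h6 : Continuous fun y : S.phaseSpace => y.1.2.1 :=
      continuous_fst.comp (continuous_snd.comp continuous_subtype_val)
    have h5 : Continuous fun y : S.phaseSpace => (y.1.2.1 : Matrix (Fin n) (Fin n) ℝ) i :=
      (continuous_apply i).comp h6.subtype_val
    exact (PiLp.continuous_toLp 2 _).comp h5
  · have h5 : R ∘ S.fullLift = (Prod.map id (Prod.map Subtype.val Subtype.val)) ∘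
        (Subtype.val : S.phaseSpace → _) := by
      funext y
      exact Prod.ext (S.inertiaC_wedge_lift (norm_coe_sph _) y.2) rfl
    rw [h5]
    exact (IsInducing.id.prodMap (IsInducing.subtypeVal.prodMap IsInducing.subtypeVal)).comp
      IsInducing.subtypeVal

theorem continuous_flow {Φ : ℝ → S.phaseSpace → S.phaseSpace}
    (hΦ : ∀ x, S.IsSolution (fun t => Φ t x) ∧ Φ 0 x = x) (t : ℝ) : Continuous (Φ t) := by
  rw [S.isInducing_fullLift.continuous_iff, continuous_iff_continuousAt]
  intro y
  obtain ⟨χ, Ψ, hΨ⟩ := S.exists_isFlowOn_fullField (S.momentumEnergy y.1.1 + 1)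
  have h1 : ContinuousAt (fun y : S.phaseSpace => Ψ t (S.fullLift y)) y :=
    ((hΨ.continuous t).comp S.isInducing_fullLift.continuous).continuousAt
  refine h1.congr ?_
  filter_upwards [(S.isOpen_momentumEnergy_lt (X := S.phaseSpace) (f := fun y => y.1.1)
    (by fun_prop) _).mem_nhds (lt_add_one (S.momentumEnergy y.1.1))] with x hx
  have := IsSolution.fullLift_eq_flow S hΨ (hΦ x).1 (by rw [(hΦ x).2]; exact hx.le) t
  rw [(hΦ x).2] at this
  exact this.symm

theorem reducedFlow_toReduced (p : Sph n) {Φ : ℝ → S.reducedPhaseSpace → S.reducedPhaseSpace}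
    (hΦ : ∀ x, S.IsReducedSolution (fun t => Φ t x) ∧ Φ 0 x = x) {k : ℝ} {χ : E n × E n → ℝ}
    {Ψ : ℝ → E n × E n → E n × E n} (hΨ : IsFlowOn S.field {z | z.2 ≠ 0} (S.slab k) χ Ψ)
    {z : E n × E n} (hz : z ∈ S.slab k) (t : ℝ) :
    Φ t (S.toReduced p z) = S.toReduced p (Ψ t z) := by
  have h1 := S.isReducedSolution_toReduced p
    (fun t => S.snd_ne_zero_of_mem_slab (hΨ.mem _ hz t)) (hΨ.hasDerivAt hz)
  have h2 := (S.existsUnique_isReducedSolution (S.toReduced p z)).unique (hΦ _)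
    ⟨h1, by simp only [hΨ.isGlobalFlow.zero]⟩
  exact congrFun h2 t

end RubberBall

end RubberRolling

/-- A Haar measure of a compact group is invariant under right translations. -/
theorem MeasureTheory.Measure.map_mul_right_eq_of_compactSpace {G : Type*} [Group G]
    [TopologicalSpace G] [IsTopologicalGroup G] [CompactSpace G] [MeasurableSpace G] [BorelSpace G]
    (ν : Measure G) [ν.IsHaarMeasure] (g : G) : ν.map (· * g) = ν := by
  have hm : Measurable fun x : G => x * g := (continuous_mul_const g).measurable
  have : IsFiniteMeasure (ν.map (· * g)) := Measure.isFiniteMeasure_map ν _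
  -- The translate is again left invariant, so it is a multiple of `ν`; the total masses agree and
  -- are finite and nonzero.
  have h1 := Measure.isMulInvariant_eq_smul_of_compactSpace (ν.map (· * g)) ν
  have h2 : ν Set.univ = (ν.map (· * g)).haarScalarFactor ν • ν Set.univ := by
    conv_lhs => rw [← Set.preimage_univ (f := fun x : G => x * g),
      ← Measure.map_apply hm MeasurableSet.univ, h1]
    rfl
  have h3 : (((ν.map (· * g)).haarScalarFactor ν : ℝ≥0) : ENNReal) = 1 := by
    have h0 : ν Set.univ ≠ 0 := isOpen_univ.measure_ne_zero ν ⟨1, trivial⟩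
    have h4 : (1 : ENNReal) * ν Set.univ =
        (((ν.map (· * g)).haarScalarFactor ν : ℝ≥0) : ENNReal) * ν Set.univ := by
      rw [one_mul]
      exact h2
    exact ((ENNReal.mul_left_inj h0 (measure_ne_top ν _)).1 h4).symm
  rw [h1, ENNReal.coe_eq_one.1 h3, one_smul]

namespace RubberRolling

variable {n : ℕ}

/-! ### The rotation group -/

instance : CompactSpace (SO n) := by
  refine isCompact_iff_compactSpace.1 ?_
  have h1 : IsCompact (Set.pi Set.univ fun _ : Fin n =>
      (Set.pi Set.univ fun _ : Fin n => Set.Icc (-1 : ℝ) 1)) :=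
    isCompact_univ_pi fun _ => isCompact_univ_pi fun _ => isCompact_Icc
  refine IsCompact.of_isClosed_subset h1 ?_ ?_
  · have h2 : {g : Matrix (Fin n) (Fin n) ℝ | g * gᵀ = 1 ∧ g.det = 1} =
        (Matrix.specialOrthogonalGroup (Fin n) ℝ : Set (Matrix (Fin n) (Fin n) ℝ)) :=
      Set.ext fun g => RubberBall.mem_specialOrthogonalGroup_iff'.symm
    rw [← h2]
    exact (isClosed_eq (by fun_prop) continuous_const).inter
      (isClosed_eq (by fun_prop) continuous_const)
  · intro g hg i _ j _
    have h3 := congrFun (congrFun (RubberBall.mem_specialOrthogonalGroup_iff'.1 hg).1 i) i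
    rw [Matrix.mul_apply, Matrix.one_apply_eq] at h3
    have h4 : g i j * g i j ≤ ∑ k, g i k * gᵀ k i :=
      Finset.single_le_sum (f := fun k => g i k * gᵀ k i) (fun k _ => mul_self_nonneg (g i k))
        (Finset.mem_univ j)
    exact abs_le.1 (abs_le_one_iff_mul_self_le_one.2 (h4.trans h3.le))

instance : IsTopologicalGroup (SO n) where
  continuous_mul := (continuous_fst.subtype_val.mul continuous_snd.subtype_val).subtype_mk _
  continuous_inv := (Continuous.matrix_transpose continuous_subtype_val).subtype_mk _

namespace RubberBall

variable (S : RubberBall n)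

/-! ### The invariant measure of the reduced system -/

theorem continuous_twist_act : Continuous fun q : So n × E n =>
    S.angularVelocity q.1 - wedge ((S.angularVelocity q.1).act q.2) q.2 := by
  have h1 : Continuous fun q : So n × E n => S.angularVelocity q.1 :=
    S.angularVelocity.continuous_of_finiteDimensional.comp continuous_fst
  have h2 : Continuous fun q : So n × E n => actC (S.angularVelocity q.1) q.2 :=
    (actC.continuous.comp h1).clm_apply continuous_snd
  exact h1.sub ((contDiff_wedge (k := 0)).continuous.comp (h2.prodMk continuous_snd))

theorem measurableSet_reducedPhaseSpace : MeasurableSet S.reducedPhaseSpace := by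
  have h : S.reducedPhaseSpace = {x | S.angularVelocity x.1 -
      wedge ((S.angularVelocity x.1).act (x.2 : E n)) x.2 = 0} :=
    Set.ext fun x => (S.twist_eq_zero_iff (norm_coe_sph x.2)).trans sub_eq_zero.symm
  rw [h]
  exact (isClosed_eq (S.continuous_twist_act.comp (f := fun x : So n × Sph n => (x.1, (x.2 : E n)))
    (by fun_prop)) continuous_const).measurableSet

theorem measurableSet_phaseSpace : MeasurableSet S.phaseSpace :=
  S.measurableSet_reducedPhaseSpace.preimage
    (f := fun x : Ambient n => (x.1, x.2.2)) (by fun_prop)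

theorem measurable_toReduced (p : Sph n) : Measurable (S.toReduced p) := by
  refine Measurable.subtype_mk ?_
  exact (S.inertiaC.continuous.comp (contDiff_wedge (k := 0)).continuous).measurable.prodMk
    ((measurable_toSph p).comp measurable_snd)

theorem map_toReduced_apply [Nontrivial (E n)] (p : Sph n) {θ η ζ : ℝ → ℝ} (hθ : ContDiff ℝ 1 θ)
    (hη : ContDiff ℝ 1 η) (hζ : ContDiff ℝ 1 ζ) (hθ0 : ∀ s, 0 ≤ θ s) (hη0 : ∀ s, 0 ≤ η s)
    {s : Set S.reducedPhaseSpace} (hs : MeasurableSet s) :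
    ((volume : Measure (E n × E n)).withDensity fun z =>
      ENNReal.ofReal (S.weight θ η ζ z)).map (S.toReduced p) s = S.volumeRatio θ η *
        ∫⁻ y in s, ENNReal.ofReal (ζ (S.momentumEnergy y.1.1))
          ∂S.reducedVolume.comap (Subtype.val : S.reducedPhaseSpace → So n × Sph n) := by
  have hs' : MeasurableSet (Subtype.val '' s) :=
    (MeasurableEmbedding.subtype_coe S.measurableSet_reducedPhaseSpace).measurableSet_image.2 hs
  have hp : MeasurableSet (S.toReduced p ⁻¹' s) := S.measurable_toReduced p hs
  have key := S.lintegral_weight p hθ.continuous.measurable hη.continuous.measurable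
    hζ.continuous.measurable hθ0 hη0 (f := (Subtype.val '' s).indicator fun _ => 1)
    (measurable_const.indicator hs')
  rw [Measure.map_apply (S.measurable_toReduced p) hs, withDensity_apply _ hp,
    setLIntegral_subtype S.measurableSet_reducedPhaseSpace s
      fun x => ENNReal.ofReal (ζ (S.momentumEnergy x.1)), ← lintegral_indicator hp,
    ← lintegral_indicator hs']
  convert key using 1
  · refine lintegral_congr fun z => ?_
    by_cases hz : S.toReduced p z ∈ s
    · rw [Set.indicator_of_mem (Set.mem_preimage.2 hz),
        Set.indicator_of_mem (show
          (S.inertiaC (wedge z.1 z.2), toSph p z.2) ∈ Subtype.val '' s from ⟨_, hz, rfl⟩), one_mul]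
    · rw [Set.indicator_of_notMem (by exact hz), Set.indicator_of_notMem, zero_mul]
      rintro ⟨y, hy, hyz⟩
      exact hz (by rwa [show S.toReduced p z = y from Subtype.ext hyz.symm])
  · congr 1
    refine lintegral_congr fun x => ?_
    by_cases hx : x ∈ Subtype.val '' s <;> simp [hx]

theorem exists_cutoffs : ∃ θ η : ℝ → ℝ, ContDiff ℝ 1 θ ∧ ContDiff ℝ 1 η ∧ (∀ s, 0 ≤ θ s) ∧
    (∀ s, 0 ≤ η s) ∧ (∀ s, θ s ≠ 0 → 1 / 2 ≤ s ∧ s ≤ 2) ∧ (∀ s, η s ≠ 0 → |s| ≤ 1) ∧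
    θ 1 = 1 ∧ η 0 = 1 := by
  obtain ⟨θ, hθ, hθ0, hθ1, hθs⟩ := exists_cutoff 1 (a := 1 / 4) (b := 1 / 2) (by norm_num)
    (by norm_num)
  obtain ⟨η, hη, hη0, hη1, hηs⟩ := exists_cutoff 0 (a := 1 / 2) (b := 1) (by norm_num)
    (by norm_num)
  refine ⟨θ, η, hθ, hη, hθ0, hη0, fun s hs => ?_, fun s hs => ?_, hθ1 1 (by norm_num),
    hη1 0 (by norm_num)⟩
  · have := abs_le.1 (hθs s hs)
    constructor <;> linarith
  · simpa using hηs s hs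

/-- The weighted volumes on `ℝⁿ × ℝⁿ` project to invariant measures that agree with a multiple
of the reduced volume on the energy sublevels. -/
theorem exists_measure_sublevel [Nontrivial (E n)] (p : Sph n) :
    ∃ K : ENNReal, K ≠ 0 ∧ K ≠ ⊤ ∧ ∀ k : ℝ, 0 < k → ∃ M : Measure S.reducedPhaseSpace,
      IsFiniteMeasure M ∧
      (∀ s, MeasurableSet s → (∀ y ∈ s, S.momentumEnergy y.1.1 ≤ k) →
        M s = K * S.reducedVolume.comap
          (Subtype.val : S.reducedPhaseSpace → So n × Sph n) s) ∧
      ∀ Φ : ℝ → S.reducedPhaseSpace → S.reducedPhaseSpace,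
        (∀ x, S.IsReducedSolution (fun t => Φ t x) ∧ Φ 0 x = x) → ∀ t, M.map (Φ t) = M := by
  obtain ⟨θ, η, hθ, hη, hθ0, hη0, hθs, hηs, hθ1, hη1⟩ := exists_cutoffs
  obtain ⟨hK0, hKt⟩ := S.volumeRatio_ne p hθ hη hθ0 hη0 hθs hηs hθ1 hη1
  refine ⟨S.volumeRatio θ η, hK0, hKt, fun k hk => ?_⟩
  -- The energy is non-negative, so `ζ = 1` on the sublevel `k`, while the weight is supported in
  -- the slab of level `k + 1`.
  obtain ⟨ζ, hζ, hζ0, hζ1, hζs⟩ := exists_cutoff 0 hk (lt_add_one k)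
  have hζs' : ∀ s, ζ s ≠ 0 → s ≤ k + 1 := fun s hs => by
    have := hζs s hs
    rw [sub_zero] at this
    exact (le_abs_self s).trans this
  obtain ⟨χ, Ψ, hΨ⟩ := S.exists_isFlowOn_field (k + 1)
  have hw0 := S.weight_nonneg hθ0 hη0 hζ0 hθs
  have hc := (S.contDiff_weight hθ hη hζ hθs).continuous
  have hpres := S.measurePreserving_of_isFlowOn_field hΨ hθ hη hζ hθs hηs hζs' hw0
  set W := (volume : Measure (E n × E n)).withDensity fun z => ENNReal.ofReal (S.weight θ η ζ z)
    with hW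
  have hr := S.measurable_toReduced p
  have hfin : IsFiniteMeasure W := by
    have hint : Integrable (S.weight θ η ζ) volume :=
      Continuous.integrable_of_hasCompactSupport (μ := (volume : Measure (E n × E n))) hc
        (S.hasCompactSupport_weight hθs hηs hζs')
    exact isFiniteMeasure_withDensity_ofReal hint.2
  refine ⟨W.map (S.toReduced p), inferInstance, fun s hs hsk => ?_, fun Φ hΦ t => ?_⟩
  · rw [S.map_toReduced_apply p hθ hη hζ hθ0 hη0 hs]
    congr 1
    rw [← setLIntegral_one]
    refine setLIntegral_congr_fun hs fun y hy => ?_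
    rw [hζ1 _ (by rw [sub_zero, abs_of_nonneg (S.momentumEnergy_nonneg _)]; exact hsk y hy),
      ENNReal.ofReal_one]
  · have hΦm : Measurable (Φ t) := (S.continuous_reducedFlow hΦ t).measurable
    rw [Measure.map_map hΦm hr]
    -- The projection intertwines the two flows on the slab, and off the slab the weight is zero.
    have hae : Φ t ∘ S.toReduced p =ᵐ[W] S.toReduced p ∘ Ψ t := by
      rw [EventuallyEq, hW, ae_withDensity_iff hc.measurable.ennreal_ofReal]
      refine Eventually.of_forall fun z hz => ?_
      refine S.reducedFlow_toReduced p hΦ hΨ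
        (S.mem_slab_of_weight_ne_zero hθs hηs hζs' fun h => hz ?_) t
      rw [h, ENNReal.ofReal_zero]
    rw [Measure.map_congr hae, ← Measure.map_map hr (hpres t).measurable, (hpres t).map_eq]

theorem measurable_momentumEnergy_reduced :
    Measurable fun y : S.reducedPhaseSpace => S.momentumEnergy y.1.1 :=
  S.continuous_momentumEnergy.measurable.comp (measurable_fst.comp measurable_subtype_coe)

/-- The levels are shifted by one because the cutoff construction needs a positive level. -/
theorem iUnion_sublevel (s : Set S.reducedPhaseSpace) :
    ⋃ k : ℕ, s ∩ {y | S.momentumEnergy y.1.1 ≤ (k : ℝ) + 1} = s := by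
  rw [← Set.inter_iUnion, Set.inter_eq_left]
  intro y _
  obtain ⟨k, hk⟩ := exists_nat_ge (S.momentumEnergy y.1.1)
  exact Set.mem_iUnion.2 ⟨k, hk.trans (le_add_of_nonneg_right zero_le_one)⟩

theorem sigmaFinite_reducedVolume [Nontrivial (E n)] (p : Sph n) : SigmaFinite
    (S.reducedVolume.comap (Subtype.val : S.reducedPhaseSpace → So n × Sph n)) := by
  obtain ⟨K, hK0, -, hK⟩ := S.exists_measure_sublevel p
  refine ⟨⟨⟨fun k : ℕ => Set.univ ∩ {y | S.momentumEnergy y.1.1 ≤ (k : ℝ) + 1}, fun _ => trivial,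
    fun k => ?_, S.iUnion_sublevel _⟩⟩⟩
  obtain ⟨M, hM, hMs, -⟩ := hK ((k : ℝ) + 1) (by positivity)
  have h1 := hMs (Set.univ ∩ {y | S.momentumEnergy y.1.1 ≤ (k : ℝ) + 1})
    (MeasurableSet.univ.inter (measurableSet_le S.measurable_momentumEnergy_reduced
      measurable_const)) fun y hy => hy.2
  refine lt_top_iff_ne_top.2 fun h => ?_
  rw [h, ENNReal.mul_top hK0] at h1
  exact measure_ne_top M _ h1

/-- Energy is conserved, so taking preimages commutes with truncation to a sublevel. On each
sublevel the reduced measure is proportional to an invariant finite measure, with a ratio that is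
nonzero, finite and the same for all levels; monotone exhaustion finishes. -/
theorem measurePreserving_reducedFlow [Nontrivial (E n)] (p : Sph n)
    {Φ : ℝ → S.reducedPhaseSpace → S.reducedPhaseSpace}
    (hΦ : ∀ x, S.IsReducedSolution (fun t => Φ t x) ∧ Φ 0 x = x) (t : ℝ) :
    MeasurePreserving (Φ t)
      (S.reducedVolume.comap (Subtype.val : S.reducedPhaseSpace → So n × Sph n))
      (S.reducedVolume.comap (Subtype.val : S.reducedPhaseSpace → So n × Sph n)) := by
  have hΦm : Measurable (Φ t) := (S.continuous_reducedFlow hΦ t).measurable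
  have he : ∀ x, S.momentumEnergy (Φ t x).1.1 = S.momentumEnergy x.1.1 := fun x => by
    have := IsReducedSolution.momentumEnergy_eq S (hΦ x).1 t
    rwa [(hΦ x).2] at this
  obtain ⟨K, hK0, hKt, hK⟩ := S.exists_measure_sublevel p
  refine ⟨hΦm, Measure.ext fun s hs => ?_⟩
  rw [Measure.map_apply hΦm hs]
  have hsub : ∀ k : ℕ, MeasurableSet {y : S.reducedPhaseSpace |
      S.momentumEnergy y.1.1 ≤ (k : ℝ) + 1} := fun k =>
    measurableSet_le S.measurable_momentumEnergy_reduced measurable_const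
  have hmono : ∀ s : Set S.reducedPhaseSpace,
      Monotone fun k : ℕ => s ∩ {y | S.momentumEnergy y.1.1 ≤ (k : ℝ) + 1} :=
    fun s i j hij x hx => ⟨hx.1, (show S.momentumEnergy x.1.1 ≤ (i : ℝ) + 1 from hx.2).trans
      (add_le_add (Nat.cast_le.2 hij) le_rfl)⟩
  rw [← S.iUnion_sublevel (Φ t ⁻¹' s), (hmono _).measure_iUnion]
  conv_rhs => rw [← S.iUnion_sublevel s, (hmono _).measure_iUnion]
  refine iSup_congr fun k => ?_
  obtain ⟨M, -, hMs, hMΦ⟩ := hK ((k : ℝ) + 1) (by positivity)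
  have h1 := hMs _ (hs.inter (hsub k)) fun y hy => hy.2
  have h2 := hMs _ ((hΦm hs).inter (hsub k)) fun y hy => hy.2
  have h3 : Φ t ⁻¹' s ∩ {y | S.momentumEnergy y.1.1 ≤ (k : ℝ) + 1} =
      Φ t ⁻¹' (s ∩ {y | S.momentumEnergy y.1.1 ≤ (k : ℝ) + 1}) := by
    ext x
    simp only [Set.mem_inter_iff, Set.mem_preimage, Set.mem_ofPred_eq, he]
  rw [h3, ← Measure.map_apply hΦm (hs.inter (hsub k)), hMΦ Φ hΦ t, h1, ← h3] at h2
  exact ((ENNReal.mul_right_inj hK0 hKt).1 h2).symm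

end RubberBall

end RubberRolling

namespace RubberRolling

variable {n : ℕ}

namespace RubberBall

variable (S : RubberBall n)

/-! ### The invariant measure of the full system -/

/-- The projection of the phase space to the reduced phase space. -/
def reduce (x : S.phaseSpace) : S.reducedPhaseSpace := ⟨(x.1.1, x.1.2.2), x.2⟩

/-- The point of the phase space over a point of the reduced phase space. -/
def assemble (q : S.reducedPhaseSpace × SO n) : S.phaseSpace :=
  ⟨(q.1.1.1, q.2, q.1.1.2), q.1.2⟩

theorem continuous_assemble : Continuous S.assemble := by
  refine Continuous.subtype_mk ?_ _
  exact (by fun_prop : Continuous fun q : S.reducedPhaseSpace × SO n => (q.1.1.1, q.2, q.1.1.2))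

theorem measurable_assemble : Measurable S.assemble :=
  Measurable.subtype_mk (by fun_prop)

theorem IsSolution.reduce {c : ℝ → S.phaseSpace} (hc : S.IsSolution c) :
    S.IsReducedSolution fun t => S.reduce (c t) := fun t => ⟨(hc t).1, (hc t).2.2⟩

theorem IsSolution.mul_left {c : ℝ → S.phaseSpace} (hc : S.IsSolution c) (g : SO n) :
    S.IsSolution fun t => S.assemble (S.reduce (c t), g * (c t).1.2.1) := fun t => by
  refine ⟨(hc t).1, fun i j => ?_, (hc t).2.2⟩
  have h1 := (hc t).2.1
  have h2 : HasDerivAt (fun s => ∑ k, (g : Matrix (Fin n) (Fin n) ℝ) i k *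
      ((c s).1.2.1 : Matrix (Fin n) (Fin n) ℝ) k j)
      (∑ k, (g : Matrix (Fin n) (Fin n) ℝ) i k * (((c t).1.2.1 : Matrix (Fin n) (Fin n) ℝ) *
        (S.angularVelocity (c t).1.1).mat) k j) t :=
    HasDerivAt.fun_sum fun k _ => (h1 k j).const_mul _
  have h3 : ∀ s, (((S.assemble (S.reduce (c s), g * (c s).1.2.1)).1.2.1 : SO n) :
      Matrix (Fin n) (Fin n) ℝ) = g * ((c s).1.2.1 : Matrix (Fin n) (Fin n) ℝ) := fun s => rfl
  simp only [h3]
  rw [Matrix.mul_assoc]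
  exact h2

/-- Left translates of solutions are solutions, so by uniqueness the solution through `g` is `g`
times the one through `1`. Hence the flow acts on the group by right multiplication with an element
that depends on the reduced point alone. -/
theorem flow_eq {Φ : ℝ → S.phaseSpace → S.phaseSpace}
    (hΦ : ∀ x, S.IsSolution (fun t => Φ t x) ∧ Φ 0 x = x) (t : ℝ) (y : S.reducedPhaseSpace)
    (g : SO n) : Φ t (S.assemble (y, g)) =
      S.assemble (S.reduce (Φ t (S.assemble (y, 1))), g * (Φ t (S.assemble (y, 1))).1.2.1) := by
  have h1 := IsSolution.mul_left S (hΦ (S.assemble (y, 1))).1 g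
  refine congrFun ((S.existsUnique_isSolution (S.assemble (y, g))).unique (hΦ _) ⟨h1, ?_⟩) t
  simp only [(hΦ (S.assemble (y, 1))).2]
  change S.assemble (y, g * 1) = _
  rw [mul_one]

/-- Neither the constraints nor the density involve `g`, and `|Ω^d|` is `d!` times the product
volume, so the measure on the phase space is a product. -/
theorem comap_phaseVolume_eq (ν : Measure (SO n)) [SFinite ν] :
    (S.phaseVolume ν).comap (Subtype.val : S.phaseSpace → Ambient n) =
      ENNReal.ofReal (Module.finrank ℝ (So n)).factorial •
        ((S.reducedVolume.comap (Subtype.val : S.reducedPhaseSpace → So n × Sph n)).prod ν).map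
          S.assemble := by
  refine Measure.ext fun s hs => ?_
  have hemb := MeasurableEmbedding.subtype_coe S.measurableSet_phaseSpace
  have hs' : MeasurableSet (Subtype.val '' s) := hemb.measurableSet_image.2 hs
  have hmem : ∀ (y : S.reducedPhaseSpace) (g : SO n),
      ((y.1.1, g, y.1.2) : Ambient n) ∈ Subtype.val '' s ↔ S.assemble (y, g) ∈ s := fun y g =>
    Subtype.val_injective.mem_set_image (a := S.assemble (y, g))
  have hf : Measurable ((Subtype.val '' s).indicator fun _ : Ambient n => (1 : ENNReal)) :=
    measurable_const.indicator hs'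
  have h1 := S.lintegral_phaseVolume ν hf
  rw [lintegral_indicator hs', setLIntegral_one] at h1
  rw [hemb.comap_apply, h1, Measure.smul_apply, Measure.map_apply S.measurable_assemble hs,
    Measure.prod_apply (S.measurable_assemble hs), smul_eq_mul]
  congr 1
  have h2 : ∀ y : So n × Sph n, ∫⁻ g, (Subtype.val '' s).indicator
      (fun _ : Ambient n => (1 : ENNReal)) (y.1, g, y.2) ∂ν =
      S.reducedPhaseSpace.indicator (fun y => ∫⁻ g, (Subtype.val '' s).indicator
        (fun _ : Ambient n => (1 : ENNReal)) (y.1, g, y.2) ∂ν) y := fun y => by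
    by_cases hy : y ∈ S.reducedPhaseSpace
    · rw [Set.indicator_of_mem hy]
    · rw [Set.indicator_of_notMem hy, ← lintegral_zero (μ := ν)]
      refine lintegral_congr fun g => Set.indicator_of_notMem ?_ _
      rintro ⟨x, -, hx⟩
      refine hy ?_
      have h3 := x.2
      rw [hx] at h3
      exact h3
  rw [lintegral_congr h2, lintegral_indicator S.measurableSet_reducedPhaseSpace,
    ← lintegral_subtype_comap S.measurableSet_reducedPhaseSpace]
  refine lintegral_congr fun y => ?_
  have h4 : MeasurableSet (Prod.mk y ⁻¹' (S.assemble ⁻¹' s)) :=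
    measurable_prodMk_left (S.measurable_assemble hs)
  rw [← lintegral_indicator_one h4]
  refine lintegral_congr fun g => ?_
  by_cases hg : S.assemble (y, g) ∈ s
  · rw [Set.indicator_of_mem ((hmem y g).2 hg), Set.indicator_of_mem (by exact hg), Pi.one_apply]
  · rw [Set.indicator_of_notMem (fun h => hg ((hmem y g).1 h)),
      Set.indicator_of_notMem (by exact hg)]

/-- The flow is a skew product: the reduced flow on the base, and right translations, which preserve
the Haar measure of a compact group, on the fibres. -/
theorem measurePreserving_flow [Nontrivial (E n)] (p : Sph n) (ν : Measure (SO n))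
    [ν.IsHaarMeasure] {Φ : ℝ → S.phaseSpace → S.phaseSpace}
    (hΦ : ∀ x, S.IsSolution (fun t => Φ t x) ∧ Φ 0 x = x) (t : ℝ) :
    MeasurePreserving (Φ t)
      ((S.phaseVolume ν).comap (Subtype.val : S.phaseSpace → Ambient n))
      ((S.phaseVolume ν).comap (Subtype.val : S.phaseSpace → Ambient n)) := by
  have hΦm : Measurable (Φ t) := (S.continuous_flow hΦ t).measurable
  let φ : ℝ → S.reducedPhaseSpace → S.reducedPhaseSpace :=
    fun t y => S.reduce (Φ t (S.assemble (y, 1)))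
  have hφ : ∀ y, S.IsReducedSolution (fun t => φ t y) ∧ φ 0 y = y := fun y =>
    ⟨IsSolution.reduce S (hΦ _).1, congrArg S.reduce (hΦ (S.assemble (y, 1))).2⟩
  have hφt := S.measurePreserving_reducedFlow p hφ t
  have hσ := S.sigmaFinite_reducedVolume p
  have h1 : Continuous fun y : S.reducedPhaseSpace => (Φ t (S.assemble (y, 1))).1.2.1 :=
    continuous_fst.comp (continuous_snd.comp (continuous_subtype_val.comp
      ((S.continuous_flow hΦ t).comp (S.continuous_assemble.comp
        (continuous_id.prodMk continuous_const)))))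
  have hskew := hφt.skew_product (μc := ν) (μd := ν)
    (g := fun y g => g * (Φ t (S.assemble (y, 1))).1.2.1)
    (continuous_snd.mul (h1.comp continuous_fst)).measurable
    (Eventually.of_forall fun y => Measure.map_mul_right_eq_of_compactSpace ν _)
  refine ⟨hΦm, ?_⟩
  rw [comap_phaseVolume_eq, Measure.map_smul, Measure.map_map hΦm S.measurable_assemble]
  have h2 : Φ t ∘ S.assemble = S.assemble ∘ fun q : S.reducedPhaseSpace × SO n =>
      (φ t q.1, q.2 * (Φ t (S.assemble (q.1, 1))).1.2.1) :=
    funext fun q => S.flow_eq hΦ t q.1 q.2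
  rw [h2, ← Measure.map_map S.measurable_assemble hskew.measurable, hskew.map_eq]

end RubberBall

end RubberRolling

end

theorem theorem3p1 (n : ℕ) (hn : 2 ≤ n) (S : RubberRolling.RubberBall n)
    (ν : MeasureTheory.Measure (RubberRolling.SO n)) [ν.IsHaarMeasure] :
    RubberRolling.IsInvariantMeasure S.IsSolution
      ((S.phaseVolume ν).comap (Subtype.val : S.phaseSpace → RubberRolling.RubberBall.Ambient n)) ∧
    RubberRolling.IsInvariantMeasure S.IsReducedSolution
      (S.reducedVolume.comap
        (Subtype.val : S.reducedPhaseSpace → RubberRolling.So n × RubberRolling.Sph n)) := by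
  have : Nonempty (Fin n) := ⟨⟨0, by omega⟩⟩
  have : Nontrivial (RubberRolling.E n) :=
    Module.nontrivial_of_finrank_pos (R := ℝ) (by
      rw [finrank_euclideanSpace, Fintype.card_fin]
      omega)
  obtain ⟨p, hp⟩ := NormedSpace.sphere_nonempty (E := RubberRolling.E n) (x := 0) (r := 1) |>.2
    zero_le_one
  exact ⟨⟨S.existsUnique_isSolution, fun Φ hΦ t => S.measurePreserving_flow ⟨p, hp⟩ ν hΦ t⟩,
    ⟨S.existsUnique_isReducedSolution, fun Φ hΦ t => S.measurePreserving_reducedFlow ⟨p, hp⟩ hΦ t⟩⟩
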